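/- Let $k$ be an algebraically closed field of characteristic zero, let $A$ be a finitely generated commutative $k$-algebra and $X=\operatorname{Spec}A$, let $\mathfrak g$ be a finite dimensional Lie superalgebra over $k$, and let $\Gamma$ be a finite group acting on $A$ by $k$-algebra automorphisms and on $\mathfrak g$ by Lie superalgebra automorphisms. Let $X_{\mathrm{rat}}$ be the set of maximal ideals $\mathfrak m$ of $A$ with $A/\mathfrak m=k$, and assume that $\Gamma$ acts freely on $X_{\mathrm{rat}}$. Let $(\mathfrak g\otimes A)^\Gamma$ be the Lie superalgebra of $\Gamma$-fixed points of $\mathfrak g\otimes A$ under $\gamma(u\otimes f)=\gamma u\otimes\gamma f$. All representations are on $\mathbb Z/2$-graded vector spaces. Irreducible means nonzero and without graded subrepresentations other than $0$ and the whole space. Isomorphisms are homogeneous of even or odd degree (so a representation is identified with its parity shift). For $\mathfrak m\in X_{\mathrm{rat}}$ let $\mathrm{ev}_{\mathfrak m}^\Gamma:(\mathfrak g\otimes A)^\Gamma\to\mathfrak g\otimes A/\mathfrak m=\mathfrak g$ be the evaluation homomorphism. An *evaluation representation* of $(\mathfrak g\otimes A)^\Gamma$ is a tensor product $\bigotimes_{i=1}^{\ell}\rho_i\circ\mathrm{ev}^\Gamma_{\mathfrak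 m_i}$ with $\ell\ge 0$, pairwise distinct $\mathfrak m_1,\dots,\mathfrak m_\ell\in X_{\mathrm{rat}}$ and finite dimensional representations $\rho_i$ of $\mathfrak g$; for $\ell=0$ it is the trivial representation. Let $\mathcal R(\mathfrak g)$ be the set of isomorphism classes of irreducible finite dimensional representations of $\mathfrak g$, on which $\Gamma$ acts by $\gamma[\rho]=[\rho\circ\gamma^{-1}]$. Let $\mathcal E(X,\mathfrak g)^\Gamma$ be the set of $\Gamma$-equivariant functions $\Psi:X_{\mathrm{rat}}\to\mathcal R(\mathfrak g)$ of finite support, the support being the set of points at which $\Psi$ is not the class of the trivial representation. For $\Psi\in\mathcal E(X,\mathfrak g)^\Gamma$ let $\mathrm{ev}^\Gamma_\Psi$ be the isomorphism class of $\bigotimes_{\mathfrak m\in M}\rho_{\mathfrak m}\circ\mathrm{ev}^\Gamma_{\mathfrak m}$, where $M$ contains exactly one point of each $\Gamma$-orbit in the support of $\Psi$ and $[\rho_{\mathfrak m}]=\Psi(\mathfrak m)$. Suppose that $\mathfrak g$ is a reductive Lie algebra, a basic classical Lie superalgebra (that is, simple, with $\mathfrak g_{\bar 1}$ completely reducible over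 $\mathfrak g_{\bar 0}$, and with a non-degenerate even invariant bilinear form), or isomorphic to $\mathfrak{sl}(n,n)$ for some $n\ge 1$. Then: 1. for every $\Psi\in\mathcal E(X,\mathfrak g)^\Gamma$, the class $\mathrm{ev}^\Gamma_\Psi$ does not depend on the choice of $M$, of the order of its points, or of the representatives $\rho_{\mathfrak m}$; 2. $\mathrm{ev}^\Gamma_\Psi$ is irreducible for every $\Psi\in\mathcal E(X,\mathfrak g)^\Gamma$; 3. $\Psi\mapsto\mathrm{ev}^\Gamma_\Psi$ is a bijection from $\mathcal E(X,\mathfrak g)^\Gamma$ onto the set of isomorphism classes of irreducible evaluation representations of $(\mathfrak g\otimes A)^\Gamma$. -/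

import Mathlib

open scoped TensorProduct

universe u v w

/-! ### Super vector spaces -/

/-- A `ℤ/2`-grading `V = V₀ ⊕ V₁` of a vector space `V`. -/
structure SuperGrading (k : Type*) (V : Type*) [Field k] [AddCommGroup V] [Module k V] where
  gr : ZMod 2 → Submodule k V
  isCompl : IsCompl (gr 0) (gr 1)

/-- The sign `(-1)^(i j)`. -/
def superSign (k : Type*) [Field k] (i j : ZMod 2) : k := if i = 1 ∧ j = 1 then -1 else 1

theorem zmod_two_cases (i : ZMod 2) : i = 0 ∨ i = 1 := by
  revert i; decide

theorem superSign_zero_left (k : Type*) [Field k] (j : ZMod 2) : superSign k 0 j = 1 := by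
  simp [superSign]

theorem superSign_zero_right (k : Type*) [Field k] (i : ZMod 2) : superSign k i 0 = 1 := by
  simp [superSign]

theorem superSign_one_one (k : Type*) [Field k] : superSign k 1 1 = -1 := by
  simp [superSign]

namespace SuperGrading

variable {k : Type*} {V : Type*} [Field k] [AddCommGroup V] [Module k V]

/-- The projection onto the component of degree `i` along the other component. -/
noncomputable def proj (G : SuperGrading k V) (i : ZMod 2) : V →ₗ[k] V :=
  if i = 0 then (G.gr 0).projection (G.gr 1) G.isCompl
  else (G.gr 1).projection (G.gr 0) G.isCompl.symm

/-- The parity operator `v ↦ (-1)^j v` for `v ∈ V_j`. -/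
noncomputable def parity (G : SuperGrading k V) : V →ₗ[k] V := G.proj 0 - G.proj 1

/-- `U = (U ∩ V₀) ⊕ (U ∩ V₁)`. -/
def IsGraded (G : SuperGrading k V) (U : Submodule k V) : Prop :=
  ∀ u ∈ U, ∀ i, G.proj i u ∈ U

theorem proj_mem (G : SuperGrading k V) (i : ZMod 2) (x : V) : G.proj i x ∈ G.gr i := by
  fin_cases i
  · exact Submodule.projection_apply_mem G.isCompl x
  · exact Submodule.projection_apply_mem G.isCompl.symm x

theorem proj_of_mem (G : SuperGrading k V) {i : ZMod 2} {x : V} (hx : x ∈ G.gr i) :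
    G.proj i x = x := by
  fin_cases i
  · exact Submodule.projection_apply_of_mem_left G.isCompl hx
  · exact Submodule.projection_apply_of_mem_left G.isCompl.symm hx

theorem proj_of_mem_ne (G : SuperGrading k V) {i j : ZMod 2} (h : i ≠ j) {x : V}
    (hx : x ∈ G.gr j) : G.proj i x = 0 := by
  fin_cases i <;> fin_cases j
  · exact absurd rfl h
  · exact Submodule.projection_apply_of_mem_right G.isCompl hx
  · exact Submodule.projection_apply_of_mem_right G.isCompl.symm hx
  · exact absurd rfl h

theorem proj_add_proj (G : SuperGrading k V) (x : V) : G.proj 0 x + G.proj 1 x = x := by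
  obtain ⟨a, ha, b, hb, rfl⟩ : ∃ a ∈ G.gr 0, ∃ b ∈ G.gr 1, a + b = x :=
    Submodule.mem_sup.1 (by rw [G.isCompl.sup_eq_top]; trivial)
  simp only [map_add]
  rw [G.proj_of_mem ha, G.proj_of_mem hb, G.proj_of_mem_ne (by decide) ha,
    G.proj_of_mem_ne (by decide) hb]
  simp

theorem parity_of_mem (G : SuperGrading k V) {j : ZMod 2} {x : V} (hx : x ∈ G.gr j) :
    G.parity x = superSign k 1 j • x := by
  rcases zmod_two_cases j with rfl | rfl
  · have h : G.proj 1 x = 0 := G.proj_of_mem_ne (by decide) hx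
    rw [parity, LinearMap.sub_apply, h, G.proj_of_mem hx, superSign_zero_right, one_smul, sub_zero]
  · have h : G.proj 0 x = 0 := G.proj_of_mem_ne (by decide) hx
    rw [parity, LinearMap.sub_apply, h, G.proj_of_mem hx, superSign_one_one, neg_one_smul,
      zero_sub]

theorem isCompl_of (P : ZMod 2 → Submodule k V) (f : V →ₗ[k] V) (hs : P 0 ⊔ P 1 = ⊤)
    (h0 : ∀ x ∈ P 0, f x = x) (h1 : ∀ x ∈ P 1, f x = 0) : IsCompl (P 0) (P 1) := by
  refine ⟨Submodule.disjoint_def.2 fun x hx hx' => ?_, codisjoint_iff.2 hs⟩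
  rw [← h0 x hx, h1 x hx']

/-- Two linear maps that agree on homogeneous vectors are equal. -/
theorem hom_ext (G : SuperGrading k V) {W : Type*} [AddCommGroup W] [Module k W]
    {f f' : V →ₗ[k] W} (h : ∀ i, ∀ x ∈ G.gr i, f x = f' x) : f = f' := by
  ext x
  rw [← G.proj_add_proj x, map_add, map_add, h 0 _ (G.proj_mem 0 x), h 1 _ (G.proj_mem 1 x)]

variable {W : Type*} [AddCommGroup W] [Module k W]

/-- The grading of a tensor product: `(V ⊗ W)_n` is spanned by the `v ⊗ w` with `v ∈ V_i`,
`w ∈ W_j`, `i + j = n`. -/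
noncomputable def tensor (G : SuperGrading k V) (H : SuperGrading k W) :
    SuperGrading k (V ⊗[k] W) where
  gr n := Submodule.span k {t | ∃ i j, i + j = n ∧ ∃ v ∈ G.gr i, ∃ w ∈ H.gr j, v ⊗ₜ[k] w = t}
  isCompl := by
    apply isCompl_of (fun n => Submodule.span k
      {t | ∃ i j, i + j = n ∧ ∃ v ∈ G.gr i, ∃ w ∈ H.gr j, v ⊗ₜ[k] w = t})
      (TensorProduct.map (G.proj 0) (H.proj 0) + TensorProduct.map (G.proj 1) (H.proj 1))
    · refine eq_top_iff.2 fun t _ => ?_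
      induction t with
      | zero => exact zero_mem _
      | add a b ha hb => exact add_mem (ha trivial) (hb trivial)
      | tmul v w =>
        rw [← G.proj_add_proj v, ← H.proj_add_proj w]
        simp only [TensorProduct.add_tmul, TensorProduct.tmul_add]
        have key : ∀ i j, G.proj i v ⊗ₜ[k] H.proj j w ∈ Submodule.span k
            {t | ∃ i' j', i' + j' = i + j ∧ ∃ v ∈ G.gr i', ∃ w ∈ H.gr j', v ⊗ₜ[k] w = t} :=
          fun i j => Submodule.subset_span
            ⟨i, j, rfl, _, G.proj_mem i v, _, H.proj_mem j w, rfl⟩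
        refine add_mem (add_mem ?_ ?_) (add_mem ?_ ?_)
        · exact Submodule.mem_sup_left (key 0 0)
        · exact Submodule.mem_sup_right (key 1 0)
        · exact Submodule.mem_sup_right (key 0 1)
        · exact Submodule.mem_sup_left (key 1 1)
    · intro x hx
      induction hx using Submodule.span_induction with
      | zero => simp
      | add a b _ _ ha hb => rw [map_add, ha, hb]
      | smul c a _ ha => rw [map_smul, ha]
      | mem a ha =>
        obtain ⟨i, j, hij, v, hv, w, hw, rfl⟩ := ha
        have hj : j = i := by clear hv hw; revert i j; decide
        subst hj
        fin_cases j
        · have e1 : G.proj 0 v = v := G.proj_of_mem (i := 0) hv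
          have e2 : H.proj 0 w = w := H.proj_of_mem (i := 0) hw
          have e3 : G.proj 1 v = 0 := G.proj_of_mem_ne (j := 0) (by decide) hv
          simp [e1, e2, e3]
        · have e1 : G.proj 1 v = v := G.proj_of_mem (i := 1) hv
          have e2 : H.proj 1 w = w := H.proj_of_mem (i := 1) hw
          have e3 : G.proj 0 v = 0 := G.proj_of_mem_ne (j := 1) (by decide) hv
          simp [e1, e2, e3]
    · intro x hx
      induction hx using Submodule.span_induction with
      | zero => simp
      | add a b _ _ ha hb => rw [map_add, ha, hb, add_zero]
      | smul c a _ ha => rw [map_smul, ha, smul_zero]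
      | mem a ha =>
        obtain ⟨i, j, hij, v, hv, w, hw, rfl⟩ := ha
        have hj : j = i + 1 := by clear hv hw; revert i j; decide
        have hl : ∀ l : ZMod 2, l ≠ i ∨ l ≠ j := by subst hj; clear hv hw hij; revert i; decide
        have key : ∀ l, G.proj l v ⊗ₜ[k] H.proj l w = 0 := fun l => by
          rcases hl l with h | h
          · rw [G.proj_of_mem_ne h hv, TensorProduct.zero_tmul]
          · rw [H.proj_of_mem_ne h hw, TensorProduct.tmul_zero]
        simp [key]

theorem tmul_mem (G : SuperGrading k V) (H : SuperGrading k W) {i j : ZMod 2} {v : V} {w : W}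
    (hv : v ∈ G.gr i) (hw : w ∈ H.gr j) : v ⊗ₜ[k] w ∈ (G.tensor H).gr (i + j) :=
  Submodule.subset_span ⟨i, j, rfl, v, hv, w, hw, rfl⟩

/-- The grading `(V ⊗ A)_i = V_i ⊗ A`. -/
noncomputable def tensorEven (G : SuperGrading k V) (A : Type*) [AddCommGroup A] [Module k A] :
    SuperGrading k (V ⊗[k] A) where
  gr i := Submodule.span k {t | ∃ x ∈ G.gr i, ∃ a : A, x ⊗ₜ[k] a = t}
  isCompl := by
    apply isCompl_of (fun i => Submodule.span k {t | ∃ x ∈ G.gr i, ∃ a : A, x ⊗ₜ[k] a = t})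
      ((G.proj 0).rTensor A)
    · refine eq_top_iff.2 fun t _ => ?_
      induction t with
      | zero => exact zero_mem _
      | add a b ha hb => exact add_mem (ha trivial) (hb trivial)
      | tmul v a =>
        rw [← G.proj_add_proj v, TensorProduct.add_tmul]
        exact add_mem (Submodule.mem_sup_left (Submodule.subset_span ⟨_, G.proj_mem 0 v, a, rfl⟩))
          (Submodule.mem_sup_right (Submodule.subset_span ⟨_, G.proj_mem 1 v, a, rfl⟩))
    · intro x hx
      induction hx using Submodule.span_induction with
      | zero => simp
      | add a b _ _ ha hb => rw [map_add, ha, hb]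
      | smul c a _ ha => rw [map_smul, ha]
      | mem a ha =>
        obtain ⟨v, hv, a, rfl⟩ := ha
        rw [LinearMap.rTensor_tmul, G.proj_of_mem hv]
    · intro x hx
      induction hx using Submodule.span_induction with
      | zero => simp
      | add a b _ _ ha hb => rw [map_add, ha, hb, add_zero]
      | smul c a _ ha => rw [map_smul, ha, smul_zero]
      | mem a ha =>
        obtain ⟨v, hv, a, rfl⟩ := ha
        rw [LinearMap.rTensor_tmul, G.proj_of_mem_ne (by decide) hv, TensorProduct.zero_tmul]

theorem tensorEven_induction (G : SuperGrading k V) {A : Type*} [AddCommGroup A] [Module k A]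
    {i : ZMod 2} {p : V ⊗[k] A → Prop} (h0 : p 0) (ha : ∀ s t, p s → p t → p (s + t))
    (ht : ∀ x ∈ G.gr i, ∀ a : A, p (x ⊗ₜ a)) {t : V ⊗[k] A} (h : t ∈ (G.tensorEven A).gr i) :
    p t := by
  suffices H : ∀ c : k, p (c • t) by simpa using H 1
  induction h using Submodule.span_induction with
  | zero => intro c; simpa using h0
  | add a b _ _ h1 h2 => intro c; rw [smul_add]; exact ha _ _ (h1 c) (h2 c)
  | smul d a _ h1 => intro c; rw [smul_smul]; exact h1 (c * d)
  | mem a h =>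
    intro c
    obtain ⟨v, hv, a, rfl⟩ := h
    rw [TensorProduct.smul_tmul']
    exact ht _ (Submodule.smul_mem _ _ hv) a

/-- The grading induced on a graded subspace. -/
noncomputable def restrict (G : SuperGrading k V) (S : Submodule k V) (hS : G.IsGraded S) :
    SuperGrading k S where
  gr i := (G.gr i).comap S.subtype
  isCompl := by
    refine ⟨Submodule.disjoint_def.2 fun x hx hx' => ?_, codisjoint_iff.2 ?_⟩
    · exact Subtype.ext (Submodule.disjoint_def.1 G.isCompl.disjoint _ hx hx')
    · refine eq_top_iff.2 fun x _ => Submodule.mem_sup.2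
        ⟨⟨_, hS x x.2 0⟩, G.proj_mem 0 x, ⟨_, hS x x.2 1⟩, G.proj_mem 1 x, ?_⟩
      exact Subtype.ext (G.proj_add_proj x)

end SuperGrading

/-! ### Lie superalgebras -/

/-- A Lie superalgebra over a field `k` (of characteristic different from `2` and `3`). -/
class LieSuperalgebra (k : Type*) (L : Type*) [Field k] [AddCommGroup L] [Module k L] where
  grading : SuperGrading k L
  bracket : L →ₗ[k] L →ₗ[k] L
  bracket_mem : ∀ {i j : ZMod 2} {x y : L}, x ∈ grading.gr i → y ∈ grading.gr j →
    bracket x y ∈ grading.gr (i + j)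
  skew : ∀ {i j : ZMod 2} {x y : L}, x ∈ grading.gr i → y ∈ grading.gr j →
    bracket x y = -(superSign k i j • bracket y x)
  jacobi : ∀ {i j l : ZMod 2} {x y z : L}, x ∈ grading.gr i → y ∈ grading.gr j →
    z ∈ grading.gr l → bracket x (bracket y z) =
      bracket (bracket x y) z + superSign k i j • bracket y (bracket x z)

namespace LieSuperalgebra

section Types

variable (k : Type*) (L : Type*) [Field k] [AddCommGroup L] [Module k L] [LieSuperalgebra k L]

/-- Ideals of a Lie superalgebra are graded by convention. -/
def IsIdeal (I : Submodule k L) : Prop :=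
  (grading (k := k) (L := L)).IsGraded I ∧ ∀ x : L, ∀ y ∈ I, bracket (k := k) x y ∈ I

/-- A reductive Lie algebra (for finite dimensional `L`), seen as a Lie superalgebra without odd
part: the adjoint representation is completely reducible. -/
def IsReductiveLie : Prop :=
  (grading (k := k) (L := L)).gr 1 = ⊥ ∧
    ∀ I : Submodule k L, IsIdeal k L I → ∃ J : Submodule k L, IsIdeal k L J ∧ IsCompl I J

/-- Simple: non-abelian, without ideals other than `0` and `L`. -/
def IsSimple : Prop :=
  (∃ x y : L, bracket (k := k) x y ≠ 0) ∧
    ∀ I : Submodule k L, IsIdeal k L I → I = ⊥ ∨ I = ⊤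

/-- A subspace of `L₁` that is stable under `L₀`. -/
def IsEvenStable (U : Submodule k L) : Prop :=
  U ≤ (grading (k := k) (L := L)).gr 1 ∧
    ∀ x ∈ (grading (k := k) (L := L)).gr 0, ∀ y ∈ U, bracket (k := k) x y ∈ U

/-- Classical: simple, and the representation of `L₀` on `L₁` is completely reducible. -/
def IsClassical : Prop :=
  IsSimple k L ∧ ∀ U : Submodule k L, IsEvenStable k L U →
    ∃ U' : Submodule k L, IsEvenStable k L U' ∧ U ⊓ U' = ⊥ ∧
      U ⊔ U' = (grading (k := k) (L := L)).gr 1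

/-- Basic classical: classical, with a non-degenerate even invariant bilinear form. (Since `L` is
perfect, such a form is automatically supersymmetric.) -/
def IsBasicClassical : Prop :=
  IsClassical k L ∧ ∃ B : L →ₗ[k] L →ₗ[k] k,
    ((∀ x, (∀ y, B x y = 0) → x = 0) ∧ ∀ y, (∀ x, B x y = 0) → y = 0) ∧
    (∀ i j, i ≠ j → ∀ x ∈ (grading (k := k) (L := L)).gr i,
      ∀ y ∈ (grading (k := k) (L := L)).gr j, B x y = 0) ∧
    ∀ x y z, B (bracket (k := k) x y) z = B x (bracket (k := k) y z)

/-- `L` is isomorphic to `𝔰𝔩(n,n)`, the Lie superalgebra of the block matrices of size `n + n`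
whose supertrace `tr a - tr d` vanishes, with the block diagonal matrices as even part, the block
antidiagonal ones as odd part, and the supercommutator as bracket. -/
def IsSpecialLinear (n : ℕ) : Prop :=
  ∃ e : L →ₗ[k] Matrix (Fin n ⊕ Fin n) (Fin n ⊕ Fin n) k,
    Function.Injective e ∧
    Set.range e = {X | X.toBlocks₁₁.trace - X.toBlocks₂₂.trace = 0} ∧
    (∀ x ∈ (grading (k := k) (L := L)).gr 0, (e x).toBlocks₁₂ = 0 ∧ (e x).toBlocks₂₁ = 0) ∧
    (∀ x ∈ (grading (k := k) (L := L)).gr 1, (e x).toBlocks₁₁ = 0 ∧ (e x).toBlocks₂₂ = 0) ∧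
    ∀ i j, ∀ x ∈ (grading (k := k) (L := L)).gr i, ∀ y ∈ (grading (k := k) (L := L)).gr j,
      e (bracket (k := k) x y) = e x * e y - superSign k i j • (e y * e x)

end Types

/-- Homomorphisms of Lie superalgebras. -/
structure Hom (k : Type*) (L L' : Type*) [Field k] [AddCommGroup L] [Module k L]
    [LieSuperalgebra k L] [AddCommGroup L'] [Module k L'] [LieSuperalgebra k L'] where
  toLinearMap : L →ₗ[k] L'
  map_mem : ∀ {i : ZMod 2} {x : L}, x ∈ (grading (k := k)).gr i →
    toLinearMap x ∈ (grading (k := k)).gr i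
  map_bracket : ∀ x y : L, toLinearMap (bracket (k := k) x y) =
    bracket (k := k) (toLinearMap x) (toLinearMap y)

/-- An action of a group on a Lie superalgebra by automorphisms of Lie superalgebras. -/
class Action (Γ : Type*) (k : Type*) (L : Type*) [Group Γ] [Field k] [AddCommGroup L]
    [Module k L] [LieSuperalgebra k L] extends DistribMulAction Γ L, SMulCommClass Γ k L where
  smul_mem : ∀ (γ : Γ) {i : ZMod 2} {x : L}, x ∈ (grading (k := k)).gr i →
    γ • x ∈ (grading (k := k)).gr i
  smul_bracket : ∀ (γ : Γ) (x y : L),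
    γ • bracket (k := k) x y = bracket (k := k) (γ • x) (γ • y)

/-- The automorphism of `L` given by `γ`. -/
def actionHom {Γ : Type*} (k : Type*) (L : Type*) [Group Γ] [Field k] [AddCommGroup L]
    [Module k L] [LieSuperalgebra k L] [Action Γ k L] (γ : Γ) : Hom k L L where
  toLinearMap := DistribSMul.toLinearMap k L γ
  map_mem := Action.smul_mem γ
  map_bracket := Action.smul_bracket γ

section MapSuperalgebra

variable {k : Type*} [Field k] {g : Type*} [AddCommGroup g] [Module k g] [LieSuperalgebra k g]
  {A : Type*} [CommRing A] [Algebra k A]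

/-- The map superalgebra `g ⊗ A`: its even and odd parts are `g₀ ⊗ A` and `g₁ ⊗ A`, and
`[x ⊗ a, y ⊗ b] = [x, y] ⊗ a b`. -/
noncomputable instance mapSuperalgebra : LieSuperalgebra k (g ⊗[k] A) where
  grading := (grading (k := k) (L := g)).tensorEven A
  bracket := TensorProduct.map₂ (bracket (k := k) (L := g)) (LinearMap.mul k A)
  bracket_mem := by
    intro i j x y hx hy
    refine SuperGrading.tensorEven_induction _
      (p := fun x => TensorProduct.map₂ (bracket (k := k)) (LinearMap.mul k A) x y ∈ _) (by simp)
      (fun s t hs ht => by rw [map_add, LinearMap.add_apply]; exact add_mem hs ht) ?_ hx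
    intro x hx a
    refine SuperGrading.tensorEven_induction _
      (p := fun y => TensorProduct.map₂ (bracket (k := k)) (LinearMap.mul k A) (x ⊗ₜ a) y ∈ _)
      (by simp) (fun s t hs ht => by rw [map_add]; exact add_mem hs ht) ?_ hy
    intro y hy b
    exact Submodule.subset_span ⟨_, bracket_mem hx hy, a * b, rfl⟩
  skew := by
    intro i j x y hx hy
    refine SuperGrading.tensorEven_induction _
      (p := fun x => TensorProduct.map₂ (bracket (k := k)) (LinearMap.mul k A) x y =
        -(superSign k i j • TensorProduct.map₂ (bracket (k := k)) (LinearMap.mul k A) y x))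
      (by simp) (fun s t hs ht => by
        rw [map_add, LinearMap.add_apply, hs, ht, map_add, smul_add, neg_add]) ?_ hx
    intro x hx a
    refine SuperGrading.tensorEven_induction _
      (p := fun y => TensorProduct.map₂ (bracket (k := k)) (LinearMap.mul k A) (x ⊗ₜ a) y =
        -(superSign k i j • TensorProduct.map₂ (bracket (k := k)) (LinearMap.mul k A) y (x ⊗ₜ a)))
      (by simp) (fun s t hs ht => by
        rw [map_add, hs, ht, map_add, LinearMap.add_apply, smul_add, neg_add]) ?_ hy
    intro y hy b
    simp only [TensorProduct.map₂_apply_tmul, TensorProduct.map_tmul, LinearMap.mul_apply']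
    rw [skew hx hy, mul_comm, TensorProduct.neg_tmul, TensorProduct.smul_tmul']
  jacobi := by
    intro i j l x y z hx hy hz
    let β := TensorProduct.map₂ (bracket (k := k) (L := g)) (LinearMap.mul k A)
    change β x (β y z) = β (β x y) z + superSign k i j • β y (β x z)
    refine SuperGrading.tensorEven_induction _
      (p := fun x => β x (β y z) = β (β x y) z + superSign k i j • β y (β x z)) (by simp)
      (fun s t hs ht => by
        simp only [map_add, LinearMap.add_apply, hs, ht, smul_add]; abel) ?_ hx
    intro x hx a
    refine SuperGrading.tensorEven_induction _
      (p := fun y => β (x ⊗ₜ a) (β y z) =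
        β (β (x ⊗ₜ a) y) z + superSign k i j • β y (β (x ⊗ₜ a) z)) (by simp)
      (fun s t hs ht => by
        simp only [map_add, LinearMap.add_apply, hs, ht, smul_add]; abel) ?_ hy
    intro y hy b
    refine SuperGrading.tensorEven_induction _
      (p := fun z => β (x ⊗ₜ a) (β (y ⊗ₜ b) z) =
        β (β (x ⊗ₜ a) (y ⊗ₜ b)) z + superSign k i j • β (y ⊗ₜ b) (β (x ⊗ₜ a) z)) (by simp)
      (fun s t hs ht => by
        simp only [map_add, hs, ht, smul_add]; abel) ?_ hz
    intro z hz c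
    simp only [β, TensorProduct.map₂_apply_tmul, TensorProduct.map_tmul, LinearMap.mul_apply']
    rw [jacobi hx hy hz, TensorProduct.add_tmul, mul_assoc, TensorProduct.smul_tmul',
      mul_left_comm b a c]

end MapSuperalgebra

section Equivariant

variable (Γ : Type*) [Group Γ] (k : Type*) [Field k]
  (g : Type*) [AddCommGroup g] [Module k g] [LieSuperalgebra k g] [Action Γ k g]
  (A : Type*) [CommRing A] [Algebra k A] [MulSemiringAction Γ A] [SMulCommClass Γ k A]

/-- The action of `γ` on `g ⊗ A`, given by `γ (x ⊗ a) = γ x ⊗ γ a`. -/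
noncomputable def diagMap (γ : Γ) : g ⊗[k] A →ₗ[k] g ⊗[k] A :=
  TensorProduct.map (DistribSMul.toLinearMap k g γ) (DistribSMul.toLinearMap k A γ)

/-- The space `(g ⊗ A)^Γ` of the `Γ`-fixed points of `g ⊗ A`. -/
def EquivariantMaps : Submodule k (g ⊗[k] A) where
  carrier := {t | ∀ γ : Γ, diagMap Γ k g A γ t = t}
  zero_mem' := by simp
  add_mem' := by intro a b ha hb γ; rw [map_add, ha γ, hb γ]
  smul_mem' := by intro c a ha γ; rw [map_smul, ha γ]

variable {Γ k g A}

theorem diagMap_mem (γ : Γ) {i : ZMod 2} {t : g ⊗[k] A}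
    (ht : t ∈ (grading (k := k) (L := g ⊗[k] A)).gr i) :
    diagMap Γ k g A γ t ∈ (grading (k := k) (L := g ⊗[k] A)).gr i := by
  refine SuperGrading.tensorEven_induction _
    (p := fun t => diagMap Γ k g A γ t ∈ (grading (k := k) (L := g ⊗[k] A)).gr i) (by simp)
    (fun s t hs ht => by rw [map_add]; exact add_mem hs ht) ?_ ht
  intro x hx a
  exact Submodule.subset_span ⟨γ • x, Action.smul_mem γ hx, γ • a, rfl⟩

theorem diagMap_proj (γ : Γ) (i : ZMod 2) (t : g ⊗[k] A) :
    diagMap Γ k g A γ ((grading (k := k)).proj i t) =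
      (grading (k := k)).proj i (diagMap Γ k g A γ t) := by
  have h := SuperGrading.hom_ext (grading (k := k) (L := g ⊗[k] A))
    (f := diagMap Γ k g A γ ∘ₗ (grading (k := k)).proj i)
    (f' := (grading (k := k)).proj i ∘ₗ diagMap Γ k g A γ) (fun j x hx => by
      simp only [LinearMap.comp_apply]
      by_cases hij : i = j
      · subst hij
        rw [SuperGrading.proj_of_mem _ hx, SuperGrading.proj_of_mem _ (diagMap_mem γ hx)]
      · rw [SuperGrading.proj_of_mem_ne _ hij hx,
          SuperGrading.proj_of_mem_ne _ hij (diagMap_mem γ hx), map_zero])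
  exact LinearMap.congr_fun h t

theorem diagMap_bracket (γ : Γ) (s t : g ⊗[k] A) :
    diagMap Γ k g A γ (bracket (k := k) s t) =
      bracket (k := k) (diagMap Γ k g A γ s) (diagMap Γ k g A γ t) := by
  induction s with
  | zero => simp
  | add a b ha hb => simp only [map_add, LinearMap.add_apply, ha, hb]
  | tmul x a =>
    induction t with
    | zero => simp
    | add c d hc hd => simp only [map_add, hc, hd]
    | tmul y b =>
      change (γ • bracket (k := k) x y) ⊗ₜ[k] (γ • (a * b)) =
        (bracket (k := k) (γ • x) (γ • y)) ⊗ₜ[k] ((γ • a) * (γ • b))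
      rw [Action.smul_bracket, smul_mul']

theorem equivariantMaps_isGraded :
    (grading (k := k) (L := g ⊗[k] A)).IsGraded (EquivariantMaps Γ k g A) := by
  intro t ht i γ
  rw [diagMap_proj, ht γ]

/-- The equivariant map superalgebra `(g ⊗ A)^Γ`, a subsuperalgebra of `g ⊗ A`. -/
noncomputable instance equivariantMapSuperalgebra :
    LieSuperalgebra k (EquivariantMaps Γ k g A) where
  grading := (grading (k := k)).restrict _ equivariantMaps_isGraded
  bracket := LinearMap.mk₂ k
    (fun s t => ⟨bracket (k := k) (s : g ⊗[k] A) t, fun γ => by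
      rw [diagMap_bracket, s.2 γ, t.2 γ]⟩)
    (fun _ _ _ => Subtype.ext (by simp)) (fun _ _ _ => Subtype.ext (by simp))
    (fun _ _ _ => Subtype.ext (by simp)) (fun _ _ _ => Subtype.ext (by simp))
  bracket_mem hx hy := bracket_mem (k := k) (L := g ⊗[k] A) hx hy
  skew hx hy := Subtype.ext (skew (k := k) (L := g ⊗[k] A) hx hy)
  jacobi hx hy hz := Subtype.ext (jacobi (k := k) (L := g ⊗[k] A) hx hy hz)

end Equivariant

end LieSuperalgebra

/-! ### Finite dimensional representations -/

/-- A finite dimensional representation of a Lie superalgebra on a super vector space. -/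
structure SuperRep (k : Type u) (L : Type v) [Field k] [AddCommGroup L] [Module k L]
    [LieSuperalgebra k L] where
  V : Type u
  [addCommGroup : AddCommGroup V]
  [module : Module k V]
  [finiteDimensional : FiniteDimensional k V]
  grading : SuperGrading k V
  ρ : L →ₗ[k] V →ₗ[k] V
  ρ_mem : ∀ {i j : ZMod 2} {x : L} {v : V},
    x ∈ (LieSuperalgebra.grading (k := k)).gr i → v ∈ grading.gr j → ρ x v ∈ grading.gr (i + j)
  ρ_bracket : ∀ {i j : ZMod 2} {x y : L}, x ∈ (LieSuperalgebra.grading (k := k)).gr i →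
    y ∈ (LieSuperalgebra.grading (k := k)).gr j → ∀ v : V,
      ρ (LieSuperalgebra.bracket (k := k) x y) v =
        ρ x (ρ y v) - superSign k i j • ρ y (ρ x v)

namespace SuperRep

attribute [instance] addCommGroup module finiteDimensional

variable {k : Type u} {L : Type v} [Field k] [AddCommGroup L] [Module k L] [LieSuperalgebra k L]
  {L' : Type w} [AddCommGroup L'] [Module k L'] [LieSuperalgebra k L']

/-- Isomorphism of representations: a bijective intertwining operator that is homogeneous, of even
or odd degree `p`. (Composing with the parity operator turns an odd operator that commutes with the
action into one that commutes with it up to the usual sign, and conversely.) -/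
def Iso (M N : SuperRep k L) : Prop :=
  ∃ e : M.V ≃ₗ[k] N.V, (∃ p : ZMod 2, ∀ i, ∀ v ∈ M.grading.gr i, e v ∈ N.grading.gr (i + p)) ∧
    ∀ x v, e (M.ρ x v) = N.ρ x (e v)

/-- Irreducible: nonzero, without graded subrepresentations other than `0` and the whole. -/
def IsIrreducible (M : SuperRep k L) : Prop :=
  Nontrivial M.V ∧ ∀ U : Submodule k M.V, M.grading.IsGraded U →
    (∀ x, ∀ v ∈ U, M.ρ x v ∈ U) → U = ⊥ ∨ U = ⊤

theorem map_proj {M N : SuperRep k L} (e : M.V ≃ₗ[k] N.V) {p : ZMod 2}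
    (h : ∀ i, ∀ v ∈ M.grading.gr i, e v ∈ N.grading.gr (i + p)) (i : ZMod 2) (v : M.V) :
    e (M.grading.proj i v) = N.grading.proj (i + p) (e v) := by
  have h := M.grading.hom_ext (f := e.toLinearMap ∘ₗ M.grading.proj i)
    (f' := N.grading.proj (i + p) ∘ₗ e.toLinearMap) (fun j x hx => by
      simp only [LinearMap.comp_apply, LinearEquiv.coe_coe]
      by_cases hij : i = j
      · subst hij
        rw [SuperGrading.proj_of_mem _ hx, SuperGrading.proj_of_mem _ (h _ _ hx)]
      · rw [SuperGrading.proj_of_mem_ne _ hij hx,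
          SuperGrading.proj_of_mem_ne _ (fun h' => hij (add_right_cancel h')) (h _ _ hx),
          map_zero])
  exact LinearMap.congr_fun h v

theorem Iso.refl (M : SuperRep k L) : M.Iso M :=
  ⟨LinearEquiv.refl k M.V, ⟨0, fun i v hv => by simpa using hv⟩, fun _ _ => rfl⟩

theorem Iso.symm {M N : SuperRep k L} : M.Iso N → N.Iso M := by
  rintro ⟨e, ⟨p, hp⟩, he⟩
  refine ⟨e.symm, ⟨p, fun i v hv => ?_⟩, fun x v => ?_⟩
  · have h : e (M.grading.proj (i + p) (e.symm v)) = v := by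
      have hpp : ∀ i p : ZMod 2, i + p + p = i := by decide
      rw [map_proj e hp, hpp i p, e.apply_symm_apply, SuperGrading.proj_of_mem _ hv]
    rw [← h, e.symm_apply_apply]
    exact SuperGrading.proj_mem _ _ _
  · rw [LinearEquiv.symm_apply_eq, he, e.apply_symm_apply]

theorem Iso.trans {M N P : SuperRep k L} : M.Iso N → N.Iso P → M.Iso P := by
  rintro ⟨e, ⟨p, hp⟩, he⟩ ⟨f, ⟨q, hq⟩, hf⟩
  refine ⟨e.trans f, ⟨p + q, fun i v hv => ?_⟩, fun x v => ?_⟩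
  · rw [← add_assoc]
    exact hq _ _ (hp _ _ hv)
  · simp [he, hf]

theorem Iso.isIrreducible {M N : SuperRep k L} (h : M.Iso N) (hM : M.IsIrreducible) :
    N.IsIrreducible := by
  obtain ⟨e, ⟨p, hp⟩, he⟩ := h
  obtain ⟨hn, hU⟩ := hM
  refine ⟨e.symm.toEquiv.nontrivial, fun U hgr hst => ?_⟩
  have key := hU (U.comap e.toLinearMap)
    (fun u hu i => by
      change e (M.grading.proj i u) ∈ U
      rw [map_proj e hp]
      exact hgr _ hu _)
    (fun x v hv => by
      change e (M.ρ x v) ∈ U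
      rw [he]
      exact hst x _ hv)
  have hmap : (U.comap e.toLinearMap).map e.toLinearMap = U :=
    Submodule.map_comap_eq_of_surjective e.surjective U
  rcases key with h | h
  · left; rw [← hmap, h, Submodule.map_bot]
  · right; rw [← hmap, h, Submodule.map_top]; exact LinearEquiv.range e

/-- The trivial representation, on `k` in degree `0`. -/
def trivial (k : Type u) (L : Type v) [Field k] [AddCommGroup L] [Module k L]
    [LieSuperalgebra k L] : SuperRep k L where
  V := k
  grading := ⟨fun i => if i = 0 then ⊤ else ⊥, by simpa using isCompl_top_bot⟩
  ρ := 0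
  ρ_mem _ _ := zero_mem _
  ρ_bracket _ _ v := by simp

/-- The pullback `ρ ∘ f` of a representation `ρ` along a homomorphism `f`. -/
def pullback (M : SuperRep k L') (f : LieSuperalgebra.Hom k L L') : SuperRep k L where
  V := M.V
  grading := M.grading
  ρ := M.ρ ∘ₗ f.toLinearMap
  ρ_mem hx hv := M.ρ_mem (f.map_mem hx) hv
  ρ_bracket {i j x y} hx hy v := by
    change M.ρ (f.toLinearMap _) v = _
    rw [f.map_bracket]
    exact M.ρ_bracket (f.map_mem hx) (f.map_mem hy) v

theorem Iso.pullback {M N : SuperRep k L'} (f : LieSuperalgebra.Hom k L L') (h : M.Iso N) :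
    (M.pullback f).Iso (N.pullback f) := by
  obtain ⟨e, hp, he⟩ := h
  exact ⟨e, hp, fun x v => he _ v⟩

/-- The action on a tensor product: `x (v ⊗ w) = x v ⊗ w + (-1)^(|x| |v|) v ⊗ x w`. -/
noncomputable def tensorρ (M N : SuperRep k L) : L →ₗ[k] (M.V ⊗[k] N.V) →ₗ[k] (M.V ⊗[k] N.V) where
  toFun x := TensorProduct.map (M.ρ x) LinearMap.id +
    TensorProduct.map LinearMap.id (N.ρ ((LieSuperalgebra.grading (k := k)).proj 0 x)) +
    TensorProduct.map M.grading.parity (N.ρ ((LieSuperalgebra.grading (k := k)).proj 1 x))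
  map_add' x y := by
    simp only [map_add, TensorProduct.map_add_left, TensorProduct.map_add_right]; abel
  map_smul' c x := by
    simp only [map_smul, TensorProduct.map_smul_left, TensorProduct.map_smul_right, smul_add,
      RingHom.id_apply]

theorem tensorρ_tmul (M N : SuperRep k L) {i j : ZMod 2} {x : L} {v : M.V}
    (hx : x ∈ (LieSuperalgebra.grading (k := k)).gr i) (hv : v ∈ M.grading.gr j) (w : N.V) :
    tensorρ M N x (v ⊗ₜ w) = M.ρ x v ⊗ₜ w + superSign k i j • (v ⊗ₜ[k] N.ρ x w) := by
  change M.ρ x v ⊗ₜ w + v ⊗ₜ[k] N.ρ ((LieSuperalgebra.grading (k := k)).proj 0 x) w +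
    M.grading.parity v ⊗ₜ[k] N.ρ ((LieSuperalgebra.grading (k := k)).proj 1 x) w = _
  rcases zmod_two_cases i with rfl | rfl
  · rw [SuperGrading.proj_of_mem _ hx, SuperGrading.proj_of_mem_ne (i := 1) _ (by decide) hx,
      superSign_zero_left]
    simp
  · rw [SuperGrading.proj_of_mem _ hx, SuperGrading.proj_of_mem_ne (i := 0) _ (by decide) hx,
      M.grading.parity_of_mem hv, ← TensorProduct.smul_tmul']
    simp

/-- The tensor product of two representations. -/
noncomputable def tensor (M N : SuperRep k L) : SuperRep k L where
  V := M.V ⊗[k] N.V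
  grading := M.grading.tensor N.grading
  ρ := tensorρ M N
  ρ_mem := by
    intro i n x t hx ht
    induction ht using Submodule.span_induction with
    | zero => simp
    | add a b _ _ ha hb => rw [map_add]; exact add_mem ha hb
    | smul c a _ ha => rw [map_smul]; exact Submodule.smul_mem _ _ ha
    | mem a ha =>
      obtain ⟨j, l, rfl, v, hv, w, hw, rfl⟩ := ha
      rw [tensorρ_tmul M N hx hv]
      refine add_mem ?_ (Submodule.smul_mem _ _ ?_)
      · rw [← add_assoc]
        exact SuperGrading.tmul_mem _ _ (M.ρ_mem hx hv) hw
      · rw [add_left_comm]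
        exact SuperGrading.tmul_mem _ _ hv (N.ρ_mem hx hw)
  ρ_bracket := by
    intro i j x y hx hy t
    induction t with
    | zero => simp
    | add a b ha hb => simp only [map_add, ha, hb, smul_add]; abel
    | tmul v w =>
      suffices H : ∀ l, ∀ v ∈ M.grading.gr l,
          tensorρ M N (LieSuperalgebra.bracket (k := k) x y) (v ⊗ₜ w) =
          tensorρ M N x (tensorρ M N y (v ⊗ₜ w)) -
            superSign k i j • tensorρ M N y (tensorρ M N x (v ⊗ₜ w)) by
        rw [← M.grading.proj_add_proj v, TensorProduct.add_tmul]
        simp only [map_add, smul_add, H 0 _ (M.grading.proj_mem 0 v),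
          H 1 _ (M.grading.proj_mem 1 v)]
        abel
      intro l v hv
      rw [tensorρ_tmul M N (LieSuperalgebra.bracket_mem hx hy) hv, tensorρ_tmul M N hy hv,
        tensorρ_tmul M N hx hv, M.ρ_bracket hx hy, N.ρ_bracket hx hy]
      simp only [map_add, map_smul]
      rw [tensorρ_tmul M N hx (M.ρ_mem hy hv), tensorρ_tmul M N hy (M.ρ_mem hx hv),
        tensorρ_tmul M N hx hv, tensorρ_tmul M N hy hv]
      simp only [TensorProduct.sub_tmul, TensorProduct.tmul_sub, ← TensorProduct.smul_tmul',
        TensorProduct.tmul_smul, smul_add, smul_sub, smul_smul]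
      have h11 : (1 + 1 : ZMod 2) = 0 := by decide
      rcases zmod_two_cases i with rfl | rfl <;> rcases zmod_two_cases j with rfl | rfl <;>
        rcases zmod_two_cases l with rfl | rfl <;>
        simp only [h11, add_zero, zero_add, superSign_zero_left, superSign_zero_right,
          superSign_one_one, one_smul, neg_smul, mul_one, mul_neg, neg_neg] <;>
        abel

instance setoid (k : Type u) (L : Type v) [Field k] [AddCommGroup L] [Module k L]
    [LieSuperalgebra k L] : Setoid (SuperRep k L) where
  r := Iso
  iseqv := ⟨Iso.refl, Iso.symm, Iso.trans⟩

end SuperRep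

/-- Isomorphism classes of finite dimensional representations of `L`. -/
def RepClass (k : Type u) (L : Type v) [Field k] [AddCommGroup L] [Module k L]
    [LieSuperalgebra k L] : Type (max (u + 1) v) := Quotient (SuperRep.setoid k L)

namespace RepClass

variable {k : Type u} {L : Type v} [Field k] [AddCommGroup L] [Module k L] [LieSuperalgebra k L]

/-- The isomorphism class of a representation. -/
def mk (M : SuperRep k L) : RepClass k L := Quotient.mk _ M

/-- The class consists of irreducible representations. -/
def IsIrreducible (c : RepClass k L) : Prop :=
  Quotient.lift SuperRep.IsIrreducible
    (fun _ _ h => propext ⟨SuperRep.Iso.isIrreducible h,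
      SuperRep.Iso.isIrreducible (SuperRep.Iso.symm h)⟩) c

/-- The class of the pullbacks `ρ ∘ f`. -/
def pullback {L' : Type w} [AddCommGroup L'] [Module k L'] [LieSuperalgebra k L']
    (c : RepClass k L') (f : LieSuperalgebra.Hom k L L') : RepClass k L :=
  Quotient.map (fun M => M.pullback f) (fun _ _ h => SuperRep.Iso.pullback f h) c

/-- The action of `Γ` on isomorphism classes: `γ [ρ] = [ρ ∘ γ⁻¹]`. -/
def twist {Γ : Type*} [Group Γ] [LieSuperalgebra.Action Γ k L] (γ : Γ) (c : RepClass k L) :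
    RepClass k L := c.pullback (LieSuperalgebra.actionHom k L γ⁻¹)

end RepClass

/-! ### Rational points and evaluation -/

/-- The set `X_rat` of the `k`-rational points of `X = Spec A`: the maximal ideals of `A` whose
residue field is `k`. -/
def RatPoint (k : Type*) (A : Type*) [Field k] [CommRing A] [Algebra k A] : Type _ :=
  {m : MaximalSpectrum A // Function.Bijective (algebraMap k (A ⧸ m.asIdeal))}

namespace RatPoint

variable {k : Type*} {A : Type*} [Field k] [CommRing A] [Algebra k A]

/-- The value at `m` of a function in `A`, that is, its class in `A / m = k`. -/
noncomputable def eval (m : RatPoint k A) : A →ₐ[k] k :=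
  (AlgEquiv.ofBijective (Algebra.ofId k (A ⧸ m.1.asIdeal)) m.2).symm.toAlgHom.comp
    (Ideal.Quotient.mkₐ k m.1.asIdeal)

variable {Γ : Type*} [Group Γ] [MulSemiringAction Γ A] [SMulCommClass Γ k A]

theorem bijective_comap (γ : Γ) (m : RatPoint k A) : Function.Bijective
    (algebraMap k (A ⧸ m.1.asIdeal.comap (MulSemiringAction.toRingHom Γ A γ⁻¹))) := by
  have := m.1.isMaximal
  have : (m.1.asIdeal.comap (MulSemiringAction.toRingHom Γ A γ⁻¹)).IsMaximal :=
    Ideal.comap_isMaximal_of_surjective _ (MulAction.surjective γ⁻¹)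
  refine ⟨(algebraMap k _).injective, fun y => ?_⟩
  obtain ⟨a, rfl⟩ := Ideal.Quotient.mk_surjective y
  obtain ⟨c, hc⟩ := m.2.2 (Ideal.Quotient.mk _ (γ⁻¹ • a))
  refine ⟨c, ?_⟩
  change Ideal.Quotient.mk _ (algebraMap k A c) = _ at hc ⊢
  rw [Ideal.Quotient.eq] at hc ⊢
  change γ⁻¹ • (algebraMap k A c - a) ∈ m.1.asIdeal
  rwa [smul_sub, smul_algebraMap]

/-- The action of `Γ` on the rational points: `γ m = {γ f | f ∈ m} = {f | γ⁻¹ f ∈ m}`. -/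
instance : MulAction Γ (RatPoint k A) where
  smul γ m := ⟨⟨m.1.asIdeal.comap (MulSemiringAction.toRingHom Γ A γ⁻¹),
    haveI := m.1.isMaximal
    Ideal.comap_isMaximal_of_surjective _ (MulAction.surjective γ⁻¹)⟩, bijective_comap γ m⟩
  one_smul m := by
    apply Subtype.ext
    apply MaximalSpectrum.ext
    ext f
    change (1 : Γ)⁻¹ • f ∈ m.1.asIdeal ↔ _
    simp
  mul_smul γ δ m := by
    apply Subtype.ext
    apply MaximalSpectrum.ext
    ext f
    change (γ * δ)⁻¹ • f ∈ m.1.asIdeal ↔ δ⁻¹ • γ⁻¹ • f ∈ m.1.asIdeal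
    rw [mul_inv_rev, mul_smul]

end RatPoint

section Evaluation

variable {Γ : Type*} [Group Γ] {k : Type u} [Field k]
  {g : Type*} [AddCommGroup g] [Module k g] [LieSuperalgebra k g] [LieSuperalgebra.Action Γ k g]
  {A : Type*} [CommRing A] [Algebra k A] [MulSemiringAction Γ A] [SMulCommClass Γ k A]

/-- Evaluation at the point `m` as a linear map `g ⊗ A → g ⊗ A / m = g ⊗ k = g`. -/
noncomputable def evalLin (g : Type*) [AddCommGroup g] [Module k g] (m : RatPoint k A) :
    g ⊗[k] A →ₗ[k] g :=
  (TensorProduct.rid k g).toLinearMap ∘ₗ m.eval.toLinearMap.lTensor g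

/-- The evaluation homomorphism `ev_m^Γ : (g ⊗ A)^Γ → g`. -/
noncomputable def evalHom (Γ : Type*) [Group Γ] [LieSuperalgebra.Action Γ k g]
    [MulSemiringAction Γ A] [SMulCommClass Γ k A] (m : RatPoint k A) :
    LieSuperalgebra.Hom k (LieSuperalgebra.EquivariantMaps Γ k g A) g where
  toLinearMap := evalLin g m ∘ₗ (LieSuperalgebra.EquivariantMaps Γ k g A).subtype
  map_mem {i x} hx := by
    refine SuperGrading.tensorEven_induction (LieSuperalgebra.grading (k := k) (L := g))
      (p := fun t => evalLin g m t ∈ _) (by simp)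
      (fun s t hs ht => by rw [map_add]; exact add_mem hs ht) ?_ hx
    intro x hx a
    simpa [evalLin] using Submodule.smul_mem _ _ hx
  map_bracket x y := by
    change evalLin g m (LieSuperalgebra.bracket (k := k) (x : g ⊗[k] A) y) =
      LieSuperalgebra.bracket (k := k) (evalLin g m x) (evalLin g m y)
    generalize (x : g ⊗[k] A) = s
    generalize (y : g ⊗[k] A) = t
    induction s with
    | zero => simp
    | add a b ha hb => simp only [map_add, LinearMap.add_apply, ha, hb]
    | tmul x a =>
      induction t with
      | zero => simp
      | add c d hc hd => simp only [map_add, hc, hd]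
      | tmul y b =>
        change evalLin g m (LieSuperalgebra.bracket (k := k) x y ⊗ₜ[k] (a * b)) = _
        simp [evalLin, mul_smul, smul_comm (m.eval a)]

/-- The evaluation representation `ev^Γ_{m₁,…,m_ℓ}(V₁,…,V_ℓ)` of `(g ⊗ A)^Γ`. Composing the map
`(g ⊗ A)^Γ → g ⊕ ⋯ ⊕ g` given by the values at the points with `ρ₁ ⊗ ⋯ ⊗ ρ_ℓ` is the same as
forming the tensor product of the representations `ρ_i ∘ ev_{m_i}^Γ`. The empty list gives the
trivial representation. -/
noncomputable def evalRep (Γ : Type*) [Group Γ] [LieSuperalgebra.Action Γ k g]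
    [MulSemiringAction Γ A] [SMulCommClass Γ k A] :
    List (RatPoint k A × SuperRep k g) →
      SuperRep k (LieSuperalgebra.EquivariantMaps Γ k g A)
  | [] => SuperRep.trivial k _
  | p :: l => (p.2.pullback (evalHom Γ p.1)).tensor (evalRep Γ l)

/-- The class of an evaluation representation at finitely many pairwise distinct points, of
arbitrary finite dimensional representations. -/
def RepClass.IsEvaluation (c : RepClass k (LieSuperalgebra.EquivariantMaps Γ k g A)) : Prop :=
  ∃ l : List (RatPoint k A × SuperRep k g),
    (l.map Prod.fst).Nodup ∧ RepClass.mk (evalRep Γ l) = c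

variable (Γ k g A) in
/-- The set `ℰ(X, g)^Γ` of the finitely supported `Γ`-equivariant functions from the rational
points of `X` to the isomorphism classes of irreducible finite dimensional representations of `g`;
the support consists of the points whose value is not the trivial class. -/
structure EquivariantFun where
  toFun : RatPoint k A → RepClass k g
  isIrreducible : ∀ m, (toFun m).IsIrreducible
  finite_support : {m | toFun m ≠ RepClass.mk (SuperRep.trivial k g)}.Finite
  equivariant : ∀ (γ : Γ) (m : RatPoint k A), toFun (γ • m) = (toFun m).twist γ

namespace EquivariantFun

/-- The support of `Ψ`. -/
def support (Ψ : EquivariantFun Γ k g A) : Set (RatPoint k A) :=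
  {m | Ψ.toFun m ≠ RepClass.mk (SuperRep.trivial k g)}

/-- `l` lists one point from each `Γ`-orbit in the support of `Ψ`, together with a representative
of the class that is the value of `Ψ` at that point. -/
def Presents (Ψ : EquivariantFun Γ k g A) (l : List (RatPoint k A × SuperRep k g)) : Prop :=
  l.Pairwise (fun p q => ∀ γ : Γ, γ • p.1 ≠ q.1) ∧
  (∀ p ∈ l, p.1 ∈ Ψ.support) ∧
  (∀ m ∈ Ψ.support, ∃ p ∈ l, ∃ γ : Γ, γ • p.1 = m) ∧
  ∀ p ∈ l, RepClass.mk p.2 = Ψ.toFun p.1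

theorem exists_presents (Ψ : EquivariantFun Γ k g A) : ∃ l, Ψ.Presents l := by
  classical
  let s : Setoid (RatPoint k A) := MulAction.orbitRel Γ (RatPoint k A)
  let r : RatPoint k A → RatPoint k A := fun m => (Quotient.mk s m).out
  have hr : ∀ m, ∃ γ : Γ, γ • r m = m := fun m => by
    obtain ⟨γ, hγ⟩ : ∃ γ : Γ, γ • m = r m := MulAction.orbitRel_apply.1 (Quotient.mk_out m)
    exact ⟨γ⁻¹, by rw [← hγ, inv_smul_smul]⟩
  have hrr : ∀ (γ : Γ) m, r (γ • m) = r m := fun γ m =>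
    congrArg Quotient.out (Quotient.sound (MulAction.orbitRel_apply.2 ⟨γ, rfl⟩))
  have hirr : ∀ m, r (r m) = r m := fun m => congrArg Quotient.out (Quotient.out_eq _)
  have hsupp : ∀ (γ : Γ) m, γ • m ∈ Ψ.support → m ∈ Ψ.support := fun γ m h h' => by
    apply h
    rw [Ψ.equivariant, h']
    rfl
  have hfin : (r '' Ψ.support).Finite := Ψ.finite_support.image r
  refine ⟨hfin.toFinset.toList.map fun m => (m, (Ψ.toFun m).out), ?_, ?_, ?_, ?_⟩
  · rw [List.pairwise_map]
    refine List.Pairwise.imp_of_mem ?_ (Finset.nodup_toList _)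
    intro a b ha hb hab γ h
    simp only [Finset.mem_toList, Set.Finite.mem_toFinset] at ha hb
    obtain ⟨a, -, rfl⟩ := ha
    obtain ⟨b, -, rfl⟩ := hb
    apply hab
    change γ • r a = r b at h
    rw [← hirr b, ← h, hrr, hirr]
  · intro p hp
    simp only [List.mem_map, Finset.mem_toList, Set.Finite.mem_toFinset] at hp
    obtain ⟨_, ⟨a, ha, rfl⟩, rfl⟩ := hp
    obtain ⟨γ, hγ⟩ := hr a
    exact hsupp γ _ (by rwa [hγ])
  · intro m hm
    refine ⟨_, List.mem_map.2 ⟨r m, ?_, rfl⟩, hr m⟩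
    simp only [Finset.mem_toList, Set.Finite.mem_toFinset]
    exact ⟨m, hm, rfl⟩
  · intro p hp
    obtain ⟨m, -, rfl⟩ := List.mem_map.1 hp
    exact Quotient.out_eq _

/-- The class `ev^Γ_Ψ` of the evaluation representation `ev^Γ_M (Ψ(m))_{m ∈ M}`, where `M` contains
one element of each `Γ`-orbit in the support of `Ψ`. -/
noncomputable def evalClass (Ψ : EquivariantFun Γ k g A) :
    RepClass k (LieSuperalgebra.EquivariantMaps Γ k g A) :=
  RepClass.mk (evalRep Γ Ψ.exists_presents.choose)

end EquivariantFun

end Evaluation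

/-! Over an algebraically closed field the outer tensor product of irreducible representations of
two Lie superalgebras may be reducible: this happens when both factors carry an invertible odd
operator that commutes with the action. The core of the proof is that no irreducible representation
of the given `g` has such an operator (`IsIrreducible.hasNoOddSymmetry`). Then the commutant is `k`,
the representation is simple even without its grading, and by Jacobson density the action generates
all of `End V` (`IsIrreducible.isDense`).

Because `Γ` acts freely, averaging `y ⊗ a` over `Γ`, for a function `a` that is 1 at one point and 0
at finitely many others, gives a fixed point with value `y` at one point and 0 at given points of
other orbits (`exists_evalHom_eq`). So the factors of an evaluation representation at distinct
orbits can be acted on separately, and density passes to their tensor product (`IsDense.tensor`).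
This gives irreducibility.

On fixed points, evaluation at `γ m` is `γ` after evaluation at `m`; hence twisting by `γ` moves a
factor along its orbit, and the class does not depend on the choices. Injectivity: elements that
vanish at all other points act on the factor at `m` alone, so contracting an isomorphism of tensor
products yields an isomorphism of the factors at `m` (`Iso.of_tensor_iso`). Surjectivity: factors on
one orbit are merged, trivial factors are dropped, and a tensor factor of an irreducible
representation is irreducible.

Odd symmetries are excluded as follows. If `g₁ = 0`, each parity is a subrepresentation. Otherwise
one looks for an even `h` with `ad h` diagonalizable and abelian centralizer; highest weight theory
for the eigenvalues of `h` makes the top eigenspace a line, which an odd operator cannot preserve.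
For `𝔰𝔩(n,n)` with `n ≥ 2`, `h` is a diagonal matrix with distinct entries. For basic classical `g`,
`h` is a generic element of a Cartan subalgebra of `g₀`: the trace form of `g₀` on `g₁` is
non-degenerate by simplicity, which makes the Cartan subalgebra abelian and diagonalizable, and the
invariant form of `g` shows that odd elements of the centralizer commute. `𝔰𝔩(1,1)` is a Heisenberg
superalgebra and is treated by hand. -/

/-! ### Sign operators of a graded space -/

namespace SuperGrading

variable {k : Type*} {V W : Type*} [Field k] [AddCommGroup V] [Module k V]
  [AddCommGroup W] [Module k W]

theorem proj_mem_of_mem (G : SuperGrading k V) {i j : ZMod 2} {x : V} (hx : x ∈ G.gr j) :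
    G.proj i x ∈ G.gr j := by
  by_cases h : i = j
  · subst h; exact G.proj_mem _ _
  · rw [G.proj_of_mem_ne h hx]; exact zero_mem _

theorem eq_zero_of_mem_of_mem (G : SuperGrading k V) {i j : ZMod 2} (h : i ≠ j) {x : V}
    (hi : x ∈ G.gr i) (hj : x ∈ G.gr j) : x = 0 := by
  rw [← G.proj_of_mem hi, G.proj_of_mem_ne h hj]

theorem exists_homogeneous_ne_zero (G : SuperGrading k V) {U : Submodule k V}
    (hU : G.IsGraded U) (hne : U ≠ ⊥) : ∃ i, ∃ v ∈ G.gr i, v ∈ U ∧ v ≠ 0 := by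
  obtain ⟨u, hu, h0⟩ := U.ne_bot_iff.1 hne
  by_cases h : G.proj 0 u = 0
  · refine ⟨1, G.proj 1 u, G.proj_mem _ _, hU u hu 1, fun h1 => h0 ?_⟩
    rw [← G.proj_add_proj u, h, h1, add_zero]
  · exact ⟨0, _, G.proj_mem _ _, hU u hu 0, h⟩

/-- The operator `v ↦ (-1)^(p j) v` for `v ∈ V_j`. -/
noncomputable def sgn (G : SuperGrading k V) (p : ZMod 2) : V →ₗ[k] V :=
  G.proj 0 + superSign k p 1 • G.proj 1

theorem sgn_of_mem (G : SuperGrading k V) (p : ZMod 2) {j : ZMod 2} {x : V} (hx : x ∈ G.gr j) :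
    G.sgn p x = superSign k p j • x := by
  rcases zmod_two_cases j with rfl | rfl
  · simp [sgn, G.proj_of_mem hx, G.proj_of_mem_ne (i := 1) (by decide) hx, superSign_zero_right]
  · simp [sgn, G.proj_of_mem hx, G.proj_of_mem_ne (i := 0) (by decide) hx]

theorem superSign_mul_self (p j : ZMod 2) : superSign k p j * superSign k p j = 1 := by
  unfold superSign; split_ifs <;> simp

theorem superSign_add_left (p q j : ZMod 2) :
    superSign k (p + q) j = superSign k p j * superSign k q j := by
  have h11 : (1 + 1 : ZMod 2) = 0 := by decide
  rcases zmod_two_cases p with rfl | rfl <;> rcases zmod_two_cases q with rfl | rfl <;>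
    rcases zmod_two_cases j with rfl | rfl <;> simp [superSign, h11]

theorem superSign_comm (p q : ZMod 2) : superSign k p q = superSign k q p := by
  unfold superSign; simp only [and_comm]

theorem superSign_add_right (p q j : ZMod 2) :
    superSign k j (p + q) = superSign k j p * superSign k j q := by
  rw [superSign_comm, superSign_add_left, superSign_comm p, superSign_comm q]

theorem sgn_sgn (G : SuperGrading k V) (p : ZMod 2) (x : V) : G.sgn p (G.sgn p x) = x := by
  have := G.hom_ext (f := G.sgn p ∘ₗ G.sgn p) (f' := LinearMap.id) fun i x hx => by
    simp [G.sgn_of_mem p hx, smul_smul, superSign_mul_self]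
  exact LinearMap.congr_fun this x

/-- `sgn` as an equivalence. -/
noncomputable def sgnEquiv (G : SuperGrading k V) (p : ZMod 2) : V ≃ₗ[k] V :=
  LinearEquiv.ofLinearMap (G.sgn p) (G.sgn p) (LinearMap.ext (G.sgn_sgn p))
    (LinearMap.ext (G.sgn_sgn p))

@[simp] theorem sgnEquiv_apply (G : SuperGrading k V) (p : ZMod 2) (x : V) :
    G.sgnEquiv p x = G.sgn p x := rfl

theorem sgn_mem (G : SuperGrading k V) (p : ZMod 2) {j : ZMod 2} {x : V} (hx : x ∈ G.gr j) :
    G.sgn p x ∈ G.gr j := by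
  rw [G.sgn_of_mem p hx]; exact Submodule.smul_mem _ _ hx

/-- The even projection is half of the sum of the identity and the parity operator. -/
theorem isGraded_iff_sgn (G : SuperGrading k V) (hk : (2 : k) ≠ 0) {U : Submodule k V}
    (h : ∀ u ∈ U, G.sgn 1 u ∈ U) : G.IsGraded U := by
  have key : ∀ u ∈ U, G.proj 0 u ∈ U := fun u hu => by
    have h2 : (2 : k) • G.proj 0 u = u + G.sgn 1 u := by
      conv_rhs => enter [1]; rw [← G.proj_add_proj u]
      simp [sgn, superSign_one_one, two_smul]; abel
    have : (2 : k)⁻¹ • (2 : k) • G.proj 0 u ∈ U := by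
      rw [h2]; exact U.smul_mem _ (add_mem hu (h u hu))
    rwa [inv_smul_smul₀ hk] at this
  intro u hu i
  rcases zmod_two_cases i with rfl | rfl
  · exact key u hu
  · have : G.proj 1 u = u - G.proj 0 u := by
      rw [eq_sub_iff_add_eq, add_comm]; exact G.proj_add_proj u
    rw [this]; exact sub_mem hu (key u hu)

theorem tensor_hom_ext (G : SuperGrading k V) (H : SuperGrading k W) {P : Type*} [AddCommGroup P]
    [Module k P] {f f' : V ⊗[k] W →ₗ[k] P}
    (h : ∀ i j, ∀ v ∈ G.gr i, ∀ w ∈ H.gr j, f (v ⊗ₜ w) = f' (v ⊗ₜ w)) : f = f' := by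
  ext v w
  simp only [TensorProduct.AlgebraTensorModule.curry_apply, LinearMap.restrictScalars_self,
    TensorProduct.curry_apply]
  rw [← G.proj_add_proj v, ← H.proj_add_proj w]
  simp only [TensorProduct.add_tmul, TensorProduct.tmul_add, map_add]
  rw [h _ _ _ (G.proj_mem 0 v) _ (H.proj_mem 0 w), h _ _ _ (G.proj_mem 1 v) _ (H.proj_mem 0 w),
    h _ _ _ (G.proj_mem 0 v) _ (H.proj_mem 1 w), h _ _ _ (G.proj_mem 1 v) _ (H.proj_mem 1 w)]

theorem tensor_map_mem (G : SuperGrading k V) (H : SuperGrading k W) {P : Type*} [AddCommGroup P]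
    [Module k P] (K : SuperGrading k P) {f : V ⊗[k] W →ₗ[k] P} {p : ZMod 2}
    (h : ∀ i j, ∀ v ∈ G.gr i, ∀ w ∈ H.gr j, f (v ⊗ₜ w) ∈ K.gr (i + j + p)) {n : ZMod 2}
    {t : V ⊗[k] W} (ht : t ∈ (G.tensor H).gr n) : f t ∈ K.gr (n + p) := by
  induction ht using Submodule.span_induction with
  | zero => simp
  | add a b _ _ ha hb => rw [map_add]; exact add_mem ha hb
  | smul c a _ ha => rw [map_smul]; exact Submodule.smul_mem _ _ ha
  | mem a ha =>
    obtain ⟨i, j, rfl, v, hv, w, hw, rfl⟩ := ha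
    exact h i j v hv w hw

end SuperGrading

/-! ### Tensor products of representations: functoriality, symmetry, associativity, unit -/

namespace SuperRep

variable {k : Type u} {L : Type v} [Field k] [AddCommGroup L] [Module k L] [LieSuperalgebra k L]
  {L' : Type w} [AddCommGroup L'] [Module k L'] [LieSuperalgebra k L']

theorem ρ_sgn (M : SuperRep k L) {i : ZMod 2} {x : L}
    (hx : x ∈ (LieSuperalgebra.grading (k := k)).gr i) (p : ZMod 2) (v : M.V) :
    M.grading.sgn p (M.ρ x v) = superSign k p i • M.ρ x (M.grading.sgn p v) := by
  have := M.grading.hom_ext (f := M.grading.sgn p ∘ₗ M.ρ x)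
    (f' := superSign k p i • M.ρ x ∘ₗ M.grading.sgn p) fun j v hv => by
      simp [M.grading.sgn_of_mem p hv, M.grading.sgn_of_mem p (M.ρ_mem hx hv),
        SuperGrading.superSign_add_right, smul_smul]
  exact LinearMap.congr_fun this v

/-- The tensor product of two representations, with reducible underlying data. -/
noncomputable abbrev tens (M N : SuperRep k L) : SuperRep k L where
  V := M.V ⊗[k] N.V
  grading := M.grading.tensor N.grading
  ρ := tensorρ M N
  ρ_mem := (M.tensor N).ρ_mem
  ρ_bracket := (M.tensor N).ρ_bracket

theorem tensor_ρ_tmul (M N : SuperRep k L) {i j : ZMod 2} {x : L} {v : M.V}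
    (hx : x ∈ (LieSuperalgebra.grading (k := k)).gr i) (hv : v ∈ M.grading.gr j) (w : N.V) :
    (tens M N).ρ x (v ⊗ₜ w) = M.ρ x v ⊗ₜ w + superSign k i j • (v ⊗ₜ[k] N.ρ x w) :=
  tensorρ_tmul M N hx hv w

theorem Iso.of_homogeneous {M N : SuperRep k L} (e : M.V ≃ₗ[k] N.V) (p : ZMod 2)
    (hp : ∀ i, ∀ v ∈ M.grading.gr i, e v ∈ N.grading.gr (i + p))
    (h : ∀ i, ∀ x ∈ (LieSuperalgebra.grading (k := k) (L := L)).gr i, ∀ j, ∀ v ∈ M.grading.gr j,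
      e (M.ρ x v) = N.ρ x (e v)) : M.Iso N := by
  refine ⟨e, ⟨p, hp⟩, fun x v => ?_⟩
  have h1 : ∀ i, ∀ x ∈ (LieSuperalgebra.grading (k := k) (L := L)).gr i, ∀ v,
      e (M.ρ x v) = N.ρ x (e v) := fun i x hx v =>
    LinearMap.congr_fun (M.grading.hom_ext (f := e.toLinearMap ∘ₗ M.ρ x)
      (f' := N.ρ x ∘ₗ e.toLinearMap) fun j v hv => h i x hx j v hv) v
  rw [← (LieSuperalgebra.grading (k := k) (L := L)).proj_add_proj x]
  simp only [map_add, LinearMap.add_apply]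
  rw [h1 _ _ (SuperGrading.proj_mem _ 0 x), h1 _ _ (SuperGrading.proj_mem _ 1 x)]

theorem Iso.of_tensor {M N P : SuperRep k L} (e : (M.V ⊗[k] N.V) ≃ₗ[k] P.V) (p : ZMod 2)
    (hp : ∀ i j, ∀ v ∈ M.grading.gr i, ∀ w ∈ N.grading.gr j,
      e (v ⊗ₜ w) ∈ P.grading.gr (i + j + p))
    (h : ∀ n, ∀ x ∈ (LieSuperalgebra.grading (k := k) (L := L)).gr n, ∀ i, ∀ v ∈ M.grading.gr i,
      ∀ j, ∀ w ∈ N.grading.gr j,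
      e (M.ρ x v ⊗ₜ w + superSign k n i • (v ⊗ₜ[k] N.ρ x w)) = P.ρ x (e (v ⊗ₜ w))) :
    (tens M N).Iso P := by
  refine Iso.of_homogeneous (M := tens M N) e p
    (fun n t ht => SuperGrading.tensor_map_mem M.grading N.grading P.grading
      (f := e.toLinearMap) hp ht) fun n x hx _ t _ => ?_
  refine LinearMap.congr_fun (SuperGrading.tensor_hom_ext M.grading N.grading
    (f := e.toLinearMap ∘ₗ (tens M N).ρ x) (f' := P.ρ x ∘ₗ e.toLinearMap)
    fun i j v hv w hw => ?_) t
  have := tensor_ρ_tmul M N hx hv w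
  change e ((tens M N).ρ x (v ⊗ₜ w)) = _
  rw [this]
  exact h n x hx i v hv j w hw

/-- An isomorphism `e` of degree `p` changes the parity of the left vector, hence the sign with
which `x` passes it. Using `e ⊗ sgn p` instead of `e ⊗ 1` compensates this. On the right factor no
correction is needed. -/
theorem Iso.tensor_left {M M' : SuperRep k L} (N : SuperRep k L) (h : M.Iso M') :
    (tens M N).Iso (tens M' N) := by
  obtain ⟨e, ⟨p, hp⟩, he⟩ := h
  refine Iso.of_tensor (P := tens M' N)
    (TensorProduct.congr e (N.grading.sgnEquiv p)) p (fun i j v hv w hw => ?_)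
    fun n x hx i v hv j w hw => ?_
  · rw [TensorProduct.congr_tmul, add_right_comm]
    exact SuperGrading.tmul_mem _ _ (hp i v hv) (N.grading.sgn_mem p hw)
  · rw [map_add, map_smul, TensorProduct.congr_tmul, TensorProduct.congr_tmul,
      TensorProduct.congr_tmul, tensor_ρ_tmul M' N hx (hp i v hv), he,
      SuperGrading.sgnEquiv_apply, SuperGrading.sgnEquiv_apply, ρ_sgn N hx,
      TensorProduct.tmul_smul, smul_smul, SuperGrading.superSign_add_right,
      SuperGrading.superSign_comm p n]

theorem Iso.tensor_right (M : SuperRep k L) {N N' : SuperRep k L} (h : N.Iso N') :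
    (tens M N).Iso (tens M N') := by
  obtain ⟨e, ⟨p, hp⟩, he⟩ := h
  refine Iso.of_tensor (P := tens M N')
    (TensorProduct.congr (LinearEquiv.refl k _) e) p (fun i j v hv w hw => ?_)
    fun n x hx i v hv j w hw => ?_
  · rw [TensorProduct.congr_tmul, add_assoc]
    exact SuperGrading.tmul_mem _ _ hv (hp j w hw)
  · rw [map_add, map_smul, TensorProduct.congr_tmul, TensorProduct.congr_tmul,
      TensorProduct.congr_tmul, LinearEquiv.refl_apply, LinearEquiv.refl_apply,
      tensor_ρ_tmul M N' hx hv, he]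

/-- The symmetry `v ⊗ w ↦ (-1)^(|v| |w|) w ⊗ v`. -/
noncomputable def tensorSwap (M N : SuperRep k L) : (M.V ⊗[k] N.V) →ₗ[k] (N.V ⊗[k] M.V) :=
  (TensorProduct.comm k M.V N.V).toLinearMap ∘ₗ
    (TensorProduct.map LinearMap.id (N.grading.proj 0) +
      TensorProduct.map (M.grading.sgn 1) (N.grading.proj 1))

theorem tensorSwap_tmul (M N : SuperRep k L) {i j : ZMod 2} {v : M.V} {w : N.V}
    (hv : v ∈ M.grading.gr i) (hw : w ∈ N.grading.gr j) :
    tensorSwap M N (v ⊗ₜ w) = superSign k i j • (w ⊗ₜ v) := by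
  rcases zmod_two_cases j with rfl | rfl
  · simp [tensorSwap, N.grading.proj_of_mem hw, N.grading.proj_of_mem_ne (i := 1) (by decide) hw,
      superSign_zero_right]
  · simp [tensorSwap, N.grading.proj_of_mem hw, N.grading.proj_of_mem_ne (i := 0) (by decide) hw,
      M.grading.sgn_of_mem 1 hv, SuperGrading.superSign_comm 1 i]

theorem tensorSwap_tensorSwap (M N : SuperRep k L) (t : M.V ⊗[k] N.V) :
    tensorSwap N M (tensorSwap M N t) = t := by
  refine LinearMap.congr_fun (SuperGrading.tensor_hom_ext M.grading N.grading
    (f := tensorSwap N M ∘ₗ tensorSwap M N) (f' := LinearMap.id) fun i j v hv w hw => ?_) t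
  rw [LinearMap.comp_apply, tensorSwap_tmul M N hv hw, map_smul, tensorSwap_tmul N M hw hv,
    smul_smul, SuperGrading.superSign_comm j i, SuperGrading.superSign_mul_self, one_smul,
    LinearMap.id_apply]

/-- The sign rule in `tensorSwap` is what makes the flip intertwine the two actions. -/
theorem Iso.tensor_comm (M N : SuperRep k L) : (tens M N).Iso (tens N M) := by
  refine Iso.of_tensor (P := tens N M)
    (LinearEquiv.ofLinearMap (tensorSwap M N) (tensorSwap N M)
      (LinearMap.ext (tensorSwap_tensorSwap N M)) (LinearMap.ext (tensorSwap_tensorSwap M N))) 0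
    (fun i j v hv w hw => ?_) fun n x hx i v hv j w hw => ?_
  · change tensorSwap M N _ ∈ _
    rw [tensorSwap_tmul M N hv hw, add_zero, add_comm]
    exact Submodule.smul_mem _ _ (SuperGrading.tmul_mem _ _ hw hv)
  · change tensorSwap M N _ = (tens N M).ρ x (tensorSwap M N _)
    rw [map_add, map_smul,
      tensorSwap_tmul M N (M.ρ_mem hx hv) hw, tensorSwap_tmul M N hv (N.ρ_mem hx hw),
      tensorSwap_tmul M N hv hw, map_smul, tensor_ρ_tmul N M hx hw, smul_add, smul_smul,
      smul_smul, SuperGrading.superSign_add_left, SuperGrading.superSign_add_right,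
      SuperGrading.superSign_comm i n, ← mul_assoc, SuperGrading.superSign_mul_self, one_mul,
      add_comm, mul_comm (superSign k n j)]

theorem Iso.tensor_assoc (M N P : SuperRep k L) :
    (tens (tens M N) P).Iso (tens M (tens N P)) := by
  refine Iso.symm (Iso.of_tensor (M := M) (N := tens N P) (P := (tens (tens M N) P))
    (TensorProduct.assoc k M.V N.V P.V).symm 0 (fun i j v hv t ht => ?_)
    fun n x hx i v hv j t ht => ?_)
  · rw [add_zero]
    induction ht using Submodule.span_induction with
    | zero => simp
    | add a b _ _ ha hb => rw [TensorProduct.tmul_add, map_add]; exact add_mem ha hb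
    | smul c a _ ha => rw [TensorProduct.tmul_smul, map_smul]; exact Submodule.smul_mem _ _ ha
    | mem a ha =>
      obtain ⟨j, l, rfl, w, hw, p, hp, rfl⟩ := ha
      rw [TensorProduct.assoc_symm_tmul, ← add_assoc]
      exact SuperGrading.tmul_mem _ _ (SuperGrading.tmul_mem _ _ hv hw) hp
  · clear ht
    have key := SuperGrading.tensor_hom_ext N.grading P.grading
      (f := (TensorProduct.assoc k M.V N.V P.V).symm.toLinearMap ∘ₗ
        (TensorProduct.mk k M.V (N.V ⊗[k] P.V) (M.ρ x v) +
          superSign k n i • TensorProduct.mk k M.V (N.V ⊗[k] P.V) v ∘ₗ (tens N P).ρ x))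
      (f' := (tens (tens M N) P).ρ x ∘ₗ (TensorProduct.assoc k M.V N.V P.V).symm.toLinearMap ∘ₗ
        TensorProduct.mk k M.V (N.V ⊗[k] P.V) v) fun j l w hw p hp => by
      have h1 := tensor_ρ_tmul N P hx hw p
      have h2 := tensor_ρ_tmul (tens M N) P hx (SuperGrading.tmul_mem _ _ hv hw) p
      have h3 := tensor_ρ_tmul M N hx hv w
      change (TensorProduct.assoc k M.V N.V P.V).symm (M.ρ x v ⊗ₜ (w ⊗ₜ p) +
          superSign k n i • (v ⊗ₜ[k] (tens N P).ρ x (w ⊗ₜ p))) =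
        (tens (tens M N) P).ρ x ((TensorProduct.assoc k M.V N.V P.V).symm (v ⊗ₜ (w ⊗ₜ p)))
      rw [h1, TensorProduct.assoc_symm_tmul]
      refine Eq.trans ?_ h2.symm
      rw [h3, TensorProduct.tmul_add, TensorProduct.tmul_smul, smul_add, smul_smul, map_add,
        map_add, map_smul, map_smul, TensorProduct.assoc_symm_tmul,
        TensorProduct.assoc_symm_tmul, TensorProduct.assoc_symm_tmul, TensorProduct.add_tmul,
        SuperGrading.superSign_add_right, ← TensorProduct.smul_tmul', add_assoc]
    exact LinearMap.congr_fun key t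

/-- The trivial representation, with reducible underlying data. -/
abbrev triv (k : Type u) (L : Type v) [Field k] [AddCommGroup L] [Module k L]
    [LieSuperalgebra k L] : SuperRep k L where
  V := k
  grading := ⟨fun i => if i = 0 then ⊤ else ⊥, by simpa using isCompl_top_bot⟩
  ρ := 0
  ρ_mem _ _ := zero_mem _
  ρ_bracket _ _ v := by simp

theorem Iso.trivial_tensor (M : SuperRep k L) : (tens (triv k L) M).Iso M := by
  refine Iso.of_tensor (M := triv k L) (N := M) (P := M) (TensorProduct.lid k M.V) 0
    (fun i j (c : k) hc w hw => ?_) fun n x hx i (c : k) hc j w hw => ?_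
  · rw [TensorProduct.lid_tmul, add_zero]
    rcases zmod_two_cases i with rfl | rfl
    · rw [zero_add]; exact Submodule.smul_mem _ _ hw
    · have : c = 0 := hc
      rw [this, zero_smul]; exact zero_mem _
  · have h0 : (triv k L).ρ x c = (0 : k) := rfl
    rw [h0, TensorProduct.zero_tmul, zero_add, map_smul]
    rw [TensorProduct.lid_tmul, TensorProduct.lid_tmul]
    rcases zmod_two_cases i with rfl | rfl
    · rw [superSign_zero_right, one_smul, map_smul]
    · have : c = 0 := hc
      rw [this]; simp

theorem Iso.tensor_left_comm (M N P : SuperRep k L) :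
    (tens M (tens N P)).Iso (tens N (tens M P)) :=
  ((Iso.tensor_assoc M N P).symm.trans ((Iso.tensor_comm M N).tensor_left P)).trans
    (Iso.tensor_assoc N M P)

theorem Iso.pullback_tensor (M N : SuperRep k L') (f : LieSuperalgebra.Hom k L L') :
    (tens (M.pullback f) (N.pullback f)).Iso ((tens M N).pullback f) := by
  refine Iso.of_tensor (M := M.pullback f) (N := N.pullback f) (P := (tens M N).pullback f)
    (LinearEquiv.refl k _) 0
    (fun i j v hv w hw => ?_) fun n x hx i v hv j w hw => ?_
  · rw [add_zero]
    exact SuperGrading.tmul_mem M.grading N.grading hv hw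
  · exact (tensor_ρ_tmul M N (f.map_mem hx) hv w).symm

end SuperRep

namespace LieSuperalgebra.Hom

variable {k : Type*} {L L' : Type*} [Field k] [AddCommGroup L] [Module k L] [LieSuperalgebra k L]
  [AddCommGroup L'] [Module k L'] [LieSuperalgebra k L']

theorem map_proj (f : LieSuperalgebra.Hom k L L') (i : ZMod 2) (x : L) :
    f.toLinearMap ((grading (k := k)).proj i x) = (grading (k := k)).proj i (f.toLinearMap x) := by
  have := (grading (k := k) (L := L)).hom_ext (f := f.toLinearMap ∘ₗ (grading (k := k)).proj i)
    (f' := (grading (k := k)).proj i ∘ₗ f.toLinearMap) fun j x hx => by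
      by_cases h : i = j
      · subst h
        simp [SuperGrading.proj_of_mem _ hx, SuperGrading.proj_of_mem _ (f.map_mem hx)]
      · simp [SuperGrading.proj_of_mem_ne _ h hx, SuperGrading.proj_of_mem_ne _ h (f.map_mem hx)]
  exact LinearMap.congr_fun this x

end LieSuperalgebra.Hom

namespace SuperRep

variable {k : Type u} {L : Type v} [Field k] [AddCommGroup L] [Module k L] [LieSuperalgebra k L]
  {L' : Type w} [AddCommGroup L'] [Module k L'] [LieSuperalgebra k L']

theorem Iso.pullback_pullback {L'' : Type*} [AddCommGroup L''] [Module k L'']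
    [LieSuperalgebra k L''] (M : SuperRep k L'') (f : LieSuperalgebra.Hom k L' L'')
    (f' : LieSuperalgebra.Hom k L L') (f'' : LieSuperalgebra.Hom k L L'')
    (h : ∀ x, f.toLinearMap (f'.toLinearMap x) = f''.toLinearMap x) :
    ((M.pullback f).pullback f').Iso (M.pullback f'') :=
  ⟨LinearEquiv.refl k _, ⟨0, fun i v hv => by rw [add_zero]; exact hv⟩, fun x v =>
    congrArg (fun y => M.ρ y v) (h x)⟩

theorem tensorρ_eq_zero (M N : SuperRep k L) {x : L} (hM : M.ρ x = 0)
    (hN : ∀ i, N.ρ ((LieSuperalgebra.grading (k := k)).proj i x) = 0) : tensorρ M N x = 0 := by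
  change TensorProduct.map (M.ρ x) LinearMap.id +
    TensorProduct.map LinearMap.id (N.ρ ((LieSuperalgebra.grading (k := k)).proj 0 x)) +
    TensorProduct.map M.grading.parity (N.ρ ((LieSuperalgebra.grading (k := k)).proj 1 x)) = 0
  rw [hM, hN, hN]
  simp

theorem tensorρ_of_right_eq_zero (M N : SuperRep k L) {x : L}
    (hN : ∀ i, N.ρ ((LieSuperalgebra.grading (k := k)).proj i x) = 0) :
    tensorρ M N x = TensorProduct.map (M.ρ x) LinearMap.id := by
  change TensorProduct.map (M.ρ x) LinearMap.id +
    TensorProduct.map LinearMap.id (N.ρ ((LieSuperalgebra.grading (k := k)).proj 0 x)) +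
    TensorProduct.map M.grading.parity (N.ρ ((LieSuperalgebra.grading (k := k)).proj 1 x)) = _
  rw [hN, hN]
  simp

end SuperRep

/-! ### Separation of rational points by functions -/

namespace RatPoint

variable {k : Type*} {A : Type*} [Field k] [CommRing A] [Algebra k A]

theorem eval_eq_zero_iff (m : RatPoint k A) (a : A) : m.eval a = 0 ↔ a ∈ m.1.asIdeal := by
  rw [eval, AlgHom.comp_apply, ← Ideal.Quotient.eq_zero_iff_mem]
  exact EmbeddingLike.map_eq_zero_iff (f := (AlgEquiv.ofBijective (Algebra.ofId k
    (A ⧸ m.1.asIdeal)) m.2).symm)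

theorem eval_eq_iff (m : RatPoint k A) (a : A) (c : k) :
    m.eval a = c ↔ a - algebraMap k A c ∈ m.1.asIdeal := by
  rw [← eval_eq_zero_iff, map_sub, AlgHom.commutes, sub_eq_zero, Algebra.algebraMap_self_apply]

theorem ext_asIdeal {m n : RatPoint k A} (h : m.1.asIdeal ≤ n.1.asIdeal) : m = n := by
  refine Subtype.ext (MaximalSpectrum.ext ?_)
  exact m.1.isMaximal.eq_of_le n.1.isMaximal.ne_top h

/-- Finitely many rational points are separated from a further one by a function. -/
theorem exists_eval_eq_one (m : RatPoint k A) (s : Finset (RatPoint k A)) (hs : m ∉ s) :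
    ∃ a : A, m.eval a = 1 ∧ ∀ n ∈ s, n.eval a = 0 := by
  classical
  induction s using Finset.induction_on with
  | empty => exact ⟨1, map_one _, by simp⟩
  | insert n s _ ih =>
    rw [Finset.mem_insert, not_or] at hs
    obtain ⟨a, ha, has⟩ := ih hs.2
    -- Distinct maximal ideals are not contained in one another; multiplying by `b` kills the new
    -- point `n`.
    obtain ⟨b, hbn, hbm⟩ : ∃ b ∈ n.1.asIdeal, b ∉ m.1.asIdeal := by
      by_contra! h
      exact hs.1 (ext_asIdeal h).symm
    rw [← eval_eq_zero_iff] at hbn hbm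
    refine ⟨(m.eval b)⁻¹ • (b * a), by simp [ha, hbm], fun q hq => ?_⟩
    rw [Finset.mem_insert] at hq
    rcases hq with rfl | hq
    · simp [hbn]
    · simp [has q hq]

variable {Γ : Type*} [Group Γ] [MulSemiringAction Γ A] [SMulCommClass Γ k A]

theorem eval_smul (γ : Γ) (m : RatPoint k A) (a : A) : (γ • m).eval a = m.eval (γ⁻¹ • a) := by
  rw [eval_eq_iff]
  change γ⁻¹ • (a - _) ∈ m.1.asIdeal
  rw [smul_sub, smul_algebraMap, ← eval_eq_iff]

end RatPoint

/-! ### Evaluation on fixed points, and independence of the choices -/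

section Evaluation

open LieSuperalgebra

variable {Γ : Type*} [Group Γ] {k : Type u} [Field k]
  {g : Type*} [AddCommGroup g] [Module k g] [LieSuperalgebra k g] [LieSuperalgebra.Action Γ k g]
  {A : Type*} [CommRing A] [Algebra k A] [MulSemiringAction Γ A] [SMulCommClass Γ k A]

omit [LieSuperalgebra k g] in
theorem evalLin_tmul (m : RatPoint k A) (y : g) (a : A) :
    evalLin g m (y ⊗ₜ a) = m.eval a • y := by
  simp [evalLin]

theorem evalLin_smul (γ : Γ) (m : RatPoint k A) (t : g ⊗[k] A) :
    evalLin g (γ • m) (diagMap Γ k g A γ t) = γ • evalLin g m t := by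
  induction t with
  | zero => simp
  | add a b ha hb => simp only [map_add, ha, hb, smul_add]
  | tmul y a =>
    change evalLin g (γ • m) ((γ • y) ⊗ₜ (γ • a)) = _
    rw [evalLin_tmul, evalLin_tmul, RatPoint.eval_smul, inv_smul_smul]
    exact (smul_comm γ _ _).symm

theorem evalHom_smul (γ : Γ) (m : RatPoint k A) (x : EquivariantMaps Γ k g A) :
    (evalHom Γ (γ • m)).toLinearMap x = γ • (evalHom (g := g) Γ m).toLinearMap x := by
  change evalLin g (γ • m) (x : g ⊗[k] A) = γ • evalLin g m (x : g ⊗[k] A)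
  rw [← evalLin_smul, x.2 γ]

/-- The element is the orbit sum of `y ⊗ a`, where `a` is 1 at `m` and 0 at the rest of the orbit of
`m` and at the orbits of the points of `s`. Evaluating at `m` leaves only the summand of `γ = 1`. -/
theorem exists_evalHom_eq [Finite Γ] (hfree : ∀ (γ : Γ) (m : RatPoint k A), γ • m = m → γ = 1)
    (m : RatPoint k A) (s : List (RatPoint k A)) (hs : ∀ n ∈ s, ∀ γ : Γ, γ • m ≠ n) (y : g) :
    ∃ x : EquivariantMaps Γ k g A,
      (∀ i, y ∈ (grading (k := k)).gr i → x ∈ (grading (k := k)).gr i) ∧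
      (evalHom Γ m).toLinearMap x = y ∧ ∀ n ∈ s, (evalHom Γ n).toLinearMap x = 0 := by
  classical
  have := Fintype.ofFinite Γ
  -- The points at which `a` has to vanish. By freeness `m` itself is not among them.
  let bad : Finset (RatPoint k A) :=
    ((Finset.univ.erase (1 : Γ)).image fun γ => γ • m) ∪
      (Finset.univ ×ˢ s.toFinset).image fun p : Γ × RatPoint k A => p.1 • p.2
  obtain ⟨a, ha1, ha0⟩ := m.exists_eval_eq_one bad (by
    simp only [bad, Finset.mem_union, Finset.mem_image, Finset.mem_erase, Finset.mem_univ,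
      and_true, Finset.mem_product, true_and, List.mem_toFinset, not_or, not_exists, not_and]
    refine ⟨fun γ hγ h => hγ (hfree γ m h), fun p hp h => hs p.2 hp p.1⁻¹ ?_⟩
    rw [← h, inv_smul_smul])
  let t : g ⊗[k] A := ∑ γ : Γ, (γ • y) ⊗ₜ (γ • a)
  have ht : t ∈ EquivariantMaps Γ k g A := fun δ => by
    rw [map_sum]
    refine Fintype.sum_equiv (Equiv.mulLeft δ) _ _ fun γ => ?_
    change (δ • γ • y) ⊗ₜ[k] (δ • γ • a) = ((δ * γ) • y) ⊗ₜ ((δ * γ) • a)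
    rw [mul_smul, mul_smul]
  have hev : ∀ n : RatPoint k A, evalLin g n t = ∑ γ : Γ, (γ⁻¹ • n).eval a • γ • y := fun n => by
    rw [map_sum]
    refine Finset.sum_congr rfl fun γ _ => ?_
    rw [evalLin_tmul, RatPoint.eval_smul, inv_inv]
  refine ⟨⟨t, ht⟩, fun i hy => ?_, ?_, fun n hn => ?_⟩
  · change t ∈ ((grading (k := k) (L := g)).tensorEven A).gr i
    exact sum_mem fun γ _ => Submodule.subset_span ⟨γ • y, Action.smul_mem γ hy, γ • a, rfl⟩
  · change evalLin g m t = y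
    rw [hev, Finset.sum_eq_single 1]
    · simp [ha1]
    · intro γ _ hγ
      rw [ha0, zero_smul]
      refine Finset.mem_union_left _ (Finset.mem_image.2 ⟨γ⁻¹, ?_, rfl⟩)
      simpa using hγ
    · simp
  · change evalLin g n t = 0
    rw [hev]
    refine Finset.sum_eq_zero fun γ _ => ?_
    rw [ha0, zero_smul]
    exact Finset.mem_union_right _ (Finset.mem_image.2 ⟨(γ⁻¹, n), by simpa using hn, rfl⟩)

/-- Evaluation respects degrees, so the homogeneous components of `x` vanish at these points as
well; the signed tensor action needs them separately. -/
theorem evalRep_ρ_eq_zero (l : List (RatPoint k A × SuperRep k g)) {x : EquivariantMaps Γ k g A}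
    (hx : ∀ p ∈ l, (evalHom Γ p.1).toLinearMap x = 0) : (evalRep Γ l).ρ x = 0 := by
  induction l generalizing x with
  | nil => rfl
  | cons p l ih =>
    refine SuperRep.tensorρ_eq_zero (p.2.pullback (evalHom Γ p.1)) (evalRep Γ l) ?_ fun i => ?_
    · change p.2.ρ ((evalHom Γ p.1).toLinearMap x) = 0
      rw [hx p (by simp), map_zero]
    · refine ih fun q hq => ?_
      rw [Hom.map_proj, hx q (by simp [hq]), map_zero]

theorem evalRep_perm {l l' : List (RatPoint k A × SuperRep k g)} (h : l.Perm l') :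
    (evalRep Γ l).Iso (evalRep Γ l') := by
  induction h with
  | nil => exact SuperRep.Iso.refl _
  | cons p _ ih => exact SuperRep.Iso.tensor_right _ ih
  | swap p q l => exact SuperRep.Iso.tensor_left_comm _ _ _
  | trans _ _ h1 h2 => exact h1.trans h2

theorem evalRep_cons_congr {p q : RatPoint k A × SuperRep k g}
    {l l' : List (RatPoint k A × SuperRep k g)}
    (h : (p.2.pullback (evalHom Γ p.1)).Iso (q.2.pullback (evalHom Γ q.1)))
    (hl : (evalRep Γ l).Iso (evalRep Γ l')) : (evalRep Γ (p :: l)).Iso (evalRep Γ (q :: l')) :=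
  (SuperRep.Iso.tensor_left _ h).trans (SuperRep.Iso.tensor_right _ hl)

/-- On fixed points the value at `γ m` is `γ` applied to the value at `m`, so the twist by `γ⁻¹`
cancels the move of the point. -/
theorem pullback_evalHom_smul (γ : Γ) (m : RatPoint k A) (M : SuperRep k g) :
    ((M.pullback (actionHom k g γ⁻¹)).pullback (evalHom Γ (γ • m))).Iso
      (M.pullback (evalHom Γ m)) := by
  refine SuperRep.Iso.pullback_pullback M _ _ _ fun x => ?_
  change γ⁻¹ • (evalHom Γ (γ • m)).toLinearMap x = _
  rw [evalHom_smul, inv_smul_smul]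

theorem RepClass.mk_eq_mk_iff {L : Type*} [AddCommGroup L] [Module k L] [LieSuperalgebra k L]
    {M N : SuperRep k L} : RepClass.mk M = RepClass.mk N ↔ M.Iso N :=
  ⟨fun h => Quotient.exact h, fun h => Quotient.sound h⟩

theorem RepClass.twist_mk (γ : Γ) (M : SuperRep k g) :
    (RepClass.mk M).twist γ = RepClass.mk (M.pullback (actionHom k g γ⁻¹)) := rfl

theorem RepClass.exists_mk_eq {L : Type*} [AddCommGroup L] [Module k L] [LieSuperalgebra k L]
    (c : RepClass k L) : ∃ M, RepClass.mk M = c := Quotient.exists_rep c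

theorem RepClass.twist_mul (γ δ : Γ) (c : RepClass k g) :
    c.twist (γ * δ) = (c.twist δ).twist γ := by
  obtain ⟨M, rfl⟩ := c.exists_mk_eq
  rw [twist_mk, twist_mk, twist_mk, mk_eq_mk_iff]
  refine ⟨LinearEquiv.refl k _, ⟨0, fun i v hv => by rw [add_zero]; exact hv⟩, fun x v => ?_⟩
  change M.ρ ((γ * δ)⁻¹ • x) v = M.ρ (δ⁻¹ • γ⁻¹ • x) v
  rw [mul_inv_rev, mul_smul]

theorem RepClass.twist_one (c : RepClass k g) : c.twist (1 : Γ) = c := by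
  obtain ⟨M, rfl⟩ := c.exists_mk_eq
  rw [twist_mk, mk_eq_mk_iff]
  refine ⟨LinearEquiv.refl k _, ⟨0, fun i v hv => by rw [add_zero]; exact hv⟩, fun x v => ?_⟩
  change M.ρ ((1 : Γ)⁻¹ • x) v = M.ρ x v
  rw [inv_one, one_smul]

theorem RepClass.twist_isIrreducible (γ : Γ) {c : RepClass k g} (h : c.IsIrreducible) :
    (c.twist γ).IsIrreducible := by
  obtain ⟨M, rfl⟩ := c.exists_mk_eq
  change (M.pullback (actionHom k g γ⁻¹)).IsIrreducible
  have h : M.IsIrreducible := h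
  refine ⟨h.1, fun U hU hs => h.2 U hU fun x v hv => ?_⟩
  have := hs (γ • x) v hv
  change M.ρ (γ⁻¹ • γ • x) v ∈ U at this
  rwa [inv_smul_smul] at this

theorem pullback_evalHom_of_twist {γ : Γ} {p q : RatPoint k A × SuperRep k g}
    (h : γ • q.1 = p.1) (hc : RepClass.mk p.2 = (RepClass.mk q.2).twist γ) :
    (p.2.pullback (evalHom Γ p.1)).Iso (q.2.pullback (evalHom Γ q.1)) := by
  obtain ⟨m, M⟩ := p
  subst h
  rw [RepClass.twist_mk, RepClass.mk_eq_mk_iff] at hc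
  exact (SuperRep.Iso.pullback _ hc).trans (pullback_evalHom_smul γ q.1 q.2)

/-- Two evaluation representations at systems of points that meet the same orbits, with matching
factors, are isomorphic. -/
theorem evalRep_iso_of_matching :
    ∀ {l l' : List (RatPoint k A × SuperRep k g)},
    l.Pairwise (fun p q => ∀ γ : Γ, γ • p.1 ≠ q.1) →
    l'.Pairwise (fun p q => ∀ γ : Γ, γ • p.1 ≠ q.1) →
    (∀ p ∈ l, ∃ q ∈ l', ∃ γ : Γ, γ • q.1 = p.1) →
    (∀ q ∈ l', ∃ p ∈ l, ∃ γ : Γ, γ • q.1 = p.1) →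
    (∀ p ∈ l, ∀ q ∈ l', ∀ γ : Γ, γ • q.1 = p.1 →
      (p.2.pullback (evalHom Γ p.1)).Iso (q.2.pullback (evalHom Γ q.1))) →
    (evalRep Γ l).Iso (evalRep Γ l')
  | [], l', _, _, _, h2, _ => by
    cases l' with
    | nil => exact SuperRep.Iso.refl _
    | cons q l' => obtain ⟨p, hp, -⟩ := h2 q (by simp); simp at hp
  | p :: l, l', hl, hl', h1, h2, h3 => by
    -- The partner of the head of `l` is brought to the front of `l'`. Each list meets an orbit at
    -- most once, so the tails still match.
    obtain ⟨q, hq, γ, hγ⟩ := h1 p (by simp)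
    obtain ⟨s, t, rfl⟩ := List.append_of_mem hq
    have hperm : (s ++ q :: t).Perm (q :: (s ++ t)) := List.perm_middle
    rw [hperm.pairwise_iff fun {a b} h δ hδ => h δ⁻¹ (by rw [← hδ, inv_smul_smul])] at hl'
    rw [List.pairwise_cons] at hl hl'
    refine SuperRep.Iso.trans ?_ (evalRep_perm hperm.symm)
    refine evalRep_cons_congr (h3 p (by simp) q (by simp) γ hγ)
      (evalRep_iso_of_matching hl.2 hl'.2 (fun p' hp' => ?_) (fun q' hq' => ?_)
        fun p' hp' q' hq' => h3 p' (by simp [hp']) q' ?_)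
    · obtain ⟨q', hq', δ, hδ⟩ := h1 p' (by simp [hp'])
      rw [hperm.mem_iff, List.mem_cons] at hq'
      rcases hq' with rfl | hq'
      · exact absurd (show (δ * γ⁻¹) • p.1 = p'.1 by rw [← hγ, ← hδ, mul_smul, inv_smul_smul])
          (hl.1 p' hp' _)
      · exact ⟨q', hq', δ, hδ⟩
    · obtain ⟨p', hp', δ, hδ⟩ := h2 q' (by rw [hperm.mem_iff]; simp [hq'])
      rw [List.mem_cons] at hp'
      rcases hp' with rfl | hp'
      · exact absurd (show (δ⁻¹ * γ) • q.1 = q'.1 by rw [mul_smul, hγ, ← hδ, inv_smul_smul])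
          (hl'.1 q' hq' _)
      · exact ⟨p', hp', δ, hδ⟩
    · rw [hperm.mem_iff]; simp [hq']

theorem EquivariantFun.Presents.iso {Ψ : EquivariantFun Γ k g A}
    {l l' : List (RatPoint k A × SuperRep k g)} (h : Ψ.Presents l) (h' : Ψ.Presents l') :
    (evalRep Γ l).Iso (evalRep Γ l') := by
  refine evalRep_iso_of_matching h.1 h'.1 (fun p hp => h'.2.2.1 _ (h.2.1 p hp)) (fun q hq => ?_)
    fun p hp q hq γ hγ => ?_
  · obtain ⟨p, hp, γ, hγ⟩ := h.2.2.1 _ (h'.2.1 q hq)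
    exact ⟨p, hp, γ⁻¹, by rw [← hγ, inv_smul_smul]⟩
  · refine pullback_evalHom_of_twist hγ ?_
    rw [h.2.2.2 p hp, h'.2.2.2 q hq, ← hγ, Ψ.equivariant]

theorem EquivariantFun.evalClass_eq {Ψ : EquivariantFun Γ k g A}
    {l : List (RatPoint k A × SuperRep k g)} (h : Ψ.Presents l) :
    RepClass.mk (evalRep Γ l) = Ψ.evalClass :=
  RepClass.mk_eq_mk_iff.2 (h.iso Ψ.exists_presents.choose_spec)

end Evaluation

/-! ### Schur's lemma, odd symmetries and density -/

namespace SuperRep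

variable {k : Type u} {L : Type v} [Field k] [AddCommGroup L] [Module k L] [LieSuperalgebra k L]

/-- The operators of the representation generate the algebra of all linear operators. -/
def IsDense (M : SuperRep k L) : Prop :=
  Algebra.adjoin k (Set.range fun x => (M.ρ x : Module.End k M.V)) = ⊤

/-- There is no invertible odd operator that commutes with the action. -/
def HasNoOddSymmetry (M : SuperRep k L) : Prop :=
  ∀ J : M.V →ₗ[k] M.V, (∀ i, ∀ v ∈ M.grading.gr i, J v ∈ M.grading.gr (i + 1)) →
    (∀ x v, J (M.ρ x v) = M.ρ x (J v)) → ¬ Function.Bijective J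

/-- Schur: since `T` is homogeneous, its kernel and range are graded subrepresentations. -/
theorem IsIrreducible.bijective_of_ne_zero {M N : SuperRep k L} (hM : M.IsIrreducible)
    (hN : N.IsIrreducible) {p : ZMod 2} (T : M.V →ₗ[k] N.V)
    (hp : ∀ i, ∀ v ∈ M.grading.gr i, T v ∈ N.grading.gr (i + p))
    (hT : ∀ x v, T (M.ρ x v) = N.ρ x (T v)) (h0 : T ≠ 0) : Function.Bijective T := by
  have hproj : ∀ i v, T (M.grading.proj i v) = N.grading.proj (i + p) (T v) := fun i v => by
    have h := M.grading.hom_ext (f := T ∘ₗ M.grading.proj i)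
      (f' := N.grading.proj (i + p) ∘ₗ T) (fun j x hx => by
        simp only [LinearMap.comp_apply]
        by_cases hij : i = j
        · subst hij
          rw [SuperGrading.proj_of_mem _ hx, SuperGrading.proj_of_mem _ (hp _ _ hx)]
        · rw [SuperGrading.proj_of_mem_ne _ hij hx,
            SuperGrading.proj_of_mem_ne _ (fun h' => hij (add_right_cancel h')) (hp _ _ hx),
            map_zero])
    exact LinearMap.congr_fun h v
  refine ⟨LinearMap.ker_eq_bot.1 ?_, LinearMap.range_eq_top.1 ?_⟩
  · refine (hM.2 (LinearMap.ker T) (fun u hu i => ?_) fun x v hv => ?_).resolve_right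
      fun h => h0 (LinearMap.ker_eq_top.1 h)
    · rw [LinearMap.mem_ker] at hu ⊢
      rw [hproj, hu, map_zero]
    · rw [LinearMap.mem_ker] at hv ⊢
      rw [hT, hv, map_zero]
  · refine (hN.2 (LinearMap.range T) (fun u hu i => ?_) fun x v hv => ?_).resolve_left
      fun h => h0 (LinearMap.range_eq_bot.1 h)
    · obtain ⟨v, rfl⟩ := hu
      refine ⟨M.grading.proj (i + p) v, ?_⟩
      rw [hproj, add_assoc]
      rw [(by decide : ∀ q : ZMod 2, q + q = 0) p, add_zero]
    · obtain ⟨v, rfl⟩ := hv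
      exact ⟨M.ρ x v, hT x v⟩

theorem commute_ext (M : SuperRep k L) {T : M.V →ₗ[k] M.V}
    (h : ∀ i, ∀ x ∈ (LieSuperalgebra.grading (k := k) (L := L)).gr i, ∀ v,
      T (M.ρ x v) = M.ρ x (T v)) (x : L) (v : M.V) : T (M.ρ x v) = M.ρ x (T v) := by
  rw [← (LieSuperalgebra.grading (k := k) (L := L)).proj_add_proj x]
  simp only [map_add, LinearMap.add_apply]
  rw [h _ _ (SuperGrading.proj_mem _ 0 x), h _ _ (SuperGrading.proj_mem _ 1 x)]

theorem sgn_conj_commute (M : SuperRep k L) {T : M.V →ₗ[k] M.V}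
    (h : ∀ x v, T (M.ρ x v) = M.ρ x (T v)) (x : L) (v : M.V) :
    M.grading.sgn 1 (T (M.grading.sgn 1 (M.ρ x v))) =
      M.ρ x (M.grading.sgn 1 (T (M.grading.sgn 1 v))) := by
  refine commute_ext M (T := M.grading.sgn 1 ∘ₗ T ∘ₗ M.grading.sgn 1) (fun i x hx v => ?_) x v
  simp only [LinearMap.comp_apply]
  rw [ρ_sgn M hx, map_smul, h, map_smul, ρ_sgn M hx, smul_smul, SuperGrading.superSign_mul_self,
    one_smul]

theorem isGraded_of_sgn (M : SuperRep k L) [CharZero k] {U : Submodule k M.V}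
    (h : ∀ u ∈ U, M.grading.sgn 1 u ∈ U) : M.grading.IsGraded U :=
  M.grading.isGraded_iff_sgn two_ne_zero h

/-- The odd part of `T` commutes with the action too, so it is zero or an odd symmetry; hence `T` is
even. Its eigenspaces are then graded subrepresentations. -/
theorem IsIrreducible.commutant_eq_scalar [IsAlgClosed k] [CharZero k] {M : SuperRep k L}
    (hM : M.IsIrreducible) (hJ : M.HasNoOddSymmetry) (T : M.V →ₗ[k] M.V)
    (hT : ∀ x v, T (M.ρ x v) = M.ρ x (T v)) : ∃ c : k, ∀ v, T v = c • v := by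
  set σ := M.grading.sgn 1 with hσ
  have hss : ∀ v, σ (σ v) = v := M.grading.sgn_sgn 1
  have hc := M.sgn_conj_commute hT
  have heven : ∀ v, σ (T (σ v)) = T v := by
    by_contra hne
    -- Conjugation by `σ` fixes the even part of `T` and negates the odd part, so `J` is twice the
    -- odd part.
    let J : M.V →ₗ[k] M.V := T - σ ∘ₗ T ∘ₗ σ
    have hJ0 : J ≠ 0 := fun h => hne fun v => by
      have := LinearMap.congr_fun h v
      exact (sub_eq_zero.1 this).symm
    have hJc : ∀ x v, J (M.ρ x v) = M.ρ x (J v) := fun x v => by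
      change T (M.ρ x v) - σ (T (σ (M.ρ x v))) = M.ρ x (T v - σ (T (σ v)))
      rw [hT, hc, map_sub]
    have hJodd : ∀ i, ∀ v ∈ M.grading.gr i, J v ∈ M.grading.gr (i + 1) := fun i v hv => by
      have h2 : J v = T v - superSign k 1 i • σ (T v) := by
        change T v - σ (T (σ v)) = _
        rw [hσ, M.grading.sgn_of_mem 1 hv, map_smul, map_smul]
      have h3 : J v = (2 : k) • M.grading.proj (i + 1) (T v) := by
        rw [h2, hσ]
        conv_lhs => enter [1]; rw [← M.grading.proj_add_proj (T v)]
        rcases zmod_two_cases i with rfl | rfl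
        · simp [SuperGrading.sgn, superSign_one_one, superSign_zero_right, two_smul]
        · simp [SuperGrading.sgn, superSign_one_one, two_smul, show (1 + 1 : ZMod 2) = 0 by decide]
      rw [h3]
      exact Submodule.smul_mem _ _ (M.grading.proj_mem _ _)
    exact hJ J hJodd hJc (hM.bijective_of_ne_zero hM J hJodd hJc hJ0)
  have := hM.1
  obtain ⟨c, hc⟩ := Module.End.exists_eigenvalue (K := k) (V := M.V) T
  refine ⟨c, fun v => ?_⟩
  have h := (hM.2 (Module.End.eigenspace T c) (M.isGraded_of_sgn fun u hu => ?_)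
    fun x u hu => ?_).resolve_left hc
  · exact Module.End.mem_eigenspace_iff.1 (h ▸ Submodule.mem_top : v ∈ Module.End.eigenspace T c)
  · rw [Module.End.mem_eigenspace_iff] at hu ⊢
    rw [← heven, ← hσ, hss, hu, map_smul]
  · rw [Module.End.mem_eigenspace_iff] at hu ⊢
    rw [hT, hu, map_smul]

/-- Here `U` need not be graded. If `σ` is the parity operator, `U ∩ σU` and `U + σU` are graded
subrepresentations; the only case that does not settle itself is `V = U ⊕ σU`. -/
theorem IsIrreducible.stable_eq_bot_or_top [IsAlgClosed k] [CharZero k] {M : SuperRep k L}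
    (hM : M.IsIrreducible) (hJ : M.HasNoOddSymmetry) (U : Submodule k M.V)
    (hU : ∀ x, ∀ v ∈ U, M.ρ x v ∈ U) : U = ⊥ ∨ U = ⊤ := by
  set σ := M.grading.sgn 1 with hσ
  have hss : ∀ v, σ (σ v) = v := M.grading.sgn_sgn 1
  let U' := U.comap σ
  have hU' : ∀ x, ∀ v ∈ U', M.ρ x v ∈ U' := by
    have key : ∀ i, ∀ x ∈ (LieSuperalgebra.grading (k := k) (L := L)).gr i, ∀ v ∈ U',
        M.ρ x v ∈ U' := fun i x hx v hv => by
      change σ (M.ρ x v) ∈ U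
      rw [hσ, ρ_sgn M hx]
      exact U.smul_mem _ (hU x _ hv)
    intro x v hv
    rw [← (LieSuperalgebra.grading (k := k) (L := L)).proj_add_proj x, map_add]
    exact add_mem (key _ _ (SuperGrading.proj_mem _ 0 x) v hv)
      (key _ _ (SuperGrading.proj_mem _ 1 x) v hv)
  have hinf := hM.2 (U ⊓ U') (M.isGraded_of_sgn fun u hu => ⟨hu.2, by
    change σ (σ u) ∈ U; rw [hss]; exact hu.1⟩) fun x v hv => ⟨hU x v hv.1, hU' x v hv.2⟩
  have hsup := hM.2 (U ⊔ U') (M.isGraded_of_sgn fun u hu => by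
    obtain ⟨a, ha, b, hb, rfl⟩ := Submodule.mem_sup.1 hu
    rw [map_add, add_comm]
    exact Submodule.add_mem_sup hb (by change σ (σ a) ∈ U; rw [hss]; exact ha)) fun x v hv => by
      obtain ⟨a, ha, b, hb, rfl⟩ := Submodule.mem_sup.1 hv
      rw [map_add]
      exact Submodule.add_mem_sup (hU x a ha) (hU' x b hb)
  rcases hinf with hinf | hinf
  · rcases hsup with hsup | hsup
    · left; exact eq_bot_iff.2 (le_sup_left.trans hsup.le)
    · have hcompl : IsCompl U U' := ⟨disjoint_iff.2 hinf, codisjoint_iff.2 hsup⟩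
      -- Both summands are stable, so the projection lies in the commutant and is a scalar. As `U`
      -- and `σU` have the same dimension, this forces `U = 0`.
      obtain ⟨c, hc⟩ := hM.commutant_eq_scalar hJ (U.projection U' hcompl) fun x v => by
        obtain ⟨a, ha, b, hb, rfl⟩ : ∃ a ∈ U, ∃ b ∈ U', a + b = v :=
          Submodule.mem_sup.1 (by rw [hsup]; trivial)
        simp only [map_add]
        rw [Submodule.projection_apply_of_mem_left hcompl ha,
          Submodule.projection_apply_of_mem_right hcompl hb,
          Submodule.projection_apply_of_mem_left hcompl (hU x a ha),
          Submodule.projection_apply_of_mem_right hcompl (hU' x b hb), map_zero]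
      by_cases hc0 : c = 0
      · left
        refine eq_bot_iff.2 fun u hu => ?_
        have := hc u
        rw [Submodule.projection_apply_of_mem_left hcompl hu, hc0, zero_smul] at this
        exact this
      · left
        refine eq_bot_iff.2 fun u hu => ?_
        have h1 := hc (σ u)
        rw [Submodule.projection_apply_of_mem_right hcompl
          (show σ u ∈ U' by change σ (σ u) ∈ U; rw [hss]; exact hu)] at h1
        have h2 : σ u = 0 := (smul_eq_zero.1 h1.symm).resolve_left hc0
        rw [← hss u, h2, map_zero]; exact zero_mem _
  · right; exact eq_top_iff.2 (hinf.ge.trans inf_le_left)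

theorem stable_adjoin (M : SuperRep k L) {U : Submodule k M.V} (hU : ∀ x, ∀ v ∈ U, M.ρ x v ∈ U)
    {a : Module.End k M.V}
    (ha : a ∈ Algebra.adjoin k (Set.range fun x => (M.ρ x : Module.End k M.V))) :
    ∀ v ∈ U, a v ∈ U := by
  induction ha using Algebra.adjoin_induction with
  | mem a h => obtain ⟨x, rfl⟩ := h; exact hU x
  | algebraMap c => intro v hv; exact U.smul_mem c hv
  | add a b _ _ ha hb => intro v hv; exact add_mem (ha v hv) (hb v hv)
  | mul a b _ _ ha hb => intro v hv; exact ha _ (hb v hv)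

/-- Burnside's theorem: the ungraded module is simple over the generated algebra and its commutant
is `k`, so Jacobson density applies to every linear operator. -/
theorem IsIrreducible.isDense [IsAlgClosed k] [CharZero k] {M : SuperRep k L}
    (hM : M.IsIrreducible) (hJ : M.HasNoOddSymmetry) : M.IsDense := by
  have := hM.1
  let 𝒜 := Algebra.adjoin k (Set.range fun x => (M.ρ x : Module.End k M.V))
  have hmem : ∀ x, (M.ρ x : Module.End k M.V) ∈ 𝒜 := fun x =>
    Algebra.subset_adjoin ⟨x, rfl⟩
  have hsimple : IsSimpleModule 𝒜 M.V := by
    refine (isSimpleModule_iff _ _).2 ⟨fun U => ?_⟩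
    rcases hM.stable_eq_bot_or_top hJ (U.restrictScalars k)
      (fun x v hv => U.smul_mem (⟨M.ρ x, hmem x⟩ : 𝒜) hv) with h | h
    · left; exact (Submodule.restrictScalars_eq_bot_iff k 𝒜 M.V).1 h
    · right; exact (Submodule.restrictScalars_eq_top_iff k 𝒜 M.V).1 h
  refine eq_top_iff.2 fun φ _ => ?_
  let b := Module.finBasis k M.V
  -- A `k`-linear map commutes with the commutant because the latter consists of scalars.
  -- Approximating it on a basis reproduces it exactly.
  let f : Module.End (Module.End 𝒜 M.V) M.V :=
    { toFun := φ
      map_add' := map_add φ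
      map_smul' := fun T v => by
        obtain ⟨c, hc⟩ := hM.commutant_eq_scalar hJ (T.restrictScalars k)
          fun x v => T.map_smul (⟨M.ρ x, hmem x⟩ : 𝒜) v
        have hc : ∀ v, T v = c • v := hc
        change φ (T v) = T (φ v)
        rw [hc, hc, map_smul] }
  classical
  obtain ⟨r, hr⟩ := jacobson_density f (Finset.univ.image b)
  have : φ = r.1 := b.ext fun i => hr (b i) (by simp)
  rw [this]
  exact r.2

theorem IsDense.isIrreducible {M : SuperRep k L} (hM : M.IsDense) [Nontrivial M.V] :
    M.IsIrreducible := by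
  refine ⟨inferInstance, fun U _ hU => ?_⟩
  by_contra! h
  obtain ⟨u, hu, hu0⟩ := U.ne_bot_iff.1 h.1
  obtain ⟨w, -, hw⟩ := SetLike.exists_of_lt h.2.lt_top
  obtain ⟨f, hf⟩ := Module.Projective.exists_dual_ne_zero k hu0
  -- An operator of rank one that takes `u ∈ U` to `w ∉ U`.
  have : (f.smulRight ((f u)⁻¹ • w)) u ∈ U :=
    M.stable_adjoin hU (by rw [hM]; trivial) u hu
  rw [LinearMap.smulRight_apply, smul_inv_smul₀ hf] at this
  exact hw this

theorem isDense_trivial : (trivial k L).IsDense := by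
  refine eq_top_iff.2 fun (φ : k →ₗ[k] k) _ => ?_
  have : φ = algebraMap k (Module.End k k) (φ 1) := LinearMap.ext_ring (mul_one (φ 1)).symm
  rw [this]
  exact Subalgebra.algebraMap_mem _ _

/-- The elements `x'` act as `ρ_M(x) ⊗ 1`, so the generated algebra contains `End M ⊗ 1`. This
includes the sign operators, with which the sign in the action of `x` can be undone to obtain `1 ⊗
ρ_N(x)`, hence `1 ⊗ End N`. -/
theorem IsDense.tensor {M N : SuperRep k L} (hM : M.IsDense) (hN : N.IsDense)
    (h : ∀ x, ∃ x', M.ρ x' = M.ρ x ∧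
      ∀ i, N.ρ ((LieSuperalgebra.grading (k := k)).proj i x') = 0) : (M.tensor N).IsDense := by
  let 𝒜 : Subalgebra k (Module.End k (M.V ⊗[k] N.V)) :=
    Algebra.adjoin k (Set.range fun x => (tensorρ M N x : Module.End k (M.V ⊗[k] N.V)))
  change 𝒜 = ⊤
  have hmem : ∀ x, tensorρ M N x ∈ 𝒜 := fun x => Algebra.subset_adjoin ⟨x, rfl⟩
  have h1 : ∀ a : Module.End k M.V, TensorProduct.map a LinearMap.id ∈ 𝒜 := fun a => by
    have ha : a ∈ Algebra.adjoin k (Set.range fun x => (M.ρ x : Module.End k M.V)) := by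
      rw [hM]; trivial
    induction ha using Algebra.adjoin_induction with
    | mem a ha =>
      obtain ⟨x, rfl⟩ := ha
      obtain ⟨x', hx', hx0⟩ := h x
      have := hmem x'
      rwa [tensorρ_of_right_eq_zero M N hx0, hx'] at this
    | algebraMap c =>
      have : TensorProduct.map (algebraMap k (Module.End k M.V) c) (LinearMap.id (M := N.V)) =
          algebraMap k (Module.End k (M.V ⊗[k] N.V)) c :=
        TensorProduct.ext' fun v w => by
          simp [Module.algebraMap_end_apply, TensorProduct.smul_tmul']
      rw [this]
      exact Subalgebra.algebraMap_mem _ _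
    | add a b _ _ ha hb => rw [TensorProduct.map_add_left]; exact add_mem ha hb
    | mul a b _ _ ha hb =>
      have : TensorProduct.map (a * b) (LinearMap.id (M := N.V)) =
          TensorProduct.map a LinearMap.id * TensorProduct.map b LinearMap.id :=
        TensorProduct.ext' fun v w => by simp
      rw [this]; exact mul_mem ha hb
  have h2 : ∀ i, ∀ x ∈ (LieSuperalgebra.grading (k := k) (L := L)).gr i,
      TensorProduct.map LinearMap.id (N.ρ x) ∈ 𝒜 := fun i x hx => by
    -- Subtracting `ρ_M(x) ⊗ 1` leaves `sgn i ⊗ ρ_N(x)`, and `sgn i` is its own inverse.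
    have key : TensorProduct.map LinearMap.id (N.ρ x) =
        TensorProduct.map (M.grading.sgn i) (LinearMap.id (M := N.V)) *
          (tensorρ M N x - TensorProduct.map (M.ρ x) LinearMap.id :
            Module.End k (M.V ⊗[k] N.V)) :=
      SuperGrading.tensor_hom_ext M.grading N.grading fun j l v hv w hw => by
        rw [Module.End.mul_apply, LinearMap.sub_apply, tensorρ_tmul M N hx hv]
        simp [M.grading.sgn_of_mem i hv, smul_smul, SuperGrading.superSign_mul_self,
          ← TensorProduct.smul_tmul']
    rw [key]
    exact mul_mem (h1 _) (sub_mem (hmem x) (h1 _))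
  have h3 : ∀ b : Module.End k N.V, TensorProduct.map LinearMap.id b ∈ 𝒜 := fun b => by
    have hb : b ∈ Algebra.adjoin k (Set.range fun x => (N.ρ x : Module.End k N.V)) := by
      rw [hN]; trivial
    induction hb using Algebra.adjoin_induction with
    | mem b hb =>
      obtain ⟨x, rfl⟩ := hb
      change TensorProduct.map LinearMap.id (N.ρ x) ∈ 𝒜
      rw [← (LieSuperalgebra.grading (k := k) (L := L)).proj_add_proj x, map_add,
        TensorProduct.map_add_right]
      exact add_mem (h2 0 _ (SuperGrading.proj_mem _ 0 x)) (h2 1 _ (SuperGrading.proj_mem _ 1 x))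
    | algebraMap c =>
      have : TensorProduct.map (LinearMap.id (M := M.V)) (algebraMap k (Module.End k N.V) c) =
          algebraMap k (Module.End k (M.V ⊗[k] N.V)) c :=
        TensorProduct.ext' fun v w => by
          simp [Module.algebraMap_end_apply]
      rw [this]
      exact Subalgebra.algebraMap_mem _ _
    | add a b _ _ ha hb => rw [TensorProduct.map_add_right]; exact add_mem ha hb
    | mul a b _ _ ha hb =>
      have : TensorProduct.map (LinearMap.id (M := M.V)) (a * b) =
          TensorProduct.map LinearMap.id a * TensorProduct.map LinearMap.id b :=
        TensorProduct.ext' fun v w => by simp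
      rw [this]; exact mul_mem ha hb
  refine eq_top_iff.2 fun φ _ => ?_
  obtain ⟨t, rfl⟩ := (homTensorHomEquiv k M.V N.V M.V N.V).surjective φ
  induction t with
  | zero => rw [map_zero]; exact zero_mem _
  | add a b ha hb => rw [map_add]; exact add_mem (ha Algebra.mem_top) (hb Algebra.mem_top)
  | tmul a b =>
    have : homTensorHomEquiv k M.V N.V M.V N.V (a ⊗ₜ b) =
        TensorProduct.map a (LinearMap.id (M := N.V)) *
          TensorProduct.map (LinearMap.id (M := M.V)) b :=
      TensorProduct.ext' fun v w => by simp
    rw [this]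
    exact mul_mem (h1 a) (h3 b)

end SuperRep

/-! ### Density of evaluation representations -/

section Evaluation

open LieSuperalgebra

variable {Γ : Type*} [Group Γ] [Finite Γ] {k : Type u} [Field k]
  {g : Type*} [AddCommGroup g] [Module k g] [LieSuperalgebra k g] [LieSuperalgebra.Action Γ k g]
  {A : Type*} [CommRing A] [Algebra k A] [MulSemiringAction Γ A] [SMulCommClass Γ k A]

theorem SuperRep.tensor_nontrivial {L : Type*} [AddCommGroup L] [Module k L] [LieSuperalgebra k L]
    (M N : SuperRep k L) : Nontrivial (M.tensor N).V ↔ Nontrivial M.V ∧ Nontrivial N.V := by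
  have h : Module.finrank k (M.tensor N).V = Module.finrank k M.V * Module.finrank k N.V :=
    Module.finrank_tensorProduct (R := k) (S := k)
  rw [← Module.finrank_pos_iff (R := k), ← Module.finrank_pos_iff (R := k),
    ← Module.finrank_pos_iff (R := k), h, Nat.pos_iff_ne_zero, mul_ne_zero_iff]
  simp [Nat.pos_iff_ne_zero]

/-- Evaluation at the first point stays surjective on the elements that vanish at the other points.
This gives density of the first pullback as well as the hypothesis of `IsDense.tensor`. -/
theorem evalRep_isDense (hfree : ∀ (γ : Γ) (m : RatPoint k A), γ • m = m → γ = 1)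
    {l : List (RatPoint k A × SuperRep k g)}
    (hl : l.Pairwise (fun p q => ∀ γ : Γ, γ • p.1 ≠ q.1)) (h : ∀ p ∈ l, p.2.IsDense) :
    (evalRep Γ l).IsDense := by
  induction l with
  | nil => exact SuperRep.isDense_trivial
  | cons p l ih =>
    rw [List.pairwise_cons] at hl
    have hev : ∀ y : g, ∃ x' : EquivariantMaps Γ k g A, (evalHom Γ p.1).toLinearMap x' = y ∧
        ∀ n ∈ l.map Prod.fst, (evalHom Γ n).toLinearMap x' = 0 := fun y => by
      obtain ⟨x', -, h1, h2⟩ := exists_evalHom_eq hfree p.1 (l.map Prod.fst) (fun n hn => by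
        obtain ⟨q, hq, rfl⟩ := List.mem_map.1 hn
        exact hl.1 q hq) y
      exact ⟨x', h1, h2⟩
    refine SuperRep.IsDense.tensor (M := p.2.pullback (evalHom Γ p.1)) ?_
      (ih hl.2 fun q hq => h q (by simp [hq])) fun x => ?_
    · have hp := h p (by simp)
      unfold SuperRep.IsDense at hp ⊢
      refine Eq.trans ?_ hp
      congr 1
      ext a
      constructor
      · rintro ⟨x, rfl⟩; exact ⟨_, rfl⟩
      · rintro ⟨y, rfl⟩
        obtain ⟨x', hx', -⟩ := hev y
        exact ⟨x', congrArg p.2.ρ hx'⟩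
    · obtain ⟨x', hx', hx0⟩ := hev ((evalHom Γ p.1).toLinearMap x)
      refine ⟨x', congrArg p.2.ρ hx', fun i => evalRep_ρ_eq_zero l fun q hq => ?_⟩
      rw [Hom.map_proj, hx0 _ (List.mem_map_of_mem hq), map_zero]

omit [Finite Γ] in
theorem evalRep_nontrivial {l : List (RatPoint k A × SuperRep k g)}
    (h : ∀ p ∈ l, Nontrivial p.2.V) : Nontrivial (evalRep Γ l).V := by
  induction l with
  | nil => exact inferInstanceAs (Nontrivial k)
  | cons p l ih =>
    exact (SuperRep.tensor_nontrivial (p.2.pullback (evalHom Γ p.1)) (evalRep Γ l)).2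
      ⟨h p (by simp), ih fun q hq => h q (by simp [hq])⟩

end Evaluation

/-! ### Highest weights for an even element with abelian centralizer -/

-- The order lets eigenvalues in `k` be compared so that adding a weight raises or lowers them
-- consistently. It is the lexicographic order of the coordinates over `ℚ`.
open Classical in
theorem exists_injective_ordered (k : Type u) [Field k] [CharZero k] :
    ∃ (Λ : Type u) (_ : AddCommGroup Λ) (_ : LinearOrder Λ) (_ : IsOrderedAddMonoid Λ)
      (f : k →+ Λ), Function.Injective f := by
  let b := Module.Basis.ofVectorSpace ℚ k
  let _ : LinearOrder (Module.Basis.ofVectorSpaceIndex ℚ k) := linearOrderOfSTO WellOrderingRel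
  refine ⟨Lex (Module.Basis.ofVectorSpaceIndex ℚ k →₀ ℚ), inferInstance, inferInstance,
    inferInstance,
    { toFun := fun x => toLex (b.repr x)
      map_zero' := by simp
      map_add' := fun x y => by simp }, fun x y h => ?_⟩
  exact b.repr.injective (toLex.injective h)

namespace LieSuperalgebra

variable {k : Type*} {L : Type*} [Field k] [AddCommGroup L] [Module k L] [LieSuperalgebra k L]

theorem proj_bracket_even {h : L} (hh : h ∈ (grading (k := k)).gr 0) (i : ZMod 2) (x : L) :
    (grading (k := k)).proj i (bracket (k := k) h x) =
      bracket (k := k) h ((grading (k := k)).proj i x) := by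
  have := (grading (k := k) (L := L)).hom_ext
    (f := (grading (k := k)).proj i ∘ₗ bracket (k := k) h)
    (f' := bracket (k := k) h ∘ₗ (grading (k := k)).proj i) fun j y hy => by
      have hy' : bracket (k := k) h y ∈ (grading (k := k)).gr j := by
        simpa using bracket_mem (k := k) hh hy
      by_cases hij : i = j
      · subst hij
        simp [SuperGrading.proj_of_mem _ hy, SuperGrading.proj_of_mem _ hy']
      · simp [SuperGrading.proj_of_mem_ne _ hij hy, SuperGrading.proj_of_mem_ne _ hij hy']
  exact LinearMap.congr_fun this x

theorem bracket_bracket_of_weight {h : L} (hh : h ∈ (grading (k := k)).gr 0) {i j : ZMod 2}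
    {x y : L} (hx : x ∈ (grading (k := k)).gr i) (hy : y ∈ (grading (k := k)).gr j) {α β : k}
    (hα : bracket (k := k) h x = α • x) (hβ : bracket (k := k) h y = β • y) :
    bracket (k := k) h (bracket (k := k) x y) = (α + β) • bracket (k := k) x y := by
  rw [jacobi hh hx hy, hα, hβ, superSign_zero_left]
  simp [add_smul]

end LieSuperalgebra

namespace SuperRep

variable {k : Type u} {L : Type v} [Field k] [AddCommGroup L] [Module k L] [LieSuperalgebra k L]

open LieSuperalgebra

theorem proj_ρ (M : SuperRep k L) {j : ZMod 2} {x : L}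
    (hx : x ∈ (LieSuperalgebra.grading (k := k)).gr j)
    (i : ZMod 2) (v : M.V) :
    M.grading.proj i (M.ρ x v) = M.ρ x (M.grading.proj (i + j) v) := by
  have hjj : ∀ i j : ZMod 2, i + j + j = i := by decide
  have := M.grading.hom_ext (f := M.grading.proj i ∘ₗ M.ρ x)
    (f' := M.ρ x ∘ₗ M.grading.proj (i + j)) fun l w hw => by
      have hm := M.ρ_mem hx hw
      by_cases hij : i + j = l
      · subst hij
        have e : j + (i + j) = i := by rw [add_comm, hjj]
        rw [e] at hm
        simp [SuperGrading.proj_of_mem _ hw, SuperGrading.proj_of_mem _ hm]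
      · have hne : i ≠ j + l := fun h => hij (by rw [h, add_comm j l, hjj])
        simp [SuperGrading.proj_of_mem_ne _ hij hw, SuperGrading.proj_of_mem_ne _ hne hm]
  exact LinearMap.congr_fun this v

theorem ρ_weight (M : SuperRep k L) {h : L}
    (hh : h ∈ (LieSuperalgebra.grading (k := k)).gr 0) {i : ZMod 2} {x : L}
    (hx : x ∈ (LieSuperalgebra.grading (k := k)).gr i) {α μ : k} (hα : bracket (k := k) h x = α • x)
    {v : M.V} (hv : M.ρ h v = μ • v) : M.ρ h (M.ρ x v) = (μ + α) • M.ρ x v := by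
  have := M.ρ_bracket hh hx v
  rw [hα, superSign_zero_left, one_smul, hv, map_smul, map_smul, LinearMap.smul_apply] at this
  rw [add_smul, this]
  abel

/-- A minimal graded subspace of an eigenspace of `h` that is stable under the centralizer of `h`
is acted on by scalars, if this centralizer is abelian. -/
theorem exists_scalar_subspace [IsAlgClosed k] [CharZero k] (M : SuperRep k L) {h : L}
    (hh : h ∈ (LieSuperalgebra.grading (k := k)).gr 0)
    (hab : ∀ x y : L, bracket (k := k) h x = 0 → bracket (k := k) h y = 0 →
      bracket (k := k) x y = 0) {c : k} (hc : Module.End.HasEigenvalue (M.ρ h) c) :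
    ∃ i, ∃ v ∈ M.grading.gr i, v ≠ 0 ∧ M.ρ h v = c • v ∧
      ∀ x, bracket (k := k) h x = 0 → ∃ a : k, M.ρ x v = a • v := by
  let P : Submodule k M.V → Prop := fun U => U ≠ ⊥ ∧ U ≤ Module.End.eigenspace (M.ρ h) c ∧
    M.grading.IsGraded U ∧ ∀ x, bracket (k := k) h x = 0 → ∀ v ∈ U, M.ρ x v ∈ U
  have hcomm : ∀ {i j : ZMod 2} {x y : L}, x ∈ (LieSuperalgebra.grading (k := k)).gr i →
      y ∈ (LieSuperalgebra.grading (k := k)).gr j → bracket (k := k) h x = 0 →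
      bracket (k := k) h y = 0 → ∀ v,
      M.ρ x (M.ρ y v) = superSign k i j • M.ρ y (M.ρ x v) := fun {i j x y} hx hy h1 h2 v => by
    have := M.ρ_bracket hx hy v
    rw [hab x y h1 h2, map_zero, LinearMap.zero_apply] at this
    exact sub_eq_zero.1 this.symm
  have hproj : ∀ x, bracket (k := k) h x = 0 → ∀ i,
      bracket (k := k) h ((LieSuperalgebra.grading (k := k)).proj i x) = 0 := fun x hx i => by
    rw [← proj_bracket_even hh, hx, map_zero]
  have hstab : ∀ U : Submodule k M.V, (∀ i, ∀ x ∈ (LieSuperalgebra.grading (k := k) (L := L)).gr i,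
      bracket (k := k) h x = 0 → ∀ v ∈ U, M.ρ x v ∈ U) →
      ∀ x, bracket (k := k) h x = 0 → ∀ v ∈ U, M.ρ x v ∈ U := fun U hU x hx v hv => by
    rw [← (LieSuperalgebra.grading (k := k) (L := L)).proj_add_proj x, map_add]
    exact add_mem (hU _ _ (SuperGrading.proj_mem _ 0 x) (hproj x hx 0) v hv)
      (hU _ _ (SuperGrading.proj_mem _ 1 x) (hproj x hx 1) v hv)
  have hE : P (Module.End.eigenspace (M.ρ h) c) := by
    refine ⟨hc, le_rfl, fun u hu i => ?_, hstab _ fun i x hx hx0 v hv => ?_⟩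
    · rw [Module.End.mem_eigenspace_iff] at hu ⊢
      have := M.proj_ρ hh i u
      rw [add_zero] at this
      rw [← this, hu, map_smul]
    · rw [Module.End.mem_eigenspace_iff] at hv ⊢
      have := M.ρ_weight hh hx (α := 0) (by rw [hx0, zero_smul]) hv
      rwa [add_zero] at this
  -- By minimality, a graded subspace of `U` that is nonzero and stable under the centralizer is all
  -- of `U`.
  obtain ⟨U, hU, hmin⟩ := WellFounded.has_min (r := (· < · : Submodule k M.V → _ → Prop))
    wellFounded_lt {U | P U} ⟨_, hE⟩
  have hmin' : ∀ K : Submodule k M.V, U ⊓ K ≠ ⊥ → M.grading.IsGraded (U ⊓ K) →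
      (∀ i, ∀ x ∈ (LieSuperalgebra.grading (k := k) (L := L)).gr i, bracket (k := k) h x = 0 →
        ∀ v ∈ U ⊓ K, M.ρ x v ∈ K) → U ≤ K := fun K h1 h2 h3 => by
    by_contra hle
    refine hmin (U ⊓ K) ⟨h1, inf_le_left.trans hU.2.1, h2,
      hstab _ fun i x hx hx0 v hv => ⟨hU.2.2.2 x hx0 v hv.1, h3 i x hx hx0 v hv⟩⟩
      (lt_of_le_of_ne inf_le_left fun he => hle (inf_eq_left.1 he))
  -- An eigenspace of `x` in `U` is graded because `x` is even, and stable because the centralizer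
  -- is abelian.
  have heven : ∀ x ∈ (LieSuperalgebra.grading (k := k) (L := L)).gr 0, bracket (k := k) h x = 0 →
      ∃ a : k, ∀ v ∈ U, M.ρ x v = a • v := fun x hx hx0 => by
    have : Nontrivial U := Submodule.nontrivial_iff_ne_bot.2 hU.1
    obtain ⟨a, ha⟩ := Module.End.exists_eigenvalue (K := k) (V := U)
      ((M.ρ x).restrict (hU.2.2.2 x hx0))
    obtain ⟨w, hw, hw0⟩ := ha.exists_hasEigenvector
    rw [Module.End.mem_eigenspace_iff] at hw
    refine ⟨a, fun v hv => Module.End.mem_eigenspace_iff.1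
      (hmin' (Module.End.eigenspace (M.ρ x) a) ?_ ?_ ?_ hv)⟩
    · exact Submodule.ne_bot_iff _ |>.2 ⟨w, ⟨w.2, Module.End.mem_eigenspace_iff.2
        (congrArg Subtype.val hw)⟩, fun h0 => hw0 (Subtype.ext h0)⟩
    · rintro u ⟨hu1, hu2⟩ i
      refine ⟨hU.2.2.1 u hu1 i, ?_⟩
      change u ∈ Module.End.eigenspace (M.ρ x) a at hu2
      change _ ∈ Module.End.eigenspace (M.ρ x) a
      rw [Module.End.mem_eigenspace_iff] at hu2 ⊢
      have := M.proj_ρ hx i u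
      rw [add_zero] at this
      rw [← this, hu2, map_smul]
    · rintro i y hy hy0 u ⟨hu1, hu2⟩
      change u ∈ Module.End.eigenspace (M.ρ x) a at hu2
      rw [Module.End.mem_eigenspace_iff] at hu2 ⊢
      rw [hcomm hx hy hx0 hy0, superSign_zero_left, one_smul, hu2, map_smul]
  -- From `[x, x] = 0` the odd `x` acts with square zero, so its kernel meets `U` nontrivially.
  have hodd : ∀ x ∈ (LieSuperalgebra.grading (k := k) (L := L)).gr 1, bracket (k := k) h x = 0 →
      ∀ v ∈ U, M.ρ x v = 0 := fun x hx hx0 v hv => by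
    have hsq : ∀ u, M.ρ x (M.ρ x u) = 0 := fun u => by
      have := hcomm hx hx hx0 hx0 u
      rw [superSign_one_one, neg_one_smul, eq_neg_iff_add_eq_zero, ← two_smul k] at this
      exact (smul_eq_zero.1 this).resolve_left two_ne_zero
    refine LinearMap.mem_ker.1 (hmin' (LinearMap.ker (M.ρ x)) (fun hbot => ?_) ?_ ?_ hv)
    · obtain ⟨u, hu, hu0⟩ := U.ne_bot_iff.1 hU.1
      have h1 : M.ρ x u ∈ (⊥ : Submodule k M.V) :=
        hbot ▸ ⟨hU.2.2.2 x hx0 u hu, LinearMap.mem_ker.2 (hsq u)⟩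
      have h2 : u ∈ (⊥ : Submodule k M.V) :=
        hbot ▸ ⟨hu, LinearMap.mem_ker.2 ((Submodule.mem_bot k).1 h1)⟩
      exact hu0 ((Submodule.mem_bot k).1 h2)
    · rintro u ⟨hu1, hu2⟩ i
      refine ⟨hU.2.2.1 u hu1 i, ?_⟩
      have hu2 : M.ρ x u = 0 := hu2
      change M.ρ x _ = 0
      have := M.proj_ρ hx (i + 1) u
      rw [add_assoc, show (1 + 1 : ZMod 2) = 0 by decide, add_zero] at this
      rw [← this, hu2, map_zero]
    · rintro i y hy hy0 u ⟨hu1, hu2⟩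
      have hu2 : M.ρ x u = 0 := hu2
      rw [LinearMap.mem_ker, hcomm hx hy hx0 hy0, hu2, map_zero, smul_zero]
  obtain ⟨i, v, hv, hvU, hv0⟩ := M.grading.exists_homogeneous_ne_zero hU.2.2.1 hU.1
  refine ⟨i, v, hv, hv0, Module.End.mem_eigenspace_iff.1 (hU.2.1 hvU), fun x hx => ?_⟩
  obtain ⟨a, ha⟩ := heven _ (SuperGrading.proj_mem _ 0 x) (hproj x hx 0)
  refine ⟨a, ?_⟩
  conv_lhs => rw [← (LieSuperalgebra.grading (k := k) (L := L)).proj_add_proj x]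
  rw [map_add, LinearMap.add_apply, ha v hvU,
    hodd _ (SuperGrading.proj_mem _ 1 x) (hproj x hx 1) v hvU, add_zero]

/-- If an even element acts diagonalizably on `L` and has an abelian centralizer, then the highest
weight vectors of an irreducible representation form a line, which rules out odd symmetries. -/
theorem IsIrreducible.hasNoOddSymmetry_of_abelian_centralizer [IsAlgClosed k] [CharZero k]
    {M : SuperRep k L} (hM : M.IsIrreducible) {h : L}
    (hh : h ∈ (LieSuperalgebra.grading (k := k)).gr 0)
    (hdiag : ⨆ μ, Module.End.eigenspace (bracket (k := k) h) μ = ⊤)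
    (hab : ∀ x y : L, bracket (k := k) h x = 0 → bracket (k := k) h y = 0 →
      bracket (k := k) x y = 0) : M.HasNoOddSymmetry := by
  intro J hJodd hJ hJbij
  have := hM.1
  obtain ⟨Λ, _, _, _, f, hf⟩ := exists_injective_ordered k
  -- The highest weight `c`, and below a homogeneous highest weight vector `v` on which the
  -- centralizer of `h` acts by scalars.
  obtain ⟨c, hc, hmax⟩ := Set.exists_max_image {μ | Module.End.HasEigenvalue (M.ρ h) μ} f
    (Module.End.finite_hasEigenvalue _) (Module.End.exists_eigenvalue (M.ρ h))
  obtain ⟨i, v, hv, hv0, hvc, hvs⟩ := M.exists_scalar_subspace hh hab hc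
  -- The least member `S` is generated from `v` by elements of negative weight. Proving it stable
  -- under everything takes the place of a triangular decomposition of the enveloping algebra. Each
  -- property of `S` is shown by exhibiting a member of `𝒮` that has it.
  let 𝒮 : Set (Submodule k M.V) := {S | v ∈ S ∧
    ∀ j, ∀ y ∈ (LieSuperalgebra.grading (k := k) (L := L)).gr j, ∀ β,
    bracket (k := k) h y = β • y → f β < 0 → ∀ s ∈ S, M.ρ y s ∈ S}
  let S := sInf 𝒮
  have hS : S ∈ 𝒮 := by
    refine ⟨Submodule.mem_sInf.2 fun U hU => hU.1, fun j y hy β hβ hneg s hs =>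
      Submodule.mem_sInf.2 fun U hU => hU.2 j y hy β hβ hneg s (Submodule.mem_sInf.1 hs U hU)⟩
  have hSle : ∀ U ∈ 𝒮, S ≤ U := fun U hU => sInf_le hU
  have hgraded : M.grading.IsGraded S := by
    let P : Submodule k M.V := S ⊓ ⨅ i, S.comap (M.grading.proj i)
    have hP : P ∈ 𝒮 := by
      refine ⟨⟨hS.1, Submodule.mem_iInf _ |>.2 fun l => ?_⟩, fun j y hy β hβ hneg s hs =>
        ⟨hS.2 j y hy β hβ hneg s hs.1, Submodule.mem_iInf _ |>.2 fun l => ?_⟩⟩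
      · change M.grading.proj l v ∈ S
        by_cases hl : l = i
        · rw [hl, M.grading.proj_of_mem hv]; exact hS.1
        · rw [M.grading.proj_of_mem_ne hl hv]; exact zero_mem _
      · change M.grading.proj l (M.ρ y s) ∈ S
        rw [M.proj_ρ hy]
        exact hS.2 j y hy β hβ hneg _ (Submodule.mem_iInf _ |>.1 hs.2 (l + j))
    exact fun u hu l => Submodule.mem_iInf _ |>.1 (hSle P hP hu).2 l
  have hnonneg : ∀ s ∈ S, ∀ l, ∀ x ∈ (LieSuperalgebra.grading (k := k) (L := L)).gr l, ∀ α,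
      bracket (k := k) h x = α • x → 0 ≤ f α → M.ρ x s ∈ S := by
    -- If `x` has weight `α ≥ 0` and `y` has weight `β < 0`, then `x y s` is `[x, y] s` plus a
    -- multiple of `y x s`, and `[x, y]` falls under the lowering or the raising case according to
    -- the sign of `α + β`.
    let P : Submodule k M.V := S ⊓ ⨅ (l) (x : L)
      (_ : x ∈ (LieSuperalgebra.grading (k := k) (L := L)).gr l) (α)
      (_ : bracket (k := k) h x = α • x) (_ : 0 ≤ f α), S.comap (M.ρ x)
    have hPmem : ∀ s, s ∈ P ↔ s ∈ S ∧
        ∀ l, ∀ x ∈ (LieSuperalgebra.grading (k := k) (L := L)).gr l, ∀ α,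
        bracket (k := k) h x = α • x → 0 ≤ f α → M.ρ x s ∈ S := fun s => by
      simp only [P, Submodule.mem_inf, Submodule.mem_iInf, Submodule.mem_comap]
    have hP : P ∈ 𝒮 := by
      refine ⟨(hPmem v).2 ⟨hS.1, fun l x hx α hα hpos => ?_⟩, fun j y hy β hβ hneg s hs => ?_⟩
      · by_cases hα0 : α = 0
        · obtain ⟨a, ha⟩ := hvs x (by rw [hα, hα0, zero_smul])
          rw [ha]; exact S.smul_mem _ hS.1
        · have hpos' : 0 < f α := lt_of_le_of_ne hpos fun h0 => hα0 (hf (by rw [← h0, map_zero]))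
          have hz : M.ρ x v = 0 := by
            by_contra hne
            have := hmax (c + α) (Module.End.hasEigenvalue_of_hasEigenvector
              ⟨Module.End.mem_eigenspace_iff.2 (M.ρ_weight hh hx hα hvc), hne⟩)
            rw [map_add] at this
            exact absurd hpos' (not_lt.2 (by simpa using this))
          rw [hz]; exact zero_mem _
      · rw [hPmem] at hs
        refine (hPmem _).2 ⟨hS.2 j y hy β hβ hneg s hs.1, fun l x hx α hα hpos => ?_⟩
        have hb := M.ρ_bracket hx hy s
        rw [eq_sub_iff_add_eq] at hb
        rw [← hb]
        refine add_mem ?_ (S.smul_mem _ (hS.2 j y hy β hβ hneg _ (hs.2 l x hx α hα hpos)))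
        have hw := bracket_bracket_of_weight hh hx hy hα hβ
        rcases lt_or_ge (f (α + β)) 0 with hlt | hge
        · exact hS.2 _ _ (bracket_mem hx hy) _ hw hlt s hs.1
        · exact hs.2 _ _ (bracket_mem hx hy) _ hw hge
    exact fun s hs => ((hPmem s).1 (hSle P hP hs)).2
  have hstab : ∀ x, ∀ s ∈ S, M.ρ x s ∈ S := by
    intro x s hs
    have hx : x ∈ ⨆ μ, Module.End.eigenspace (bracket (k := k) h) μ := by rw [hdiag]; trivial
    induction hx using Submodule.iSup_induction' with
    | zero => rw [map_zero]; exact zero_mem _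
    | add x y _ _ hx hy => rw [map_add]; exact add_mem hx hy
    | mem α x hx =>
      rw [Module.End.mem_eigenspace_iff] at hx
      have key : ∀ l, M.ρ ((LieSuperalgebra.grading (k := k)).proj l x) s ∈ S := fun l => by
        have hw : bracket (k := k) h ((LieSuperalgebra.grading (k := k)).proj l x) =
            α • (LieSuperalgebra.grading (k := k)).proj l x := by
          rw [← proj_bracket_even hh, hx, map_smul]
        rcases lt_or_ge (f α) 0 with hlt | hge
        · exact hS.2 _ _ (SuperGrading.proj_mem _ l x) _ hw hlt s hs
        · exact hnonneg s hs _ _ (SuperGrading.proj_mem _ l x) _ hw hge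
      rw [← (LieSuperalgebra.grading (k := k) (L := L)).proj_add_proj x, map_add]
      exact add_mem (key 0) (key 1)
  have hStop : S = ⊤ := (hM.2 S hgraded hstab).resolve_left fun h0 =>
    hv0 ((Submodule.mem_bot k).1 (h0 ▸ hS.1))
  let F : Submodule k M.V := ⨆ (μ) (_ : μ ≠ c), Module.End.eigenspace (M.ρ h) μ
  let F' : Submodule k M.V := ⨆ (μ) (_ : f μ < f c), Module.End.eigenspace (M.ρ h) μ
  have hF : F' ≤ F := iSup_le fun μ => iSup_le fun hμ =>
    le_iSup₂_of_le μ (fun h0 => absurd hμ (by rw [h0]; exact lt_irrefl _)) le_rfl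
  -- Lowering operators send `v` and everything of weight below `c` to weights below `c`. Hence the
  -- whole space is the line of `v` plus lower weights.
  have hlow : (k ∙ v) ⊔ F' ∈ 𝒮 := by
    refine ⟨Submodule.mem_sup_left (Submodule.mem_span_singleton_self v),
      fun j y hy β hβ hneg s hs => ?_⟩
    obtain ⟨a, ha, b, hb, rfl⟩ := Submodule.mem_sup.1 hs
    rw [map_add]
    refine Submodule.mem_sup_right (add_mem ?_ ?_)
    · obtain ⟨a, rfl⟩ := Submodule.mem_span_singleton.1 ha
      rw [map_smul]
      refine F'.smul_mem _ (Submodule.mem_iSup_of_mem (c + β) (Submodule.mem_iSup_of_mem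
        (by rw [map_add]; simpa using hneg)
        (Module.End.mem_eigenspace_iff.2 (M.ρ_weight hh hy hβ hvc))))
    · have hle : F' ≤ F'.comap (M.ρ y) := by
        refine iSup_le fun μ => iSup_le fun hμ w hw => ?_
        rw [Module.End.mem_eigenspace_iff] at hw
        refine Submodule.mem_iSup_of_mem (μ + β) (Submodule.mem_iSup_of_mem
          (by rw [map_add]; exact (add_lt_of_neg_right _ hneg).trans hμ)
          (Module.End.mem_eigenspace_iff.2 (M.ρ_weight hh hy hβ hw)))
      exact hle hb
  have hJv : J v ∈ (k ∙ v) ⊔ F' := hSle _ hlow (hStop ▸ Submodule.mem_top)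
  obtain ⟨a, ha, b, hb, hab'⟩ := Submodule.mem_sup.1 hJv
  obtain ⟨a, rfl⟩ := Submodule.mem_span_singleton.1 ha
  -- `J` commutes with `h`, so `J v` has weight `c` and the lower component `b` vanishes. Then `J v`
  -- is a multiple of `v` of the opposite parity, hence zero.
  have hbE : b ∈ Module.End.eigenspace (M.ρ h) c := by
    rw [Module.End.mem_eigenspace_iff, eq_sub_of_add_eq' hab', map_sub, ← hJ, hvc, map_smul,
      map_smul, hvc, smul_sub, smul_comm]
  have hb0 : b = 0 := Submodule.disjoint_def.1
    (Module.End.eigenspaces_iSupIndep (M.ρ h) c) b hbE (hF hb)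
  rw [hb0, add_zero] at hab'
  have h1 := hJodd i v hv
  have h2 : J v ∈ M.grading.gr i := by rw [← hab']; exact Submodule.smul_mem _ _ hv
  have hne : i + 1 ≠ i := (by decide : ∀ i : ZMod 2, i + 1 ≠ i) i
  have h3 := M.grading.eq_zero_of_mem_of_mem hne h1 h2
  exact hv0 (hJbij.1 (by rw [h3, map_zero]))

/-- Without odd part, the even and odd parts of a representation are subrepresentations. -/
theorem IsIrreducible.hasNoOddSymmetry_of_odd_eq_bot {M : SuperRep k L} (hM : M.IsIrreducible)
    (h1 : (LieSuperalgebra.grading (k := k) (L := L)).gr 1 = ⊥) : M.HasNoOddSymmetry := by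
  intro J hJodd _ hJbij
  have hx : ∀ x : L, x ∈ (LieSuperalgebra.grading (k := k) (L := L)).gr 0 := fun x => by
    have := (LieSuperalgebra.grading (k := k) (L := L)).isCompl.sup_eq_top
    rw [h1, sup_bot_eq] at this
    rw [this]; trivial
  have key : ∀ i, M.grading.gr i = ⊥ ∨ M.grading.gr i = ⊤ := fun i =>
    hM.2 _ (fun u hu l => M.grading.proj_mem_of_mem hu) fun x v hv => by
      simpa using M.ρ_mem (hx x) hv
  obtain ⟨i, hi⟩ : ∃ i, M.grading.gr i = ⊤ := by
    by_contra! hne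
    have := M.grading.isCompl.sup_eq_top
    rw [(key 0).resolve_right (hne 0), (key 1).resolve_right (hne 1), sup_bot_eq] at this
    have := hM.1
    exact bot_ne_top ‹_›
  obtain ⟨v, hv⟩ := @exists_ne _ hM.1 (0 : M.V)
  have hne : i + 1 ≠ i := (by decide : ∀ i : ZMod 2, i + 1 ≠ i) i
  refine hv (hJbij.1 ?_)
  rw [map_zero]
  exact M.grading.eq_zero_of_mem_of_mem hne (hJodd i v (hi ▸ Submodule.mem_top))
    (hi ▸ Submodule.mem_top)

end SuperRep

/-! ### Trace forms and Cartan subalgebras in a completely reducible representation -/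

namespace LieModule

variable {k L W : Type*} [Field k] [CharZero k] [IsAlgClosed k] [LieRing L] [LieAlgebra k L]
  [AddCommGroup W] [Module k W] [LieRingModule L W] [LieModule k L W]
  [FiniteDimensional k L] [FiniteDimensional k W]

attribute [local instance 100] LieRing.ofAssociativeRing

-- Engel's theorem: if `x` acts nilpotently on `W`, so does `ad x` on `End W`, and by faithfulness
-- on `L`.
omit [CharZero k] [IsAlgClosed k] [FiniteDimensional k W] in
theorem isNilpotent_lieRing_of_faithful (hf : ∀ x : L, (∀ w : W, ⁅x, w⁆ = 0) → x = 0)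
    (h : ∀ x : L, _root_.IsNilpotent (toEnd k L W x)) : LieRing.IsNilpotent L := by
  rw [LieAlgebra.isNilpotent_iff_forall (R := k)]
  intro x
  obtain ⟨n, hn⟩ := LieAlgebra.ad_nilpotent_of_nilpotent (R := k) (h x)
  refine ⟨n, LinearMap.ext fun y => ?_⟩
  have key : ∀ m, toEnd k L W (((LieAlgebra.ad k L x) ^ m) y) =
      ((LieAlgebra.ad k (Module.End k W) (toEnd k L W x)) ^ m) (toEnd k L W y) := by
    intro m
    induction m with
    | zero => rfl
    | succ m ih =>
      rw [pow_succ', pow_succ', Module.End.mul_apply, Module.End.mul_apply, ← ih,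
        LieAlgebra.ad_apply, LieAlgebra.ad_apply, LieHom.map_lie]
  refine hf _ fun w => ?_
  have := key n
  rw [hn, LinearMap.zero_apply] at this
  exact LinearMap.congr_fun this w

/-- The radical of the trace form, as an ideal. -/
noncomputable def traceRadical (k L W : Type*) [Field k] [LieRing L] [LieAlgebra k L]
    [AddCommGroup W] [Module k W] [LieRingModule L W] [LieModule k L W] : LieIdeal k L where
  __ := LinearMap.ker (traceForm k L W)
  lie_mem := by
    intro x y hy
    have hy : traceForm k L W y = 0 := hy
    change traceForm k L W ⁅x, y⁆ = 0
    ext z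
    rw [traceForm_apply_lie_apply', hy]
    simp

-- Cartan's criterion: the trace form vanishes on the radical, so its derived ideal acts nilpotently
-- and is nilpotent.
omit [IsAlgClosed k] in
theorem isSolvable_traceRadical (hf : ∀ x : L, (∀ w : W, ⁅x, w⁆ = 0) → x = 0) :
    LieAlgebra.IsSolvable (traceRadical k L W) := by
  have h0 : traceForm k (traceRadical k L W) W = 0 := by
    ext ⟨x, hx⟩ ⟨y, hy⟩
    exact LinearMap.congr_fun (show traceForm k L W x = 0 from hx) y
  have hnil := isNilpotent_derivedSeries_of_traceForm_eq_zero h0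
  set D := LieAlgebra.derivedSeries k (traceRadical k L W) 1 with hD
  have hDn : LieRing.IsNilpotent D := by
    refine isNilpotent_lieRing_of_faithful (k := k) (L := D) (W := W)
      (fun x hx => Subtype.ext (Subtype.ext (hf _ hx))) ?_
    exact (LieModule.isNilpotent_iff_forall' (R := k)).mp hnil
  obtain ⟨n, hn⟩ := LieAlgebra.IsSolvable.solvable k D
  rw [LieIdeal.derivedSeries_eq_bot_iff] at hn
  refine LieAlgebra.IsSolvable.mk (R := k) (k := n + 1) ?_
  rw [LieAlgebra.derivedSeries_def, LieAlgebra.derivedSeriesOfIdeal_add]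
  exact hn

/-- The weight spaces of a solvable ideal are stable under `L`, so their sum has a stable
complement. By Lie's theorem a nonzero complement would contain another weight vector. -/
theorem iSup_weightSpace_traceRadical (hf : ∀ x : L, (∀ w : W, ⁅x, w⁆ = 0) → x = 0)
    (hcr : ∀ N : LieSubmodule k L W, ∃ N', IsCompl N N') :
    ⨆ χ : traceRadical k L W → k, weightSpaceOfIsLieTower k W χ (L := L) = ⊤ := by
  have := isSolvable_traceRadical (k := k) hf
  obtain ⟨N', hN'⟩ := hcr (⨆ χ : traceRadical k L W → k, weightSpaceOfIsLieTower k W χ (L := L))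
  by_cases hbot : N' = ⊥
  · rw [hbot] at hN'
    simpa using hN'.sup_eq_top
  · have : Nontrivial N' := (LieSubmodule.nontrivial_iff_ne_bot k L W).2 hbot
    obtain ⟨χ, hχ⟩ := exists_nontrivial_weightSpace_of_isSolvable k (traceRadical k L W) N'
    obtain ⟨⟨v, hv⟩, hv0⟩ := exists_ne (0 : weightSpace N' χ)
    rw [mem_weightSpace] at hv
    have h1 : (v : W) ∈ weightSpaceOfIsLieTower k W (χ : traceRadical k L W → k) (L := L) := by
      change (v : W) ∈ weightSpace W χ
      rw [mem_weightSpace]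
      intro x
      exact congrArg Subtype.val (hv x)
    have h2 := (LieSubmodule.disjoint_toSubmodule.2 hN'.disjoint)
    have h3 := Submodule.disjoint_def.1 h2 v
      (le_iSup (fun χ : traceRadical k L W → k => weightSpaceOfIsLieTower k W χ (L := L)) χ h1) v.2
    exact absurd (Subtype.ext (Subtype.ext h3)) hv0

/-- On each weight space, which is stable under `L`, `r` is a scalar; so `[r, c]` acts by zero. -/
theorem lie_eq_zero_of_mem_traceRadical (hf : ∀ x : L, (∀ w : W, ⁅x, w⁆ = 0) → x = 0)
    (hcr : ∀ N : LieSubmodule k L W, ∃ N', IsCompl N N') {r : L} (hr : traceForm k L W r = 0)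
    (c : L) : ⁅r, c⁆ = 0 := by
  refine hf _ fun w => ?_
  have hw : w ∈ ⨆ χ : traceRadical k L W → k, weightSpaceOfIsLieTower k W χ (L := L) := by
    rw [iSup_weightSpace_traceRadical hf hcr]; trivial
  induction hw using LieSubmodule.iSup_induction' with
  | mem χ w hw =>
    have h1 : ∀ u ∈ weightSpaceOfIsLieTower k W χ (L := L), ⁅r, u⁆ = χ ⟨r, hr⟩ • u := fun u hu =>
      (mem_weightSpace χ u).1 (show u ∈ weightSpace W (χ : traceRadical k L W → k) from hu) ⟨r, hr⟩
    rw [lie_lie, h1 w hw, h1 _ (LieSubmodule.lie_mem _ hw), lie_smul, sub_self]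
  | zero => simp
  | add a b _ _ ha hb => rw [lie_add, ha, hb, add_zero]

theorem iSup_eigenspace_of_mem_traceRadical (hf : ∀ x : L, (∀ w : W, ⁅x, w⁆ = 0) → x = 0)
    (hcr : ∀ N : LieSubmodule k L W, ∃ N', IsCompl N N') {r : L} (hr : traceForm k L W r = 0) :
    ⨆ μ, Module.End.eigenspace (toEnd k L W r) μ = ⊤ := by
  refine eq_top_iff.2 fun w _ => ?_
  have hw : w ∈ ⨆ χ : traceRadical k L W → k, weightSpaceOfIsLieTower k W χ (L := L) := by
    rw [iSup_weightSpace_traceRadical hf hcr]; trivial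
  induction hw using LieSubmodule.iSup_induction' with
  | mem χ w hw =>
    exact Submodule.mem_iSup_of_mem (χ ⟨r, hr⟩)
      (Module.End.mem_eigenspace_iff.2 ((mem_weightSpace χ w).1
        (show w ∈ weightSpace W (χ : traceRadical k L W → k) from hw) ⟨r, hr⟩))
  | zero => exact zero_mem _
  | add a b _ _ ha hb => exact add_mem (ha trivial) (hb trivial)

omit [CharZero k] [IsAlgClosed k] [FiniteDimensional k L] [FiniteDimensional k W] in
theorem traceForm_ad_pow_eq_zero (h t c : L) (n : ℕ) (ht : ((LieAlgebra.ad k L h) ^ n) t = 0) :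
    traceForm k L W t (((LieAlgebra.ad k L h) ^ n) c) = 0 := by
  induction n generalizing t with
  | zero =>
    have : t = 0 := ht
    simp [this]
  | succ n ih =>
    rw [pow_succ, Module.End.mul_apply] at ht
    rw [pow_succ', Module.End.mul_apply, LieAlgebra.ad_apply, ← neg_eq_zero,
      ← traceForm_apply_lie_apply']
    exact ih _ ht

omit [CharZero k] [IsAlgClosed k] [FiniteDimensional k W] in
/-- The Fitting decomposition of `ad h`. -/
theorem exists_engel_add_lie (h y : L) (m : ℕ) : ∃ n, m < n ∧ ∃ y₀ ∈ LieSubalgebra.engel k h,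
    ∃ c, y = y₀ + ((LieAlgebra.ad k L h) ^ n) c := by
  obtain ⟨N, hN⟩ := Filter.eventually_atTop.1
    (LinearMap.eventually_isCompl_ker_pow_range_pow (LieAlgebra.ad k L h))
  refine ⟨max N (m + 1), lt_of_lt_of_le (Nat.lt_succ_self m) (le_max_right _ _), ?_⟩
  have hc := hN _ (le_max_left N (m + 1))
  obtain ⟨a, ha, b, ⟨c, rfl⟩, hab⟩ := Submodule.mem_sup.1
    (show y ∈ _ ⊔ _ by rw [hc.sup_eq_top]; trivial)
  exact ⟨a, (LieSubalgebra.mem_engel_iff k h a).2 ⟨_, ha⟩, c, hab.symm⟩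

-- By the Fitting decomposition and invariance, the Cartan subalgebra is orthogonal to its
-- complement, so the trace form remains non-degenerate on it. A nilpotent Lie algebra with a
-- non-degenerate trace form is abelian.
omit [CharZero k] [IsAlgClosed k] in
theorem isLieAbelian_engel (hτ : ∀ r : L, traceForm k L W r = 0 → r = 0) {h : L}
    (hC : (LieSubalgebra.engel k h).IsCartanSubalgebra) :
    IsLieAbelian (LieSubalgebra.engel k h) := by
  have := hC.nilpotent
  refine isLieAbelian_of_ker_traceForm_eq_bot k (LieSubalgebra.engel k h) W
    (LinearMap.ker_eq_bot'.2 ?_)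
  rintro ⟨t, ht⟩ h0
  refine Subtype.ext (hτ t (LinearMap.ext fun y => ?_))
  obtain ⟨m, hm⟩ := (LieSubalgebra.mem_engel_iff k h t).1 ht
  obtain ⟨n, hn, y₀, hy₀, c, rfl⟩ := exists_engel_add_lie (k := k) h y m
  have h1 : traceForm k L W t y₀ = 0 := LinearMap.congr_fun h0 ⟨y₀, hy₀⟩
  rw [map_add, h1, traceForm_ad_pow_eq_zero h t c n, add_zero, LinearMap.zero_apply]
  exact Module.End.pow_map_zero_of_le hn.le hm

-- The kernel of `n` is a subrepresentation. A complement of it is stable under `n`, a polynomial in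
-- `t`, and there `n` is injective and nilpotent.
omit [CharZero k] [IsAlgClosed k] [FiniteDimensional k L] [FiniteDimensional k W] in
theorem eq_zero_of_commute_of_isNilpotent (hcr : ∀ N : LieSubmodule k L W, ∃ N', IsCompl N N')
    (t : L) {n : Module.End k W} (hadj : n ∈ Algebra.adjoin k {toEnd k L W t})
    (hcomm : ∀ (c : L) (w : W), n ⁅c, w⁆ = ⁅c, n w⁆) (hnil : _root_.IsNilpotent n) : n = 0 := by
  let N : LieSubmodule k L W :=
    { __ := LinearMap.ker n
      lie_mem := by
        intro c w hw
        have hw : n w = 0 := hw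
        change n ⁅c, w⁆ = 0
        rw [hcomm, hw, lie_zero] }
  obtain ⟨N', hN'⟩ := hcr N
  have hst : ∀ w ∈ N', n w ∈ N' := by
    clear hcomm hnil N hN'
    induction hadj using Algebra.adjoin_induction with
    | mem a h => rw [Set.mem_singleton_iff.1 h]; exact fun w hw => N'.lie_mem hw
    | algebraMap c => exact fun w hw => N'.smul_mem c hw
    | add a b _ _ ha hb => exact fun w hw => add_mem (ha w hw) (hb w hw)
    | mul a b _ _ ha hb => exact fun w hw => ha _ (hb w hw)
  have hdis := Submodule.disjoint_def.1 (LieSubmodule.disjoint_toSubmodule.2 hN'.disjoint)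
  have hbot : ∀ (j : ℕ) (w : W), w ∈ N' → (n ^ j) w = 0 → w = 0 := by
    intro j
    induction j with
    | zero => exact fun w _ h => h
    | succ j ih =>
      intro w hw h
      rw [pow_succ, Module.End.mul_apply] at h
      exact hdis w (ih _ (hst w hw) h) hw
  obtain ⟨j, hj⟩ := hnil
  have hN'bot : N' = ⊥ := (LieSubmodule.eq_bot_iff N').2 fun w hw =>
    hbot j w hw (by rw [hj, LinearMap.zero_apply])
  rw [hN'bot] at hN'
  have htop : N = ⊤ := by simpa using hN'.sup_eq_top
  refine LinearMap.ext fun w => ?_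
  have hw : w ∈ N := htop ▸ LieSubmodule.mem_top w
  exact hw

/-- The nilpotent part `n` of the Jordan decomposition of `t` turns out to commute with all of `L`,
hence is zero by `eq_zero_of_commute_of_isNilpotent`. -/
theorem iSup_eigenspace_of_mem_engel (hcr : ∀ N : LieSubmodule k L W, ∃ N', IsCompl N N')
    (hτ : ∀ r : L, traceForm k L W r = 0 → r = 0) {h : L}
    (hC : (LieSubalgebra.engel k h).IsCartanSubalgebra) {t : L}
    (ht : t ∈ LieSubalgebra.engel k h) :
    ⨆ μ, Module.End.eigenspace (toEnd k L W t) μ = ⊤ := by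
  have hab := isLieAbelian_engel (W := W) hτ hC
  have hcomm : ∀ y ∈ LieSubalgebra.engel k h, ⁅t, y⁆ = 0 := fun y hy =>
    congrArg Subtype.val (hab.trivial (⟨t, ht⟩ : LieSubalgebra.engel k h) ⟨y, hy⟩)
  obtain ⟨n, hn_adj, s, hs_adj, hn_nil, hs_ss, hns⟩ :=
    (toEnd k L W t).exists_isNilpotent_isSemisimple
  have hcns : Commute n s := Algebra.commute_of_mem_adjoin_singleton_of_commute hs_adj
    (Algebra.commute_of_mem_adjoin_self hn_adj).symm
  have hny : ∀ y ∈ LieSubalgebra.engel k h, Commute n (toEnd k L W y) := fun y hy => by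
    refine (Algebra.commute_of_mem_adjoin_singleton_of_commute hn_adj ?_).symm
    rw [commute_iff_lie_eq, ← LieHom.map_lie, ← lie_skew, hcomm y hy, neg_zero, map_zero]
  -- On the Cartan subalgebra `n y` is nilpotent since `n` and `y` commute; on brackets `[h, c']`
  -- the trace vanishes by cyclicity since `n` commutes with `h`.
  have htr : ∀ y : L, LinearMap.trace k W (n * toEnd k L W y) = 0 := fun y => by
    obtain ⟨m, hm, y₀, hy₀, c, rfl⟩ := exists_engel_add_lie (k := k) h y 0
    obtain ⟨m, rfl⟩ := Nat.exists_eq_succ_of_ne_zero hm.ne'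
    have h1 : LinearMap.trace k W (n * toEnd k L W y₀) = 0 :=
      (LinearMap.isNilpotent_trace_of_isNilpotent
        ((hny y₀ hy₀).isNilpotent_mul_right hn_nil)).eq_zero
    have h2 : ∀ c', LinearMap.trace k W (n * toEnd k L W ⁅h, c'⁆) = 0 := fun c' => by
      have hc := hny h (LieSubalgebra.self_mem_engel k h)
      rw [LieHom.map_lie, Ring.lie_def, mul_sub, map_sub, sub_eq_zero, ← mul_assoc,
        hc.eq, mul_assoc, LinearMap.trace_mul_comm, mul_assoc]
    rw [map_add, mul_add, map_add, h1, zero_add, pow_succ', Module.End.mul_apply,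
      LieAlgebra.ad_apply, h2]
  have hn0 : n = 0 := by
    refine eq_zero_of_commute_of_isNilpotent hcr t hn_adj (fun c w => ?_) hn_nil
    have had : LieAlgebra.ad k _ n ∈ Algebra.adjoin k {LieAlgebra.ad k _ (toEnd k L W t)} := by
      rw [hns]; exact LieAlgebra.ad_mem_adjoin_of_isNilpotent hcns hn_nil hs_ss
    -- `ad n` is a polynomial in `ad t`, so it preserves the image of `L`.
    obtain ⟨d, hd⟩ : ∃ d, toEnd k L W d = ⁅n, toEnd k L W c⁆ := by
      rw [← LieAlgebra.ad_apply (R := k)]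
      generalize LieAlgebra.ad k (Module.End k W) n = a at had
      have : ∀ z ∈ LinearMap.range (toEnd k L W : L →ₗ[k] Module.End k W),
          a z ∈ LinearMap.range (toEnd k L W : L →ₗ[k] Module.End k W) := by
        induction had using Algebra.adjoin_induction with
        | mem a ha =>
          rw [Set.mem_singleton_iff.1 ha]
          rintro _ ⟨z, rfl⟩
          exact ⟨⁅t, z⁆, LieHom.map_lie _ t z⟩
        | algebraMap c => exact fun z hz => Submodule.smul_mem _ c hz
        | add a b _ _ ha hb => exact fun z hz => add_mem (ha z hz) (hb z hz)
        | mul a b _ _ ha hb => exact fun z hz => ha _ (hb z hz)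
      exact this _ ⟨c, rfl⟩
    -- The trace of `[n, c] c'` equals that of `n [c, c']`, which is zero by `htr`.
    have hd0 : d = 0 := hτ d (LinearMap.ext fun c' => by
      rw [traceForm_apply_apply, hd, LinearMap.zero_apply, ← Module.End.mul_eq_comp,
        Ring.lie_def, sub_mul, map_sub, mul_assoc, mul_assoc,
        LinearMap.trace_mul_comm k (toEnd k L W c), mul_assoc, ← map_sub, ← mul_sub,
        ← Ring.lie_def, ← LieHom.map_lie, htr])
    rw [hd0, map_zero, eq_comm, Ring.lie_def, sub_eq_zero] at hd
    exact LinearMap.congr_fun hd w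
  rw [hns, hn0, zero_add]
  exact hs_ss.iSup_eigenspace_eq_top

end LieModule

/-- A space of commuting diagonalizable operators has a member whose kernel is the common
kernel. -/
theorem exists_mem_ker_le_ker {k X : Type*} [Field k] [CharZero k] [AddCommGroup X] [Module k X]
    [FiniteDimensional k X] (𝓗 : Submodule k (Module.End k X))
    (hcomm : ∀ s ∈ 𝓗, ∀ t ∈ 𝓗, Commute s t)
    (hdiag : ∀ s ∈ 𝓗, ⨆ μ, Module.End.eigenspace s μ = ⊤) :
    ∃ s ∈ 𝓗, ∀ t ∈ 𝓗, LinearMap.ker s ≤ LinearMap.ker t := by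
  obtain ⟨s, hs, hmin⟩ := exists_minimalFor_of_wellFoundedLT (· ∈ 𝓗)
    (fun s => Module.finrank k (LinearMap.ker s)) ⟨0, 𝓗.zero_mem⟩
  refine ⟨s, hs, fun t ht => ?_⟩
  -- For `c` outside this finite set, `α + c β = 0` with eigenvalues `α` of `s` and `β` of `t`
  -- forces both to vanish. Then the kernel of `s + c t` is the intersection of the two kernels, and
  -- minimality of `s` applies.
  have hfin : (Set.image2 (fun α β => -(α / β)) {α | Module.End.HasEigenvalue s α}
      {β | Module.End.HasEigenvalue t β} ∪ {0}).Finite :=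
    ((Module.End.finite_hasEigenvalue s).image2 _ (Module.End.finite_hasEigenvalue t)).union
      (Set.finite_singleton 0)
  obtain ⟨c, hc⟩ := hfin.exists_notMem
  rw [Set.mem_union, not_or] at hc
  have hc0 : c ≠ 0 := hc.2
  let K := LinearMap.ker (s + c • t)
  have hK : ∀ x ∈ K, s x = -(c • t x) := fun x hx => eq_neg_of_add_eq_zero_left hx
  have hKs : ∀ x ∈ K, s x ∈ K := fun x hx => by
    have hx0 : s x + c • t x = 0 := hx
    change s (s x) + c • t (s x) = 0
    rw [← Module.End.mul_apply t s, ← (hcomm s hs t ht).eq, Module.End.mul_apply, ← map_smul,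
      ← map_add, hx0, map_zero]
  have hle : K ≤ LinearMap.ker s := by
    have := Submodule.eq_iSup_inf_genEigenspace (p := K) 1 hKs (hdiag s hs)
    rw [this]
    refine iSup_le fun α x hx => ?_
    have hxα : s x = α • x := Module.End.mem_eigenspace_iff.1 hx.2
    change s x = 0
    by_contra hne
    have hα : α ≠ 0 := fun h => hne (by rw [hxα, h, zero_smul])
    have hx0 : x ≠ 0 := fun h => hne (by rw [h, map_zero])
    have htx : t x = (-(α / c)) • x := by
      have h1 := hK x hx.1
      rw [hxα] at h1
      have h2 : c • t x = -(α • x) := by rw [h1, neg_neg]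
      rw [← inv_smul_smul₀ hc0 (t x), h2, smul_neg, smul_smul, neg_smul, div_eq_inv_mul]
    refine hc.1 ⟨α, Module.End.hasEigenvalue_of_hasEigenvector
      ⟨Module.End.mem_eigenspace_iff.2 hxα, hx0⟩, -(α / c),
      Module.End.hasEigenvalue_of_hasEigenvector ⟨Module.End.mem_eigenspace_iff.2 htx, hx0⟩, ?_⟩
    field_simp
  have hKt : K ≤ LinearMap.ker s ⊓ LinearMap.ker t := fun x hx => ⟨hle hx, by
    have h1 := hK x hx
    rw [show s x = 0 from hle hx, eq_comm, neg_eq_zero] at h1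
    exact (smul_eq_zero.1 h1).resolve_left hc0⟩
  have h1 : Module.finrank k (LinearMap.ker s) ≤ Module.finrank k K := by
    have hm : s + c • t ∈ 𝓗 := add_mem hs (𝓗.smul_mem c ht)
    by_contra hlt
    exact hlt (hmin hm (not_le.1 hlt).le)
  have h2 : LinearMap.ker s ⊓ LinearMap.ker t = LinearMap.ker s :=
    Submodule.eq_of_le_of_finrank_le inf_le_left
      (h1.trans (Submodule.finrank_mono hKt))
  exact inf_eq_left.1 h2

theorem SuperGrading.proj_mem_of_homogeneous {k V : Type*} [Field k] [AddCommGroup V] [Module k V]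
    (G : SuperGrading k V) {i : ZMod 2} {U : Submodule k V} {x : V} (hi : x ∈ G.gr i) (hx : x ∈ U)
    (j : ZMod 2) : G.proj j x ∈ U := by
  by_cases h : j = i
  · subst h
    rwa [G.proj_of_mem hi]
  · rw [G.proj_of_mem_ne h hi]
    exact zero_mem _

/-! ### Structure of basic classical Lie superalgebras -/

namespace LieSuperalgebra

section EvenAction

variable {k : Type*} {L : Type*} [Field k] [AddCommGroup L] [Module k L] [LieSuperalgebra k L]

theorem bracket_bracket_even {h : L} (hh : h ∈ (grading (k := k)).gr 0) (x y : L) :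
    bracket (k := k) h (bracket (k := k) x y) =
      bracket (k := k) (bracket (k := k) h x) y + bracket (k := k) x (bracket (k := k) h y) := by
  have key : ∀ i j, ∀ x ∈ (grading (k := k) (L := L)).gr i,
      ∀ y ∈ (grading (k := k) (L := L)).gr j, bracket (k := k) h (bracket (k := k) x y) =
      bracket (k := k) (bracket (k := k) h x) y + bracket (k := k) x (bracket (k := k) h y) := by
    intro i j x hx y hy
    rw [jacobi hh hx hy, superSign_zero_left, one_smul]
  have hp := fun i z => (grading (k := k) (L := L)).proj_mem i z
  rw [← (grading (k := k) (L := L)).proj_add_proj x, ← (grading (k := k) (L := L)).proj_add_proj y]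
  simp only [map_add, LinearMap.add_apply, key _ _ _ (hp _ x) _ (hp _ y)]
  abel

theorem skew_even {h : L} (hh : h ∈ (grading (k := k)).gr 0) (x : L) :
    bracket (k := k) x h = -bracket (k := k) h x := by
  have hp := fun i z => (grading (k := k) (L := L)).proj_mem i z
  rw [← (grading (k := k) (L := L)).proj_add_proj x, map_add, map_add, LinearMap.add_apply,
    skew (hp 0 x) hh, skew (hp 1 x) hh, superSign_zero_right, superSign_zero_right, one_smul,
    one_smul, neg_add]

theorem bracket_even_even {x y : L} (hx : x ∈ (grading (k := k)).gr 0)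
    (hy : y ∈ (grading (k := k)).gr 0) : bracket (k := k) x y ∈ (grading (k := k)).gr 0 := by
  simpa using bracket_mem hx hy

theorem bracket_even_odd {x y : L} (hx : x ∈ (grading (k := k)).gr 0)
    (hy : y ∈ (grading (k := k)).gr 1) : bracket (k := k) x y ∈ (grading (k := k)).gr 1 := by
  simpa using bracket_mem hx hy

theorem bracket_odd_odd {x y : L} (hx : x ∈ (grading (k := k)).gr 1)
    (hy : y ∈ (grading (k := k)).gr 1) : bracket (k := k) x y ∈ (grading (k := k)).gr 0 := by
  have := bracket_mem hx hy
  rwa [show (1 + 1 : ZMod 2) = 0 by decide] at this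

theorem skew_odd {x y : L} (hx : x ∈ (grading (k := k)).gr 1)
    (hy : y ∈ (grading (k := k)).gr 1) : bracket (k := k) x y = bracket (k := k) y x := by
  rw [skew hx hy, superSign_one_one, neg_one_smul, neg_neg]

variable (k L) in
/-- The Lie algebra `L₀`. -/
abbrev EvenPart : Type _ := ↥((grading (k := k) (L := L)).gr 0)

variable (k L) in
/-- The space `L₁`, a representation of `L₀`. -/
abbrev OddPart : Type _ := ↥((grading (k := k) (L := L)).gr 1)

noncomputable instance [CharZero k] : LieRing (EvenPart k L) where
  bracket x y := ⟨bracket (k := k) x.1 y.1, bracket_even_even x.2 y.2⟩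
  add_lie x y z := Subtype.ext (by simp)
  lie_add x y z := Subtype.ext (by simp)
  lie_self x := Subtype.ext (by
    have := skew_even x.2 x.1
    rw [eq_neg_iff_add_eq_zero, ← two_smul k, smul_eq_zero] at this
    exact this.resolve_left two_ne_zero)
  leibniz_lie x y z := Subtype.ext (bracket_bracket_even x.2 y.1 z.1)

noncomputable instance [CharZero k] : LieAlgebra k (EvenPart k L) where
  lie_smul c x y := Subtype.ext (by simp [Bracket.bracket])

noncomputable instance [CharZero k] : LieRingModule (EvenPart k L) (OddPart k L) where
  bracket x y := ⟨bracket (k := k) x.1 y.1, bracket_even_odd x.2 y.2⟩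
  add_lie x y z := Subtype.ext (by simp)
  lie_add x y z := Subtype.ext (by simp)
  leibniz_lie x y z := Subtype.ext (bracket_bracket_even x.2 y.1 z.1)

noncomputable instance [CharZero k] : LieModule k (EvenPart k L) (OddPart k L) where
  smul_lie c x y := Subtype.ext (by simp [Bracket.bracket])
  lie_smul c x y := Subtype.ext (by simp [Bracket.bracket])

theorem exists_isCompl_of_isClassical [CharZero k] (hL : IsClassical k L)
    (N : LieSubmodule k (EvenPart k L) (OddPart k L)) :
    ∃ N' : LieSubmodule k (EvenPart k L) (OddPart k L), IsCompl N N' := by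
  obtain ⟨U', ⟨hU1, hU2⟩, hinf, hsup⟩ := hL.2 (N.toSubmodule.map (Submodule.subtype _)) ⟨by
      rintro _ ⟨y, -, rfl⟩
      exact y.2, by
      rintro x hx _ ⟨y, hy, rfl⟩
      exact ⟨⁅(⟨x, hx⟩ : EvenPart k L), y⁆, N.lie_mem hy, rfl⟩⟩
  refine ⟨{ __ := U'.comap (Submodule.subtype _), lie_mem := fun {x y} hy => hU2 x.1 x.2 _ hy },
    ?_, ?_⟩
  · rw [← LieSubmodule.disjoint_toSubmodule]
    refine Submodule.disjoint_def.2 fun y hy hy' => Subtype.ext ?_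
    have : (y : L) ∈ N.toSubmodule.map (Submodule.subtype _) ⊓ U' := ⟨⟨y, hy, rfl⟩, hy'⟩
    rwa [hinf] at this
  · rw [← LieSubmodule.codisjoint_toSubmodule, codisjoint_iff]
    refine eq_top_iff.2 fun y _ => ?_
    obtain ⟨_, ⟨a, ha, rfl⟩, b, hb, hab⟩ := Submodule.mem_sup.1 (hsup.ge y.2)
    exact Submodule.mem_sup.2 ⟨a, ha, ⟨b, hU1 hb⟩, hb, Subtype.ext hab⟩

/-- The annihilator of `L₁` in `L₀` is an ideal, and it is not `L` because `L₁ ≠ 0`. Thus `L₀` acts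
faithfully on `L₁`. -/
theorem eq_zero_of_bracket_odd (hL : IsSimple k L) (h1 : (grading (k := k) (L := L)).gr 1 ≠ ⊥)
    {x : L} (hx : x ∈ (grading (k := k)).gr 0)
    (hx1 : ∀ y ∈ (grading (k := k) (L := L)).gr 1, bracket (k := k) x y = 0) : x = 0 := by
  let Z : Submodule k L := (grading (k := k)).gr 0 ⊓
    ⨅ (y) (_ : y ∈ (grading (k := k) (L := L)).gr 1), LinearMap.ker ((bracket (k := k)).flip y)
  have hZ : ∀ z, z ∈ Z ↔ z ∈ (grading (k := k)).gr 0 ∧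
      ∀ y ∈ (grading (k := k) (L := L)).gr 1, bracket (k := k) z y = 0 := fun z => by
    simp only [Z, Submodule.mem_inf, Submodule.mem_iInf, LinearMap.mem_ker, LinearMap.flip_apply]
  have hI : IsIdeal k L Z := by
    refine ⟨fun z hz i => ?_, fun y z hz => ?_⟩
    · exact SuperGrading.proj_mem_of_homogeneous _ ((hZ z).1 hz).1 hz i
    · rw [← (grading (k := k) (L := L)).proj_add_proj y, map_add, LinearMap.add_apply,
        skew_even ((hZ z).1 hz).1 ((grading (k := k)).proj 1 y),
        ((hZ z).1 hz).2 _ (SuperGrading.proj_mem _ 1 y), neg_zero, add_zero]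
      rw [hZ] at hz ⊢
      have hy := (grading (k := k) (L := L)).proj_mem 0 y
      refine ⟨bracket_even_even hy hz.1, fun w hw => ?_⟩
      have := bracket_bracket_even hy z w
      rw [hz.2 w hw, hz.2 _ (bracket_even_odd hy hw), map_zero, add_zero] at this
      exact this.symm
  rcases hL.2 Z hI with h | h
  · have : x ∈ Z := (hZ x).2 ⟨hx, hx1⟩
    rwa [h] at this
  · refine absurd ?_ h1
    rw [Submodule.eq_bot_iff]
    intro y hy
    have : y ∈ Z := h ▸ Submodule.mem_top
    exact SuperGrading.eq_zero_of_mem_of_mem _ (by decide) ((hZ y).1 this).1 hy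

/-- If the odd part is the sum of two stable subspaces `U` and `U'` with `[U, U'] = 0`, then
`U + [U, U]` is an ideal. -/
theorem isIdeal_sup_span {U U' : Submodule k L} (hU : IsEvenStable k L U)
    (hsup : U ⊔ U' = (grading (k := k)).gr 1) (hbr : ∀ x ∈ U, ∀ y ∈ U', bracket (k := k) x y = 0) :
    IsIdeal k L (U ⊔ Submodule.span k (Set.image2 (fun x y => bracket (k := k) x y) U U)) := by
  set D := Submodule.span k (Set.image2 (fun x y => bracket (k := k) x y) (U : Set L) U) with hD
  have hD0 : D ≤ (grading (k := k)).gr 0 := by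
    refine Submodule.span_le.2 ?_
    rintro _ ⟨x, hx, y, hy, rfl⟩
    exact bracket_odd_odd (hU.1 hx) (hU.1 hy)
  have hU' : U' ≤ (grading (k := k)).gr 1 := hsup ▸ le_sup_right
  refine ⟨fun z hz i => ?_, fun x z hz => ?_⟩
  · obtain ⟨a, ha, b, hb, rfl⟩ := Submodule.mem_sup.1 hz
    rw [map_add]
    refine add_mem (Submodule.mem_sup_left ?_) (Submodule.mem_sup_right ?_)
    · exact SuperGrading.proj_mem_of_homogeneous _ (hU.1 ha) ha i
    · exact SuperGrading.proj_mem_of_homogeneous _ (hD0 hb) hb i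
  · rw [← (grading (k := k) (L := L)).proj_add_proj x, map_add, LinearMap.add_apply]
    have hx0 := (grading (k := k) (L := L)).proj_mem 0 x
    generalize (grading (k := k) (L := L)).proj 0 x = x₀ at hx0 ⊢
    obtain ⟨u, hu, u', hu', hx1⟩ := Submodule.mem_sup.1
      (hsup ▸ (grading (k := k) (L := L)).proj_mem 1 x : _ ∈ U ⊔ U')
    rw [← hx1, map_add, LinearMap.add_apply]
    obtain ⟨a, ha, b, hb, rfl⟩ := Submodule.mem_sup.1 hz
    have h1 : bracket (k := k) u' a = 0 := by
      rw [skew_odd (hU' hu') (hU.1 ha), hbr a ha u' hu']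
    have h2 : bracket (k := k) u' b = 0 := by
      refine (Submodule.span_le (p := LinearMap.ker (bracket (k := k) u'))).2 ?_ hb
      rintro _ ⟨x, hx, y, hy, rfl⟩
      change bracket (k := k) u' (bracket (k := k) x y) = 0
      rw [jacobi (hU' hu') (hU.1 hx) (hU.1 hy), skew_odd (hU' hu') (hU.1 hx), hbr x hx u' hu',
        skew_odd (hU' hu') (hU.1 hy), hbr y hy u' hu']
      simp
    have h3 : bracket (k := k) x₀ b ∈ D := by
      refine (Submodule.span_le (p := D.comap (bracket (k := k) x₀))).2 ?_ hb
      rintro _ ⟨x, hx, y, hy, rfl⟩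
      change bracket (k := k) x₀ (bracket (k := k) x y) ∈ D
      rw [bracket_bracket_even hx0]
      exact add_mem (Submodule.subset_span ⟨_, hU.2 _ hx0 _ hx, _, hy, rfl⟩)
        (Submodule.subset_span ⟨_, hx, _, hU.2 _ hx0 _ hy, rfl⟩)
    rw [map_add, map_add, map_add, h1, h2, add_zero, add_zero, skew_even (hD0 hb) u]
    refine add_mem (add_mem ?_ ?_) (add_mem ?_ ?_)
    · exact Submodule.mem_sup_left (hU.2 _ hx0 _ ha)
    · exact Submodule.mem_sup_right h3
    · exact Submodule.mem_sup_right (Submodule.subset_span ⟨_, hu, _, ha, rfl⟩)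
    · exact neg_mem (Submodule.mem_sup_left (hU.2 _ (hD0 hb) _ hu))

theorem eq_bot_or_eq_bot_of_isSimple (hL : IsSimple k L) {U U' : Submodule k L}
    (hU : IsEvenStable k L U) (hsup : U ⊔ U' = (grading (k := k)).gr 1) (hinf : U ⊓ U' = ⊥)
    (hbr : ∀ x ∈ U, ∀ y ∈ U', bracket (k := k) x y = 0) : U = ⊥ ∨ U' = ⊥ := by
  refine (hL.2 _ (isIdeal_sup_span hU hsup hbr)).imp (fun h => ?_) fun h => ?_
  · exact eq_bot_iff.2 (le_sup_left.trans h.le)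
  · have hU' : U' ≤ (grading (k := k)).gr 1 := hsup ▸ le_sup_right
    rw [← hinf, eq_comm, inf_eq_right]
    intro x hx
    obtain ⟨a, ha, b, hb, hab⟩ := Submodule.mem_sup.1 (h ▸ Submodule.mem_top (x := x))
    have hb0 : b ∈ (grading (k := k)).gr 0 := by
      refine Submodule.span_le.2 ?_ hb
      rintro _ ⟨x, hx, y, hy, rfl⟩
      exact bracket_odd_odd (hU.1 hx) (hU.1 hy)
    have hb1 : b ∈ (grading (k := k)).gr 1 := by
      rw [← add_sub_cancel_left a b, hab]
      exact sub_mem (hU' hx) (hU.1 ha)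
    rw [SuperGrading.eq_zero_of_mem_of_mem _ (by decide) hb0 hb1, add_zero] at hab
    rwa [← hab]

/-- `L₁ + [L₁, L₁]` is a nonzero ideal. -/
theorem span_bracket_odd (hL : IsSimple k L) (h1 : (grading (k := k) (L := L)).gr 1 ≠ ⊥) :
    (grading (k := k)).gr 0 ≤ Submodule.span k (Set.image2 (fun x y => bracket (k := k) x y)
      ((grading (k := k) (L := L)).gr 1 : Set L) ((grading (k := k) (L := L)).gr 1)) := by
  intro x hx
  have hst : IsEvenStable k L ((grading (k := k)).gr 1) :=
    ⟨le_rfl, fun x hx y hy => bracket_even_odd hx hy⟩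
  rcases hL.2 _ (isIdeal_sup_span (U' := ⊥) hst (sup_bot_eq _)
    (fun x _ y hy => by rw [(Submodule.mem_bot k).1 hy, map_zero])) with h | h
  · exact absurd (eq_bot_iff.2 (le_sup_left.trans h.le)) h1
  · obtain ⟨a, ha, b, hb, hab⟩ := Submodule.mem_sup.1 (h ▸ Submodule.mem_top (x := x))
    have hb0 : b ∈ (grading (k := k)).gr 0 := by
      refine Submodule.span_le.2 ?_ hb
      rintro _ ⟨x, hx, y, hy, rfl⟩
      exact bracket_odd_odd hx hy
    have ha0 : a ∈ (grading (k := k)).gr 0 := by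
      rw [← add_sub_cancel_right a b, hab]
      exact sub_mem hx hb0
    rw [SuperGrading.eq_zero_of_mem_of_mem _ (by decide) ha0 ha, zero_add] at hab
    rwa [← hab]

theorem bracket_mem_iSup_eigenspace {t : L} (ht : t ∈ (grading (k := k)).gr 0) {x y : L}
    (hx : x ∈ ⨆ μ, Module.End.eigenspace (bracket (k := k) t) μ)
    (hy : y ∈ ⨆ μ, Module.End.eigenspace (bracket (k := k) t) μ) :
    bracket (k := k) x y ∈ ⨆ μ, Module.End.eigenspace (bracket (k := k) t) μ := by
  induction hx using Submodule.iSup_induction' with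
  | zero => rw [map_zero]; exact zero_mem _
  | add a b _ _ ha hb => rw [map_add]; exact add_mem ha hb
  | mem α x hx =>
    induction hy using Submodule.iSup_induction' with
    | zero => rw [map_zero]; exact zero_mem _
    | add a b _ _ ha hb => rw [map_add]; exact add_mem ha hb
    | mem β y hy =>
      rw [Module.End.mem_eigenspace_iff] at hx hy
      refine Submodule.mem_iSup_of_mem (α + β) (Module.End.mem_eigenspace_iff.2 ?_)
      rw [bracket_bracket_even ht, hx, hy, map_smul, LinearMap.smul_apply, map_smul, add_smul]

/-- Let `R` be the action of `r` on `L₁`; it is diagonalizable and `r` is central in `L₀`. So `[Rx,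
y] = -[x, Ry]`, and `R²` is symmetric for the bracket of odd elements: different eigenspaces of `R²`
have bracket zero. Simplicity leaves one eigenvalue `μ`. -/
theorem eq_zero_of_traceForm_eq_zero [CharZero k] [IsAlgClosed k] [FiniteDimensional k L]
    (hL : IsClassical k L) (h1 : (grading (k := k) (L := L)).gr 1 ≠ ⊥) {r : EvenPart k L}
    (hr : LieModule.traceForm k (EvenPart k L) (OddPart k L) r = 0) : r = 0 := by
  have hf : ∀ x : EvenPart k L, (∀ w : OddPart k L, ⁅x, w⁆ = 0) → x = 0 := fun x hx =>
    Subtype.ext (eq_zero_of_bracket_odd hL.1 h1 x.2 fun y hy =>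
      congrArg Subtype.val (hx ⟨y, hy⟩))
  have hcr := exists_isCompl_of_isClassical hL
  have hcent := fun c => LieModule.lie_eq_zero_of_mem_traceRadical hf hcr hr c
  have hdiag := LieModule.iSup_eigenspace_of_mem_traceRadical hf hcr hr
  have hcent' : ∀ c ∈ (grading (k := k) (L := L)).gr 0, bracket (k := k) r.1 c = 0 := fun c hc =>
    congrArg Subtype.val (hcent ⟨c, hc⟩)
  set R := LieModule.toEnd k (EvenPart k L) (OddPart k L) r with hR
  have hRv : ∀ v : OddPart k L, ((R v : OddPart k L) : L) = bracket (k := k) r.1 v.1 :=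
    fun v => rfl
  have hle : ∀ μ, R.eigenspace μ ≤ (R * R).eigenspace (μ * μ) := fun μ v hv => by
    rw [Module.End.mem_eigenspace_iff] at hv ⊢
    rw [Module.End.mul_apply, hv, map_smul, hv, smul_smul]
  have hdiag2 : ⨆ μ, (R * R).eigenspace μ = ⊤ :=
    eq_top_iff.2 (hdiag ▸ iSup_le fun μ => le_iSup_of_le (μ * μ) (hle μ))
  have : Nontrivial (OddPart k L) := Submodule.nontrivial_iff_ne_bot.2 h1
  obtain ⟨μ, hμ⟩ := Module.End.exists_eigenvalue (R * R)
  have hskew : ∀ x y : OddPart k L,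
      bracket (k := k) (R x).1 y.1 = -bracket (k := k) x.1 (R y).1 := fun x y => by
    rw [hRv, hRv, eq_neg_iff_add_eq_zero, ← bracket_bracket_even r.2,
      hcent' _ (bracket_odd_odd x.2 y.2)]
  have hst : ∀ P : Submodule k (OddPart k L),
      (∀ c : EvenPart k L, ∀ x ∈ P, ⁅c, x⁆ ∈ P) →
      IsEvenStable k L (P.map (Submodule.subtype _)) := fun P hP => by
    refine ⟨?_, ?_⟩
    · rintro _ ⟨y, -, rfl⟩
      exact y.2
    · rintro c hc _ ⟨y, hy, rfl⟩
      exact ⟨_, hP ⟨c, hc⟩ y hy, rfl⟩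
  have hRc : ∀ (c : EvenPart k L) x, R ⁅c, x⁆ = ⁅c, R x⁆ := fun c x => by
    change ⁅r, ⁅c, x⁆⁆ = ⁅c, ⁅r, x⁆⁆
    rw [leibniz_lie, hcent, zero_lie, zero_add]
  have hE : ∀ ν, ∀ c : EvenPart k L, ∀ x ∈ (R * R).eigenspace ν, ⁅c, x⁆ ∈ (R * R).eigenspace ν :=
    fun ν c x hx => by
      rw [Module.End.mem_eigenspace_iff] at hx ⊢
      rw [Module.End.mul_apply, hRc, hRc, ← Module.End.mul_apply, hx, lie_smul]
  let K : Submodule k (OddPart k L) := (R * R).eigenspace μ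
  let K' : Submodule k (OddPart k L) := ⨆ (ν) (_ : ν ≠ μ), (R * R).eigenspace ν
  have hinj := Submodule.injective_subtype ((grading (k := k) (L := L)).gr 1)
  have hor := eq_bot_or_eq_bot_of_isSimple hL.1 (U := K.map (Submodule.subtype _))
    (U' := K'.map (Submodule.subtype _)) (hst K (hE μ)) (by
      rw [← Submodule.map_sup]
      have : K ⊔ K' = ⊤ := by
        refine eq_top_iff.2 (hdiag2 ▸ iSup_le fun ν => ?_)
        by_cases h : ν = μ
        · exact h ▸ le_sup_left
        · exact le_sup_of_le_right (le_iSup₂_of_le ν h le_rfl)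
      rw [this, Submodule.map_subtype_top]) (by
      rw [← Submodule.map_inf _ hinj, (Module.End.eigenspaces_iSupIndep (R * R) μ).eq_bot,
        Submodule.map_bot]) (by
      rintro _ ⟨x, hx, rfl⟩ _ ⟨y, hy, rfl⟩
      have hx : (R * R) x = μ • x := Module.End.mem_eigenspace_iff.1 hx
      change bracket (k := k) x.1 y.1 = 0
      have hle : K' ≤ LinearMap.ker (bracket (k := k) x.1 ∘ₗ Submodule.subtype _) := by
        refine iSup₂_le fun ν hν y hy => ?_
        rw [Module.End.mem_eigenspace_iff] at hy
        change bracket (k := k) x.1 y.1 = 0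
        have h2 : bracket (k := k) ((R * R) x).1 y.1 = bracket (k := k) x.1 ((R * R) y).1 := by
          rw [Module.End.mul_apply, Module.End.mul_apply, hskew, hskew, neg_neg]
        rw [hx, hy, Submodule.coe_smul, Submodule.coe_smul, map_smul, map_smul,
          LinearMap.smul_apply, ← sub_eq_zero, ← sub_smul, smul_eq_zero, sub_eq_zero] at h2
        exact h2.resolve_left hν.symm
      exact hle hy)
  have hKtop : K' = ⊥ := by
    rcases hor with h | h
    · exact absurd (Submodule.map_injective_of_injective hinj (h.trans (Submodule.map_bot _).symm))
        hμ
    · exact Submodule.map_injective_of_injective hinj (h.trans (Submodule.map_bot _).symm)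
  have hsq : ∀ x, R (R x) = μ • x := fun x => by
    have : x ∈ ⨆ ν, (R * R).eigenspace ν := hdiag2 ▸ Submodule.mem_top
    have hle : ⨆ ν, (R * R).eigenspace ν ≤ K := iSup_le fun ν => by
      by_cases h : ν = μ
      · exact h ▸ le_rfl
      · exact (le_iSup₂_of_le (f := fun ν (_ : ν ≠ μ) => (R * R).eigenspace ν) ν h le_rfl).trans
          (hKtop.le.trans bot_le)
    exact Module.End.mem_eigenspace_iff.1 (hle this)
  -- The trace of `R² = μ` is the value of the trace form at `(r, r)`, which is zero. A
  -- diagonalizable `R` with square zero is zero.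
  have htr : μ = 0 := by
    have h2 := LinearMap.congr_fun hr r
    rw [LieModule.traceForm_apply_apply, ← hR, show R ∘ₗ R = μ • LinearMap.id from
      LinearMap.ext hsq, map_smul, LinearMap.trace_id, LinearMap.zero_apply, smul_eq_mul,
      mul_eq_zero, Nat.cast_eq_zero] at h2
    exact h2.resolve_right Module.finrank_pos.ne'
  refine hf r fun w => ?_
  change R w = 0
  have hw : w ∈ ⨆ ν, R.eigenspace ν := hdiag ▸ Submodule.mem_top
  refine (iSup_le fun ν v hv => ?_ : (⨆ ν, R.eigenspace ν) ≤ LinearMap.ker R) hw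
  rw [Module.End.mem_eigenspace_iff] at hv
  have h2 := hsq v
  rw [hv, map_smul, hv, smul_smul, htr, zero_smul, smul_eq_zero, mul_self_eq_zero] at h2
  change R v = 0
  rw [hv]
  rcases h2 with h2 | h2 <;> simp [h2]

/-- A basic classical Lie superalgebra with odd part contains an even element that acts
diagonalizably and has an abelian centralizer. -/
theorem exists_abelian_centralizer_of_isBasicClassical [CharZero k] [IsAlgClosed k]
    [FiniteDimensional k L] (hL : IsBasicClassical k L)
    (h1 : (grading (k := k) (L := L)).gr 1 ≠ ⊥) :
    ∃ h ∈ (grading (k := k) (L := L)).gr 0,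
      ⨆ μ, Module.End.eigenspace (bracket (k := k) h) μ = ⊤ ∧
      ∀ x y : L, bracket (k := k) h x = 0 → bracket (k := k) h y = 0 →
        bracket (k := k) x y = 0 := by
  obtain ⟨hcl, B, ⟨hB, -⟩, hBeven, hBinv⟩ := hL
  have hτ : ∀ r : EvenPart k L, LieModule.traceForm k (EvenPart k L) (OddPart k L) r = 0 → r = 0 :=
    fun r hr => eq_zero_of_traceForm_eq_zero hcl h1 hr
  obtain ⟨h₀, hC⟩ := LieAlgebra.exists_isCartanSubalgebra_engel k (EvenPart k L)
  have hab := LieModule.isLieAbelian_engel (W := OddPart k L) hτ hC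
  have hcomm : ∀ s ∈ LieSubalgebra.engel k h₀, ∀ t ∈ LieSubalgebra.engel k h₀,
      bracket (k := k) s.1 t.1 = 0 := fun s hs t ht => congrArg (fun z => z.1.1)
    (hab.trivial (⟨s, hs⟩ : LieSubalgebra.engel k h₀) ⟨t, ht⟩)
  have hdiag : ∀ t ∈ LieSubalgebra.engel k h₀,
      ⨆ μ, Module.End.eigenspace (bracket (k := k) t.1) μ = ⊤ := by
    intro t ht
    have hd := LieModule.iSup_eigenspace_of_mem_engel (W := OddPart k L)
      (exists_isCompl_of_isClassical hcl) hτ hC ht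
    have hodd : (grading (k := k) (L := L)).gr 1 ≤
        ⨆ μ, Module.End.eigenspace (bracket (k := k) t.1) μ := by
      intro y hy
      have hy' : (⟨y, hy⟩ : OddPart k L) ∈
          ⨆ μ, Module.End.eigenspace (LieModule.toEnd k (EvenPart k L) (OddPart k L) t) μ :=
        hd ▸ Submodule.mem_top
      refine (iSup_le fun μ v hv => ?_ : _ ≤ (⨆ μ, Module.End.eigenspace
        (bracket (k := k) t.1) μ).comap (Submodule.subtype _)) hy'
      exact Submodule.mem_iSup_of_mem μ (Module.End.mem_eigenspace_iff.2
        (congrArg Subtype.val (Module.End.mem_eigenspace_iff.1 hv)))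
    rw [eq_top_iff, ← (grading (k := k) (L := L)).isCompl.sup_eq_top]
    -- Diagonalizability on `L₁` extends to `L₀ = [L₁, L₁]`, since brackets of eigenvectors are
    -- eigenvectors.
    refine sup_le ((span_bracket_odd hcl.1 h1).trans (Submodule.span_le.2 ?_)) hodd
    rintro _ ⟨x, hx, y, hy, rfl⟩
    exact bracket_mem_iSup_eigenspace t.2 (hodd hx) (hodd hy)
  -- A generic `h`: whatever commutes with `h` commutes with the whole Cartan subalgebra.
  obtain ⟨_, ⟨h, hh, rfl⟩, hmin⟩ := exists_mem_ker_le_ker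
    ((LieSubalgebra.engel k h₀).toSubmodule.map (bracket (k := k) ∘ₗ Submodule.subtype _))
    (by
      rintro _ ⟨s, hs, rfl⟩ _ ⟨t, ht, rfl⟩
      refine LinearMap.ext fun x => ?_
      change bracket (k := k) s.1 (bracket (k := k) t.1 x) =
        bracket (k := k) t.1 (bracket (k := k) s.1 x)
      rw [bracket_bracket_even s.2, hcomm s hs t ht, map_zero, LinearMap.zero_apply, zero_add])
    (by
      rintro _ ⟨t, ht, rfl⟩
      exact hdiag t ht)
  have hker : ∀ t ∈ LieSubalgebra.engel k h₀, ∀ x, bracket (k := k) h.1 x = 0 →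
      bracket (k := k) t.1 x = 0 := fun t ht x hx => hmin _ ⟨t, ht, rfl⟩ hx
  -- Such an `x` commutes with `h₀`, so it lies in the Cartan subalgebra and kills all that `h`
  -- kills.
  have heven : ∀ x ∈ (grading (k := k) (L := L)).gr 0, bracket (k := k) h.1 x = 0 →
      ∀ y, bracket (k := k) h.1 y = 0 → bracket (k := k) x y = 0 := fun x hx hhx =>
    hker ⟨x, hx⟩ ((LieSubalgebra.mem_engel_iff k _ _).2 ⟨1, by
      rw [pow_one]
      exact Subtype.ext (hker h₀ (LieSubalgebra.self_mem_engel k h₀) x hhx)⟩)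
  refine ⟨h.1, h.2, hdiag h hh, fun x y hx hy => ?_⟩
  have hpx := fun i => (proj_bracket_even h.2 i x).symm.trans (by rw [hx, map_zero])
  have hpy := fun i => (proj_bracket_even h.2 i y).symm.trans (by rw [hy, map_zero])
  have hmx := fun i => (grading (k := k) (L := L)).proj_mem i x
  have hmy := fun i => (grading (k := k) (L := L)).proj_mem i y
  rw [← (grading (k := k) (L := L)).proj_add_proj x, map_add, LinearMap.add_apply,
    heven _ (hmx 0) (hpx 0) y hy, zero_add, ← (grading (k := k) (L := L)).proj_add_proj y, map_add,
    skew_even (hmy 0), heven _ (hmy 0) (hpy 0) _ (hpx 1), neg_zero, zero_add]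
  have hx₁ := hmx 1
  have hy₁ := hmy 1
  have hhx := hpx 1
  have hhy := hpy 1
  generalize (grading (k := k) (L := L)).proj 1 x = x₁ at hx₁ hhx ⊢
  generalize (grading (k := k) (L := L)).proj 1 y = y₁ at hy₁ hhy ⊢
  have hw := bracket_odd_odd hx₁ hy₁
  have hhw : bracket (k := k) (bracket (k := k) x₁ y₁) h.1 = 0 := by
    rw [skew_even h.2, bracket_bracket_even h.2, hhx, hhy]
    simp
  -- It remains to pair the even element `[x₁, y₁]` with the even part of an eigenvector `z` of
  -- eigenvalue `α`. If `α = 0`, invariance moves `z` onto `y₁`, which it kills; if `α ≠ 0`,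
  -- invariance under `h` makes `α` times the pairing zero.
  refine hB _ fun z => ?_
  have hz : z ∈ ⨆ μ, Module.End.eigenspace (bracket (k := k) h.1) μ :=
    hdiag h hh ▸ Submodule.mem_top
  refine (iSup_le fun α z hz => ?_ : _ ≤ LinearMap.ker (B (bracket (k := k) x₁ y₁))) hz
  rw [Module.End.mem_eigenspace_iff] at hz
  change B (bracket (k := k) x₁ y₁) z = 0
  have hz0 : bracket (k := k) h.1 ((grading (k := k)).proj 0 z) =
      α • (grading (k := k)).proj 0 z := by rw [← proj_bracket_even h.2, hz, map_smul]
  have hmz := (grading (k := k) (L := L)).proj_mem 0 z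
  rw [← (grading (k := k) (L := L)).proj_add_proj z, map_add,
    hBeven 0 1 (by decide) _ hw _ (SuperGrading.proj_mem _ 1 z), add_zero]
  by_cases hα : α = 0
  · rw [hα, zero_smul] at hz0
    rw [hBinv, skew_even hmz, heven _ hmz hz0 y₁ hhy, neg_zero, map_zero]
  · have h3 := hBinv (bracket (k := k) x₁ y₁) h.1 ((grading (k := k)).proj 0 z)
    rw [hhw, hz0, map_zero, LinearMap.zero_apply, map_smul, eq_comm, smul_eq_mul, mul_eq_zero] at h3
    exact h3.resolve_left hα

end EvenAction
end LieSuperalgebra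

/-! ### Central elements and the Heisenberg superalgebra -/

namespace SuperRep

variable {k : Type u} {L : Type v} [Field k] [AddCommGroup L] [Module k L] [LieSuperalgebra k L]

open LieSuperalgebra

/-- Schur's lemma for central even elements. -/
theorem IsIrreducible.exists_scalar_of_central [IsAlgClosed k] {M : SuperRep k L}
    (hM : M.IsIrreducible) {z : L} (hz : z ∈ (LieSuperalgebra.grading (k := k)).gr 0)
    (hc : ∀ x, bracket (k := k) z x = 0) : ∃ ζ : k, ∀ v, M.ρ z v = ζ • v := by
  have := hM.1
  obtain ⟨ζ, hζ⟩ := Module.End.exists_eigenvalue (M.ρ z)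
  have hcomm : ∀ x v, M.ρ x (M.ρ z v) = M.ρ z (M.ρ x v) := by
    have key : ∀ j, ∀ x ∈ (LieSuperalgebra.grading (k := k) (L := L)).gr j, ∀ v,
        M.ρ x (M.ρ z v) = M.ρ z (M.ρ x v) := fun j x hx v => by
      have h := M.ρ_bracket hz hx v
      rw [hc, map_zero, LinearMap.zero_apply, superSign_zero_left, one_smul, eq_comm,
        sub_eq_zero] at h
      exact h.symm
    intro x v
    rw [← (LieSuperalgebra.grading (k := k) (L := L)).proj_add_proj x]
    simp only [map_add, LinearMap.add_apply, key _ _ (SuperGrading.proj_mem _ _ x)]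
  refine ⟨ζ, fun v => ?_⟩
  have htop : Module.End.eigenspace (M.ρ z) ζ = ⊤ := by
    refine (hM.2 _ (fun u hu i => ?_) fun x u hu => ?_).resolve_left hζ
    · rw [Module.End.mem_eigenspace_iff] at hu ⊢
      have h := M.proj_ρ hz i u
      rw [add_zero, hu, map_smul] at h
      exact h.symm
    · rw [Module.End.mem_eigenspace_iff] at hu ⊢
      rw [← hcomm, hu, map_smul]
  exact Module.End.mem_eigenspace_iff.1 (htop ▸ Submodule.mem_top)

/-- The case of the Lie superalgebra with basis `z`, `e`, `f`, where `z` is even and central, `e`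
and `f` are odd, and the only non-zero bracket of basis elements is `[e, f] = z`. -/
theorem IsIrreducible.hasNoOddSymmetry_of_heisenberg [IsAlgClosed k] [CharZero k]
    {M : SuperRep k L} (hM : M.IsIrreducible) {z e f : L}
    (hz : z ∈ (LieSuperalgebra.grading (k := k)).gr 0)
    (he : e ∈ (LieSuperalgebra.grading (k := k)).gr 1)
    (hf : f ∈ (LieSuperalgebra.grading (k := k)).gr 1)
    (hc : ∀ x, bracket (k := k) z x = 0) (hee : bracket (k := k) e e = 0)
    (hff : bracket (k := k) f f = 0) (hef : bracket (k := k) e f = z)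
    (hspan : ∀ x : L, ∃ a b c : k, x = a • z + b • e + c • f) : M.HasNoOddSymmetry := by
  intro J hJodd hJ hJbij
  have := hM.1
  obtain ⟨ζ, hζ⟩ := hM.exists_scalar_of_central hz hc
  have hsq : ∀ x ∈ (LieSuperalgebra.grading (k := k) (L := L)).gr 1,
      bracket (k := k) x x = 0 → ∀ v, M.ρ x (M.ρ x v) = 0 := fun x hx hxx v => by
    have h := M.ρ_bracket hx hx v
    rw [hxx, map_zero, LinearMap.zero_apply, superSign_one_one, neg_one_smul, sub_neg_eq_add,
      ← two_smul k, eq_comm, smul_eq_zero] at h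
    exact h.resolve_left two_ne_zero
  obtain ⟨i, v, hv, hv0, hev⟩ : ∃ i, ∃ v ∈ M.grading.gr i, v ≠ 0 ∧ M.ρ e v = 0 := by
    obtain ⟨w, hw⟩ := exists_ne (0 : M.V)
    obtain ⟨i, w, hw, hw0⟩ : ∃ i, ∃ w ∈ M.grading.gr i, w ≠ 0 := by
      by_contra! h
      exact hw (by rw [← M.grading.proj_add_proj w, h 0 _ (M.grading.proj_mem 0 w),
        h 1 _ (M.grading.proj_mem 1 w), add_zero])
    by_cases h : M.ρ e w = 0
    · exact ⟨i, w, hw, hw0, h⟩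
    · exact ⟨1 + i, _, M.ρ_mem he hw, h, hsq e he hee w⟩
  have hfv : M.ρ f v ∈ M.grading.gr (i + 1) := add_comm 1 i ▸ M.ρ_mem hf hv
  have hefv : M.ρ e (M.ρ f v) = ζ • v := by
    have h := M.ρ_bracket he hf v
    rw [hef, hζ, hev, map_zero, smul_zero, sub_zero] at h
    exact h.symm
  -- As `e v = 0`, `f² = 0` and `e f v = ζ v`, this span is a graded subrepresentation.
  let S : Submodule k M.V := Submodule.span k {v, M.ρ f v}
  have hvS : v ∈ S := Submodule.subset_span (by simp)
  have hfvS : M.ρ f v ∈ S := Submodule.subset_span (by simp)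
  have hS : S = ⊤ := by
    refine (hM.2 S (fun u hu j => ?_) fun x u hu => ?_).resolve_left fun h =>
      hv0 ((Submodule.mem_bot k).1 (h ▸ hvS))
    · refine (Submodule.span_le (p := S.comap (M.grading.proj j))).2 ?_ hu
      rintro w (rfl | rfl)
      · exact SuperGrading.proj_mem_of_homogeneous _ hv hvS j
      · exact SuperGrading.proj_mem_of_homogeneous _ hfv hfvS j
    · refine (Submodule.span_le (p := S.comap (M.ρ x))).2 ?_ hu
      obtain ⟨a, b, c, rfl⟩ := hspan x
      have key : ∀ w ∈ S, M.ρ e w ∈ S → M.ρ f w ∈ S → M.ρ (a • z + b • e + c • f) w ∈ S := by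
        intro w hw h1 h2
        simp only [map_add, map_smul, LinearMap.add_apply, LinearMap.smul_apply, hζ]
        exact add_mem (add_mem (S.smul_mem _ (S.smul_mem _ hw)) (S.smul_mem _ h1)) (S.smul_mem _ h2)
      rintro w (rfl | rfl)
      · exact key _ hvS (by rw [hev]; exact zero_mem _) hfvS
      · exact key _ hfvS (by rw [hefv]; exact S.smul_mem _ hvS)
          (by rw [hsq f hf hff]; exact zero_mem _)
  obtain ⟨a, b, hab⟩ := Submodule.mem_span_pair.1 (hS ▸ Submodule.mem_top : J v ∈ S)
  have ha : a • v = 0 := by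
    refine M.grading.eq_zero_of_mem_of_mem (i := i) (j := i + 1)
      ((by decide : ∀ i : ZMod 2, i ≠ i + 1) i) (Submodule.smul_mem _ _ hv) ?_
    rw [eq_sub_of_add_eq hab]
    exact sub_mem (hJodd i v hv) (Submodule.smul_mem _ _ hfv)
  rw [ha, zero_add] at hab
  -- By parity `J v = b f v`, so `J² v = b² f² v = 0`.
  have hJJ : J (J v) = 0 := by
    rw [← hab, map_smul, hJ, ← hab, map_smul, hsq f hf hff, smul_zero, smul_zero]
  exact hv0 (hJbij.1 (hJbij.1 (by rw [hJJ, map_zero, map_zero])))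

end SuperRep

/-! ### The Lie superalgebra `𝔰𝔩(n,n)` -/

namespace LieSuperalgebra

section SpecialLinear

variable {k : Type*} {L : Type*} [Field k] [AddCommGroup L] [Module k L] [LieSuperalgebra k L]
  {n : ℕ} {e : L →ₗ[k] Matrix (Fin n ⊕ Fin n) (Fin n ⊕ Fin n) k}

/-- The odd component of `x` has zero diagonal blocks, and its off-diagonal blocks are those of `x`;
so it vanishes by injectivity. -/
theorem mem_even_of_blocks (he : Function.Injective e)
    (h0 : ∀ x ∈ (grading (k := k) (L := L)).gr 0,
      (e x).toBlocks₁₂ = 0 ∧ (e x).toBlocks₂₁ = 0)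
    (h1 : ∀ x ∈ (grading (k := k) (L := L)).gr 1,
      (e x).toBlocks₁₁ = 0 ∧ (e x).toBlocks₂₂ = 0) {x : L}
    (h12 : (e x).toBlocks₁₂ = 0) (h21 : (e x).toBlocks₂₁ = 0) :
    x ∈ (grading (k := k)).gr 0 := by
  have hp0 := h0 _ ((grading (k := k) (L := L)).proj_mem 0 x)
  have hp1 := h1 _ ((grading (k := k) (L := L)).proj_mem 1 x)
  have hx : e x = e ((grading (k := k)).proj 0 x) + e ((grading (k := k)).proj 1 x) := by
    rw [← map_add, SuperGrading.proj_add_proj]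
  have hz : e ((grading (k := k)).proj 1 x) = 0 := by
    rw [hx] at h12 h21
    ext (i | i) (j | j)
    · exact congrFun (congrFun hp1.1 i) j
    · have h := congrFun (congrFun h12 i) j
      have h' := congrFun (congrFun hp0.1 i) j
      simp only [Matrix.toBlocks₁₂, Matrix.of_apply, Matrix.add_apply, Matrix.zero_apply] at h h' ⊢
      rwa [h', zero_add] at h
    · have h := congrFun (congrFun h21 i) j
      have h' := congrFun (congrFun hp0.2 i) j
      simp only [Matrix.toBlocks₂₁, Matrix.of_apply, Matrix.add_apply, Matrix.zero_apply] at h h' ⊢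
      rwa [h', zero_add] at h
    · exact congrFun (congrFun hp1.2 i) j
  have : (grading (k := k)).proj 1 x = 0 := he (by rw [hz, map_zero])
  rw [← (grading (k := k) (L := L)).proj_add_proj x, this, add_zero]
  exact SuperGrading.proj_mem _ 0 x

theorem mem_odd_of_blocks (he : Function.Injective e)
    (h0 : ∀ x ∈ (grading (k := k) (L := L)).gr 0,
      (e x).toBlocks₁₂ = 0 ∧ (e x).toBlocks₂₁ = 0)
    (h1 : ∀ x ∈ (grading (k := k) (L := L)).gr 1,
      (e x).toBlocks₁₁ = 0 ∧ (e x).toBlocks₂₂ = 0) {x : L}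
    (h11 : (e x).toBlocks₁₁ = 0) (h22 : (e x).toBlocks₂₂ = 0) :
    x ∈ (grading (k := k)).gr 1 := by
  have hp0 := h0 _ ((grading (k := k) (L := L)).proj_mem 0 x)
  have hp1 := h1 _ ((grading (k := k) (L := L)).proj_mem 1 x)
  have hx : e x = e ((grading (k := k)).proj 0 x) + e ((grading (k := k)).proj 1 x) := by
    rw [← map_add, SuperGrading.proj_add_proj]
  have hz : e ((grading (k := k)).proj 0 x) = 0 := by
    rw [hx] at h11 h22
    ext (i | i) (j | j)
    · have h := congrFun (congrFun h11 i) j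
      have h' := congrFun (congrFun hp1.1 i) j
      simp only [Matrix.toBlocks₁₁, Matrix.of_apply, Matrix.add_apply, Matrix.zero_apply] at h h' ⊢
      rwa [h', add_zero] at h
    · exact congrFun (congrFun hp0.1 i) j
    · exact congrFun (congrFun hp0.2 i) j
    · have h := congrFun (congrFun h22 i) j
      have h' := congrFun (congrFun hp1.2 i) j
      simp only [Matrix.toBlocks₂₂, Matrix.of_apply, Matrix.add_apply, Matrix.zero_apply] at h h' ⊢
      rwa [h', add_zero] at h
  have : (grading (k := k)).proj 0 x = 0 := he (by rw [hz, map_zero])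
  rw [← (grading (k := k) (L := L)).proj_add_proj x, this, zero_add]
  exact SuperGrading.proj_mem _ 1 x

theorem map_bracket_even
    (hbr : ∀ i j, ∀ x ∈ (grading (k := k) (L := L)).gr i,
      ∀ y ∈ (grading (k := k) (L := L)).gr j,
      e (bracket (k := k) x y) = e x * e y - superSign k i j • (e y * e x)) {h : L}
    (hh : h ∈ (grading (k := k)).gr 0) (x : L) :
    e (bracket (k := k) h x) = e h * e x - e x * e h := by
  have key := fun i => hbr 0 i h hh _ ((grading (k := k) (L := L)).proj_mem i x)
  simp only [superSign_zero_left, one_smul] at key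
  rw [← (grading (k := k) (L := L)).proj_add_proj x]
  simp only [map_add, key, mul_add, add_mul]
  abel

/-- Distinct integers that are the diagonal entries of an element of `𝔰𝔩(n,n)`. -/
theorem exists_injective_sum_eq (hn : 2 ≤ n) : ∃ d : Fin n ⊕ Fin n → ℤ,
    Function.Injective d ∧ ∑ i, d (.inl i) = ∑ i, d (.inr i) := by
  -- Even numbers `0, 2, …` against odd numbers `1, 3, …`, whose sum is larger by `n`. Lowering the
  -- entry `1` to `1 - n`, negative for `n ≥ 2`, balances the sums and keeps the entries distinct.
  refine ⟨Sum.elim (fun i => 2 * (i : ℕ)) (fun i => 2 * (i : ℕ) + 1 -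
    if (⟨0, by omega⟩ : Fin n) = i then (n : ℤ) else 0), ?_, ?_⟩
  · rintro (i | i) (j | j) h <;>
      simp only [Sum.elim_inl, Sum.elim_inr, Fin.ext_iff] at h <;>
      simp only [Sum.inl.injEq, Sum.inr.injEq, Fin.ext_iff, reduceCtorEq] <;>
      omega
  · simp [Finset.sum_add_distrib, Finset.sum_sub_distrib]

theorem iSup_eigenspace_diagonal {m : Type*} [Fintype m] [DecidableEq m] (d : m → k) :
    ⨆ μ, Module.End.eigenspace (LinearMap.mulLeft k (Matrix.diagonal d) -
      LinearMap.mulRight k (Matrix.diagonal d)) μ = ⊤ := by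
  refine eq_top_iff.2 fun X _ => ?_
  rw [Matrix.matrix_eq_sum_single X]
  refine sum_mem fun i _ => sum_mem fun j _ => Submodule.mem_iSup_of_mem (d i - d j) ?_
  rw [Module.End.mem_eigenspace_iff]
  ext a b
  simp only [LinearMap.sub_apply, LinearMap.mulLeft_apply, LinearMap.mulRight_apply,
    Matrix.sub_apply, Matrix.diagonal_mul, Matrix.mul_diagonal, Matrix.smul_apply,
    Matrix.single_apply, smul_eq_mul]
  split_ifs with h
  · rw [h.1, h.2]; ring
  · simp

theorem exists_abelian_centralizer_of_isSpecialLinear [CharZero k] (hn : 2 ≤ n)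
    (hL : IsSpecialLinear k L n) :
    ∃ h ∈ (grading (k := k) (L := L)).gr 0,
      ⨆ μ, Module.End.eigenspace (bracket (k := k) h) μ = ⊤ ∧
      ∀ x y : L, bracket (k := k) h x = 0 → bracket (k := k) h y = 0 →
        bracket (k := k) x y = 0 := by
  obtain ⟨e, he, hrange, h0, h1, hbr⟩ := hL
  obtain ⟨d, hd, hsum⟩ := exists_injective_sum_eq hn
  have hdiag : ∀ c : Fin n ⊕ Fin n → k, (Matrix.diagonal c).toBlocks₁₂ = 0 ∧
      (Matrix.diagonal c).toBlocks₂₁ = 0 := fun c => by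
    constructor <;> ext i j <;> simp [Matrix.toBlocks₁₂, Matrix.toBlocks₂₁]
  have hmem : ∀ x c, e x = Matrix.diagonal c → x ∈ (grading (k := k)).gr 0 := fun x c hx =>
    mem_even_of_blocks he h0 h1 (by rw [hx]; exact (hdiag c).1) (by rw [hx]; exact (hdiag c).2)
  obtain ⟨h, hh⟩ : Matrix.diagonal (fun i => (d i : k)) ∈ Set.range e := by
    rw [hrange]
    simp only [Set.mem_ofPred_eq, Matrix.trace, Matrix.diag, Matrix.toBlocks₁₁, Matrix.toBlocks₂₂,
      Matrix.of_apply, Matrix.diagonal_apply_eq, sub_eq_zero]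
    exact_mod_cast hsum
  have hh0 := hmem h _ hh
  have hbrh := map_bracket_even hbr hh0
  rw [hh] at hbrh
  set T := LinearMap.mulLeft k (Matrix.diagonal fun i => (d i : k)) -
      LinearMap.mulRight k (Matrix.diagonal fun i => (d i : k)) with hT
  have hTe : ∀ x, T (e x) = e (bracket (k := k) h x) := fun x => (hbrh x).symm
  refine ⟨h, hh0, eq_top_iff.2 fun x _ => ?_, ?_⟩
  · have hst : ∀ X ∈ LinearMap.range e, T X ∈ LinearMap.range e := by
      rintro _ ⟨x, rfl⟩
      exact ⟨_, (hTe x).symm⟩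
    have hx : e x ∈ LinearMap.range e := ⟨x, rfl⟩
    -- A diagonalizable operator stays diagonalizable on a stable subspace, here the image of `L` in
    -- the matrices.
    rw [Submodule.eq_iSup_inf_genEigenspace 1 hst (iSup_eigenspace_diagonal _)] at hx
    have hle : ⨆ μ, LinearMap.range e ⊓ Module.End.genEigenspace T μ 1 ≤
        (⨆ μ, Module.End.eigenspace (bracket (k := k) h) μ).map e := by
      refine iSup_le fun μ => ?_
      rintro _ ⟨⟨y, rfl⟩, hy⟩
      refine ⟨y, Submodule.mem_iSup_of_mem μ (Module.End.mem_eigenspace_iff.2 (he ?_)), rfl⟩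
      rw [← hTe, map_smul]
      exact Module.End.mem_eigenspace_iff.1 hy
    obtain ⟨y, hy, hyx⟩ := hle hx
    rwa [← he hyx]
  -- The commutator with `h` multiplies the `(i, j)` entry by `d i - d j`, nonzero off the diagonal.
  · have hcent : ∀ x, bracket (k := k) h x = 0 → e x = Matrix.diagonal (fun i => e x i i) := by
      intro x hx
      have h2 := hbrh x
      rw [hx, map_zero] at h2
      ext i j
      have h3 := congrFun (congrFun h2 i) j
      rw [Matrix.sub_apply, Matrix.diagonal_mul, Matrix.mul_diagonal, Matrix.zero_apply,
        mul_comm (e x i j), ← sub_mul, eq_comm, mul_eq_zero, sub_eq_zero, Int.cast_inj] at h3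
      by_cases hij : i = j
      · rw [hij, Matrix.diagonal_apply_eq]
      · rw [Matrix.diagonal_apply_ne _ hij]
        exact h3.resolve_left fun h => hij (hd h)
    intro x y hx hy
    apply he
    rw [map_bracket_even hbr (hmem x _ (hcent x hx)), hcent x hx, hcent y hy,
      Matrix.diagonal_mul_diagonal, Matrix.diagonal_mul_diagonal, map_zero, sub_eq_zero]
    simp only [mul_comm]

end SpecialLinear

end LieSuperalgebra

/-! ### Absence of odd symmetries in all cases -/

namespace SuperRep

variable {k : Type u} {L : Type v} [Field k] [AddCommGroup L] [Module k L] [LieSuperalgebra k L]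

open LieSuperalgebra

theorem IsIrreducible.hasNoOddSymmetry_of_isSpecialLinear_one [IsAlgClosed k] [CharZero k]
    {M : SuperRep k L} (hM : M.IsIrreducible) (hL : IsSpecialLinear k L 1) :
    M.HasNoOddSymmetry := by
  obtain ⟨φ, hφ, hrange, h0, h1, hbr⟩ := hL
  have hex : ∀ X : Matrix (Fin 1 ⊕ Fin 1) (Fin 1 ⊕ Fin 1) k, X (.inl 0) (.inl 0) =
      X (.inr 0) (.inr 0) → ∃ x, φ x = X := fun X hX => by
    change X ∈ Set.range φ
    rw [hrange]
    simp [Matrix.trace, Matrix.toBlocks₁₁, Matrix.toBlocks₂₂, hX]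
  -- In `𝔰𝔩(1,1)` the identity is central and the two off-diagonal matrix units have it as their
  -- bracket.
  obtain ⟨z, hz⟩ := hex 1 rfl
  obtain ⟨e, he⟩ := hex (Matrix.fromBlocks 0 1 0 0) rfl
  obtain ⟨f, hf⟩ := hex (Matrix.fromBlocks 0 0 1 0) rfl
  have hz0 : z ∈ (LieSuperalgebra.grading (k := k)).gr 0 :=
    mem_even_of_blocks hφ h0 h1 (by rw [hz, ← Matrix.fromBlocks_one, Matrix.toBlocks_fromBlocks₁₂])
      (by rw [hz, ← Matrix.fromBlocks_one, Matrix.toBlocks_fromBlocks₂₁])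
  have he1 : e ∈ (LieSuperalgebra.grading (k := k)).gr 1 :=
    mem_odd_of_blocks hφ h0 h1 (by rw [he, Matrix.toBlocks_fromBlocks₁₁])
      (by rw [he, Matrix.toBlocks_fromBlocks₂₂])
  have hf1 : f ∈ (LieSuperalgebra.grading (k := k)).gr 1 :=
    mem_odd_of_blocks hφ h0 h1 (by rw [hf, Matrix.toBlocks_fromBlocks₁₁])
      (by rw [hf, Matrix.toBlocks_fromBlocks₂₂])
  refine hM.hasNoOddSymmetry_of_heisenberg hz0 he1 hf1 (fun x => hφ ?_) (hφ ?_) (hφ ?_) (hφ ?_)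
    fun x => ⟨φ x (.inl 0) (.inl 0), φ x (.inl 0) (.inr 0), φ x (.inr 0) (.inl 0), hφ ?_⟩
  · rw [map_bracket_even hbr hz0, hz, one_mul, mul_one, sub_self, map_zero]
  · rw [hbr 1 1 e he1 e he1, he, Matrix.fromBlocks_multiply]
    simp
  · rw [hbr 1 1 f hf1 f hf1, hf, Matrix.fromBlocks_multiply]
    simp
  · rw [hbr 1 1 e he1 f hf1, he, hf, hz, Matrix.fromBlocks_multiply, Matrix.fromBlocks_multiply,
      superSign_one_one, neg_one_smul, sub_neg_eq_add, Matrix.fromBlocks_add]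
    simp
  · have hx : φ x ∈ Set.range φ := ⟨x, rfl⟩
    rw [hrange] at hx
    simp only [Set.mem_ofPred_eq, Matrix.trace, Matrix.diag, Matrix.toBlocks₁₁, Matrix.toBlocks₂₂,
      Matrix.of_apply, Finset.univ_unique, Finset.sum_singleton, sub_eq_zero,
      Fin.default_eq_zero] at hx
    rw [map_add, map_add, map_smul, map_smul, map_smul, hz, he, hf]
    ext (i | i) (j | j) <;> obtain rfl := Subsingleton.elim i 0 <;>
      obtain rfl := Subsingleton.elim j 0 <;> simp [hx]

/-- No irreducible representation of one of the Lie superalgebras in question has an odd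
symmetry. -/
theorem IsIrreducible.hasNoOddSymmetry [IsAlgClosed k] [CharZero k] [FiniteDimensional k L]
    (hL : IsReductiveLie k L ∨ IsBasicClassical k L ∨ ∃ n : ℕ, 1 ≤ n ∧ IsSpecialLinear k L n)
    {M : SuperRep k L} (hM : M.IsIrreducible) : M.HasNoOddSymmetry := by
  by_cases h1 : (LieSuperalgebra.grading (k := k) (L := L)).gr 1 = ⊥
  · exact hM.hasNoOddSymmetry_of_odd_eq_bot h1
  rcases hL with hL | hL | ⟨n, hn, hL⟩
  · exact absurd hL.1 h1
  · obtain ⟨h, hh, hdiag, hab⟩ := exists_abelian_centralizer_of_isBasicClassical hL h1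
    exact hM.hasNoOddSymmetry_of_abelian_centralizer hh hdiag hab
  · obtain rfl | hn := hn.eq_or_lt
    · exact hM.hasNoOddSymmetry_of_isSpecialLinear_one hL
    · obtain ⟨h, hh, hdiag, hab⟩ := exists_abelian_centralizer_of_isSpecialLinear hn hL
      exact hM.hasNoOddSymmetry_of_abelian_centralizer hh hdiag hab

end SuperRep


/-! ### Contractions and cancellation of tensor factors -/

section Contraction

variable {k V W : Type*} [Field k] [AddCommGroup V] [Module k V] [AddCommGroup W] [Module k W]

/-- The contraction `v ⊗ w ↦ ψ(w) v`. -/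
noncomputable def tensorContract (V : Type*) [AddCommGroup V] [Module k V] (ψ : W →ₗ[k] k) :
    V ⊗[k] W →ₗ[k] V :=
  (TensorProduct.rid k V).toLinearMap ∘ₗ ψ.lTensor V

theorem tensorContract_tmul (ψ : W →ₗ[k] k) (v : V) (w : W) :
    tensorContract V ψ (v ⊗ₜ w) = ψ w • v := by
  simp [tensorContract]

theorem tensorContract_map (ψ : W →ₗ[k] k) (T : V →ₗ[k] V) (t : V ⊗[k] W) :
    tensorContract V ψ (TensorProduct.map T LinearMap.id t) = T (tensorContract V ψ t) := by
  induction t with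
  | zero => simp
  | add a b ha hb => simp only [map_add, ha, hb]
  | tmul v w => simp [tensorContract_tmul]

/-- A homogeneous `ψ` is wanted, so that contracting with it is a homogeneous map. Every functional
is the sum of its two homogeneous parts, and all functionals together detect `t`. -/
theorem exists_tensorContract_ne_zero [FiniteDimensional k W] (H : SuperGrading k W)
    {t : V ⊗[k] W} (ht : t ≠ 0) : ∃ (ψ : W →ₗ[k] k) (i : ZMod 2),
      (∀ j, i ≠ j → ∀ w ∈ H.gr j, ψ w = 0) ∧ tensorContract V ψ t ≠ 0 := by
  by_contra! hne
  have h0 : ∀ ψ : W →ₗ[k] k, tensorContract V ψ t = 0 := fun ψ => by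
    have key := fun i => hne (ψ ∘ₗ H.proj i) i fun j hij w hw => by
      rw [LinearMap.comp_apply, H.proj_of_mem_ne hij hw, map_zero]
    have hadd : ∀ s : V ⊗[k] W, tensorContract V ψ s =
        tensorContract V (ψ ∘ₗ H.proj 0) s + tensorContract V (ψ ∘ₗ H.proj 1) s := fun s => by
      induction s with
      | zero => simp
      | add a b ha hb => rw [map_add, ha, hb, map_add, map_add]; abel
      | tmul v w =>
        rw [tensorContract_tmul, tensorContract_tmul, tensorContract_tmul, ← add_smul,
          LinearMap.comp_apply, LinearMap.comp_apply, ← map_add, H.proj_add_proj]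
    rw [hadd, key, key, add_zero]
  let b := Module.finBasis k W
  have hsum : ∀ s : V ⊗[k] W, s = ∑ i, tensorContract V (b.coord i) s ⊗ₜ[k] b i := fun s => by
    induction s with
    | zero => simp
    | add x y hx hy =>
      simp only [map_add, TensorProduct.add_tmul, Finset.sum_add_distrib]
      rw [← hx, ← hy]
    | tmul v w =>
      simp only [tensorContract_tmul, TensorProduct.smul_tmul]
      rw [← TensorProduct.tmul_sum]
      congr 1
      exact (b.sum_repr w).symm
  exact ht (by rw [hsum t]; simp [h0])

theorem tmul_ne_zero_of_ne_zero [FiniteDimensional k W] {v : V} {w : W} (hv : v ≠ 0)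
    (hw : w ≠ 0) : v ⊗ₜ[k] w ≠ 0 := by
  intro h
  obtain ⟨ψ, hψ⟩ : ∃ ψ : W →ₗ[k] k, ψ w ≠ 0 := by
    by_contra! h0
    exact hw ((Module.forall_dual_apply_eq_zero_iff k w).1 h0)
  have := tensorContract_tmul ψ v w
  rw [h, map_zero, eq_comm, smul_eq_zero] at this
  exact this.elim hψ hv

end Contraction

namespace SuperRep

variable {k : Type u} {L : Type v} [Field k] [AddCommGroup L] [Module k L] [LieSuperalgebra k L]
  {L' : Type w} [AddCommGroup L'] [Module k L'] [LieSuperalgebra k L']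

/-- A graded subrepresentation `U` of `M` yields the graded subrepresentation `U ⊗ N`; contraction
with a functional on `N` recovers `U`. -/
theorem IsIrreducible.of_tensor_left {M N : SuperRep k L} (h : (tens M N).IsIrreducible) :
    M.IsIrreducible := by
  obtain ⟨hM, hN⟩ := (tensor_nontrivial M N).1 h.1
  obtain ⟨w, hw⟩ := exists_ne (0 : N.V)
  refine ⟨hM, fun U hU hst => ?_⟩
  let R : Submodule k (M.V ⊗[k] N.V) :=
    Submodule.span k (Set.image2 (fun u w => u ⊗ₜ[k] w) (U : Set M.V) Set.univ)
  have hR : ∀ u ∈ U, ∀ w, u ⊗ₜ[k] w ∈ R := fun u hu w =>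
    Submodule.subset_span ⟨u, hu, w, Set.mem_univ w, rfl⟩
  have hpar : ∀ u ∈ U, M.grading.parity u ∈ U := fun u hu =>
    sub_mem (hU u hu 0) (hU u hu 1)
  have hgr : (M.grading.tensor N.grading).IsGraded R := fun t ht i => by
    refine (Submodule.span_le (p := R.comap ((M.grading.tensor N.grading).proj i))).2 ?_ ht
    rintro _ ⟨u, hu, w, -, rfl⟩
    change (M.grading.tensor N.grading).proj i (u ⊗ₜ w) ∈ R
    have key : ∀ a b, (M.grading.tensor N.grading).proj i
        (M.grading.proj a u ⊗ₜ N.grading.proj b w) ∈ R := fun a b =>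
      SuperGrading.proj_mem_of_homogeneous _ (SuperGrading.tmul_mem _ _
        (M.grading.proj_mem a u) (N.grading.proj_mem b w)) (hR _ (hU u hu a) _) i
    rw [← M.grading.proj_add_proj u, ← N.grading.proj_add_proj w, TensorProduct.add_tmul,
      TensorProduct.tmul_add, TensorProduct.tmul_add]
    simp only [map_add]
    exact add_mem (add_mem (key 0 0) (key 0 1)) (add_mem (key 1 0) (key 1 1))
  have hstab : ∀ x, ∀ t ∈ R, tensorρ M N x t ∈ R := fun x t ht => by
    refine (Submodule.span_le (p := R.comap (tensorρ M N x))).2 ?_ ht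
    rintro _ ⟨u, hu, w, -, rfl⟩
    exact add_mem (add_mem (hR _ (hst x u hu) _) (hR _ hu _)) (hR _ (hpar u hu) _)
  rcases h.2 R hgr hstab with h | h
  · left
    rw [Submodule.eq_bot_iff]
    intro u hu
    by_contra h0
    exact tmul_ne_zero_of_ne_zero h0 hw ((Submodule.mem_bot k).1 (h ▸ hR u hu w))
  · right
    rw [Submodule.eq_top_iff']
    intro v
    obtain ⟨ψ, hψ⟩ : ∃ ψ : N.V →ₗ[k] k, ψ w ≠ 0 := by
      by_contra! h0
      exact hw ((Module.forall_dual_apply_eq_zero_iff k w).1 h0)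
    have hle : R ≤ U.comap (tensorContract M.V ψ) := by
      refine Submodule.span_le.2 ?_
      rintro _ ⟨u, hu, w, -, rfl⟩
      change tensorContract M.V ψ (u ⊗ₜ w) ∈ U
      rw [tensorContract_tmul]
      exact U.smul_mem _ hu
    have hv : tensorContract M.V ψ (v ⊗ₜ w) ∈ U := hle (h ▸ Submodule.mem_top)
    rw [tensorContract_tmul] at hv
    exact (U.smul_mem_iff hψ).1 hv

theorem IsIrreducible.of_tensor_right {M N : SuperRep k L} (h : (tens M N).IsIrreducible) :
    N.IsIrreducible :=
  ((Iso.tensor_comm M N).isIrreducible h).of_tensor_left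

theorem IsIrreducible.of_pullback {M : SuperRep k L'} {f : LieSuperalgebra.Hom k L L'}
    (h : (M.pullback f).IsIrreducible) : M.IsIrreducible :=
  ⟨h.1, fun U hU hst => h.2 U hU fun x v hv => hst (f.toLinearMap x) v hv⟩

theorem Iso.trivial_pullback (f : LieSuperalgebra.Hom k L L') :
    ((trivial k L').pullback f).Iso (trivial k L) := Iso.refl (trivial k L)

/-- Irreducible representations `M`, `M'` of `L'` are isomorphic if tensor products of their
pullbacks with representations `N`, `N'` are, provided that each element of `L'` is the image of
one that annihilates `N` and `N'`. -/
theorem Iso.of_tensor_iso {M M' : SuperRep k L'} (hM : M.IsIrreducible) (hM' : M'.IsIrreducible)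
    {f : LieSuperalgebra.Hom k L L'} {N N' : SuperRep k L} [Nontrivial N.V]
    (h : (tens (M.pullback f) N).Iso (tens (M'.pullback f) N'))
    (hf : ∀ y, ∃ x, f.toLinearMap x = y ∧
      ∀ i, N.ρ ((LieSuperalgebra.grading (k := k)).proj i x) = 0 ∧
        N'.ρ ((LieSuperalgebra.grading (k := k)).proj i x) = 0) : M.Iso M' := by
  obtain ⟨e, ⟨p, hp⟩, he⟩ := h
  have := hM.1
  obtain ⟨v₀, hv₀⟩ := exists_ne (0 : M.V)
  obtain ⟨j, w, hw, -, hw0⟩ := N.grading.exists_homogeneous_ne_zero (U := ⊤)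
    (fun _ _ _ => Submodule.mem_top) top_ne_bot
  have ht : e (v₀ ⊗ₜ w) ≠ 0 := by
    rw [Ne, LinearEquiv.map_eq_zero_iff]
    exact tmul_ne_zero_of_ne_zero hv₀ hw0
  obtain ⟨ψ, i, hψ, hne⟩ := exists_tensorContract_ne_zero (V := M'.V) N'.grading ht
  -- `w` and `ψ` are homogeneous, so `T` is homogeneous; they are chosen so that `T v₀ ≠ 0`.
  let T : M.V →ₗ[k] M'.V :=
    tensorContract M'.V ψ ∘ₗ e.toLinearMap ∘ₗ (TensorProduct.mk k M.V N.V).flip w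
  have hT : ∀ v, T v = tensorContract M'.V ψ (e (v ⊗ₜ w)) := fun v => rfl
  have hcon : ∀ n, ∀ t ∈ (M'.grading.tensor N'.grading).gr n,
      tensorContract M'.V ψ t ∈ M'.grading.gr (n + i) := fun n t ht => by
    refine SuperGrading.tensor_map_mem M'.grading N'.grading M'.grading (fun a b v hv w hw => ?_) ht
    rw [tensorContract_tmul]
    by_cases hib : i = b
    · subst hib
      rw [(by decide : ∀ a i : ZMod 2, a + i + i = a) a i]
      exact Submodule.smul_mem _ _ hv
    · rw [hψ b hib w hw, zero_smul]
      exact zero_mem _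
  have hTdeg : ∀ a, ∀ v ∈ M.grading.gr a, T v ∈ M'.grading.gr (a + (j + p + i)) := fun a v hv => by
    have h1 := hcon _ _ (hp _ _ (SuperGrading.tmul_mem M.grading N.grading hv hw))
    rwa [← add_assoc, ← add_assoc]
  have hTρ : ∀ y v, T (M.ρ y v) = M'.ρ y (T v) := fun y v => by
    -- This `x` acts on the left factors only, and contraction of the right factor commutes with
    -- that.
    obtain ⟨x, rfl, hx⟩ := hf y
    have h1 : (tens (M.pullback f) N).ρ x = TensorProduct.map ((M.pullback f).ρ x) LinearMap.id :=
      tensorρ_of_right_eq_zero (M.pullback f) N fun i => (hx i).1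
    have h2 : (tens (M'.pullback f) N').ρ x =
        TensorProduct.map ((M'.pullback f).ρ x) LinearMap.id :=
      tensorρ_of_right_eq_zero (M'.pullback f) N' fun i => (hx i).2
    have h3 := he x (v ⊗ₜ w)
    rw [h1, h2] at h3
    exact (congrArg (tensorContract M'.V ψ) h3).trans (tensorContract_map ψ (M'.ρ _) _)
  have hT0 : T ≠ 0 := fun h0 => hne (LinearMap.congr_fun h0 v₀)
  have hbij := hM.bijective_of_ne_zero hM' T hTdeg hTρ hT0
  exact ⟨LinearEquiv.ofBijective T hbij, ⟨_, hTdeg⟩, hTρ⟩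

end SuperRep

/-! ### Bijectivity of `Ψ ↦ ev^Γ_Ψ` -/

section Evaluation

open LieSuperalgebra

variable {Γ : Type*} [Group Γ] {k : Type u} [Field k]
  {g : Type*} [AddCommGroup g] [Module k g] [LieSuperalgebra k g] [LieSuperalgebra.Action Γ k g]
  {A : Type*} [CommRing A] [Algebra k A] [MulSemiringAction Γ A] [SMulCommClass Γ k A]

theorem isIrreducible_of_evalRep {l : List (RatPoint k A × SuperRep k g)}
    (h : (evalRep Γ l).IsIrreducible) : ∀ p ∈ l, p.2.IsIrreducible := by
  induction l with
  | nil => simp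
  | cons q l ih =>
    intro p hp
    rw [List.mem_cons] at hp
    rcases hp with rfl | hp
    · exact SuperRep.IsIrreducible.of_pullback (f := evalHom Γ p.1)
        (SuperRep.IsIrreducible.of_tensor_left (N := evalRep Γ l) h)
    · exact ih (SuperRep.IsIrreducible.of_tensor_right (M := q.2.pullback (evalHom Γ q.1)) h) p hp

theorem iso_of_evalRep_cons_iso [Finite Γ]
    (hfree : ∀ (γ : Γ) (m : RatPoint k A), γ • m = m → γ = 1) {m : RatPoint k A}
    {M M' : SuperRep k g} (hM : M.IsIrreducible) (hM' : M'.IsIrreducible)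
    {l l' : List (RatPoint k A × SuperRep k g)} (hl : ∀ q ∈ l, ∀ γ : Γ, γ • m ≠ q.1)
    (hl' : ∀ q ∈ l', ∀ γ : Γ, γ • m ≠ q.1) (hn : Nontrivial (evalRep Γ l).V)
    (h : (evalRep Γ ((m, M) :: l)).Iso (evalRep Γ ((m, M') :: l'))) : M.Iso M' := by
  refine SuperRep.Iso.of_tensor_iso hM hM' (f := evalHom Γ m) h fun y => ?_
  obtain ⟨x, -, h1, h2⟩ := exists_evalHom_eq hfree m ((l ++ l').map Prod.fst) (fun n hn => by
    obtain ⟨q, hq, rfl⟩ := List.mem_map.1 hn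
    exact (List.mem_append.1 hq).elim (hl q) (hl' q)) y
  refine ⟨x, h1, fun i => ⟨?_, ?_⟩⟩ <;> refine evalRep_ρ_eq_zero _ fun q hq => ?_ <;>
    rw [Hom.map_proj, h2 _ (List.mem_map_of_mem (by simp [hq])), map_zero]

theorem RepClass.twist_trivial (γ : Γ) :
    (RepClass.mk (SuperRep.trivial k g)).twist γ = RepClass.mk (SuperRep.trivial k g) := rfl

theorem RepClass.twist_eq_trivial_iff {γ : Γ} {c : RepClass k g} :
    c.twist γ = RepClass.mk (SuperRep.trivial k g) ↔ c = RepClass.mk (SuperRep.trivial k g) := by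
  refine ⟨fun h => ?_, fun h => by rw [h, twist_trivial]⟩
  rw [← c.twist_one (Γ := Γ), ← inv_mul_cancel γ, twist_mul, h, twist_trivial]

namespace EquivariantFun

theorem smul_mem_support {Ψ : EquivariantFun Γ k g A} {γ : Γ} {m : RatPoint k A} :
    γ • m ∈ Ψ.support ↔ m ∈ Ψ.support := by
  change Ψ.toFun (γ • m) ≠ _ ↔ Ψ.toFun m ≠ _
  rw [Ψ.equivariant, Ne, RepClass.twist_eq_trivial_iff]

/-- `ev^Γ_Ψ` can be written with a factor at any given point. -/
theorem exists_evalClass_eq_cons (Ψ : EquivariantFun Γ k g A) (m : RatPoint k A) :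
    ∃ (M : SuperRep k g) (l : List (RatPoint k A × SuperRep k g)), RepClass.mk M = Ψ.toFun m ∧
      (∀ q ∈ l, ∀ γ : Γ, γ • m ≠ q.1) ∧ (∀ q ∈ l, q.2.IsIrreducible) ∧
      RepClass.mk (evalRep Γ ((m, M) :: l)) = Ψ.evalClass := by
  obtain ⟨l, hl⟩ := Ψ.exists_presents
  have hirr : ∀ q ∈ l, q.2.IsIrreducible := fun q hq => by
    have := Ψ.isIrreducible q.1
    rwa [← hl.2.2.2 q hq] at this
  rw [← Ψ.evalClass_eq hl]
  by_cases hm : m ∈ Ψ.support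
  · obtain ⟨p, hp, γ, hγ⟩ := hl.2.2.1 m hm
    obtain ⟨s, t, rfl⟩ := List.append_of_mem hp
    have hperm : (s ++ p :: t).Perm (p :: (s ++ t)) := List.perm_middle
    have hpw := (hperm.pairwise_iff fun {a b} h δ hδ => h δ⁻¹ (by rw [← hδ, inv_smul_smul])).1 hl.1
    rw [List.pairwise_cons] at hpw
    obtain ⟨M, hM⟩ := (Ψ.toFun m).exists_mk_eq
    refine ⟨M, s ++ t, hM, fun q hq δ hδ => hpw.1 q hq (δ * γ) (by rw [mul_smul, hγ, hδ]),
      fun q hq => hirr q (hperm.mem_iff.2 (List.mem_cons_of_mem _ hq)), RepClass.mk_eq_mk_iff.2 ?_⟩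
    refine SuperRep.Iso.trans (evalRep_cons_congr (q := p) ?_ (SuperRep.Iso.refl _))
      (evalRep_perm hperm.symm)
    refine pullback_evalHom_of_twist hγ ?_
    rw [hl.2.2.2 p hp, ← Ψ.equivariant, hγ, hM]
  -- Off the support the value is trivial, and a trivial factor can be inserted at `m` without
  -- changing the class.
  · refine ⟨SuperRep.trivial k g, l, (not_not.1 hm).symm, fun q hq γ h => hm ?_, hirr,
      RepClass.mk_eq_mk_iff.2 ?_⟩
    · rw [← smul_mem_support (γ := γ), h]
      exact hl.2.1 q hq
    · exact SuperRep.Iso.trans (SuperRep.Iso.tensor_left (evalRep Γ l)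
        (SuperRep.Iso.trivial_pullback (evalHom Γ m))) (SuperRep.Iso.trivial_tensor _)

/-- At each point `m` both classes are written with a factor at `m`, and the remaining factors, on
other orbits, are cancelled by `iso_of_evalRep_cons_iso`. -/
theorem evalClass_injective [Finite Γ]
    (hfree : ∀ (γ : Γ) (m : RatPoint k A), γ • m = m → γ = 1) :
    Function.Injective (evalClass : EquivariantFun Γ k g A → _) := by
  intro Ψ Ψ' h
  have hfun : Ψ.toFun = Ψ'.toFun := funext fun m => by
    obtain ⟨M, l, hM, hl, hirr, he⟩ := Ψ.exists_evalClass_eq_cons m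
    obtain ⟨M', l', hM', hl', -, he'⟩ := Ψ'.exists_evalClass_eq_cons m
    have h1 := Ψ.isIrreducible m
    have h2 := Ψ'.isIrreducible m
    rw [← hM] at h1 ⊢
    rw [← hM'] at h2 ⊢
    exact RepClass.mk_eq_mk_iff.2 (iso_of_evalRep_cons_iso hfree h1 h2 hl hl'
      (evalRep_nontrivial fun q hq => (hirr q hq).1)
      (RepClass.mk_eq_mk_iff.1 (he.trans (h.trans he'.symm))))
  cases Ψ
  cases Ψ'
  cases hfun
  rfl

end EquivariantFun

/-- Factors at points of the same orbit can be merged. -/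
theorem exists_pairwise_evalRep_iso (l : List (RatPoint k A × SuperRep k g)) :
    ∃ l' : List (RatPoint k A × SuperRep k g),
      l'.Pairwise (fun p q => ∀ γ : Γ, γ • p.1 ≠ q.1) ∧ (evalRep Γ l).Iso (evalRep Γ l') := by
  induction l with
  | nil => exact ⟨[], List.Pairwise.nil, SuperRep.Iso.refl _⟩
  | cons p l ih =>
    obtain ⟨l', hl', hiso⟩ := ih
    by_cases h : ∀ q ∈ l', ∀ γ : Γ, γ • p.1 ≠ q.1
    · exact ⟨p :: l', List.pairwise_cons.2 ⟨h, hl'⟩, SuperRep.Iso.tensor_right _ hiso⟩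
    · push Not at h
      obtain ⟨q, hq, γ, hγ⟩ := h
      obtain ⟨s, t, rfl⟩ := List.append_of_mem hq
      have hperm : (s ++ q :: t).Perm (q :: (s ++ t)) := List.perm_middle
      rw [hperm.pairwise_iff fun {a b} h δ hδ => h δ⁻¹ (by rw [← hδ, inv_smul_smul]),
        List.pairwise_cons] at hl'
      -- The factor at `p.1` is moved to `q.1` by a twist, and there two representations of `g`
      -- become one tensor product.
      let P := p.2.pullback (actionHom k g γ⁻¹)
      refine ⟨(q.1, SuperRep.tens P q.2) :: (s ++ t), List.pairwise_cons.2 hl',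
        SuperRep.Iso.trans (evalRep_cons_congr (q := (q.1, P)) ?_
          (hiso.trans (evalRep_perm hperm))) ?_⟩
      · have := pullback_evalHom_smul γ p.1 p.2
        rw [hγ] at this
        exact this.symm
      · exact (SuperRep.Iso.tensor_assoc (P.pullback (evalHom Γ q.1))
          (q.2.pullback (evalHom Γ q.1)) (evalRep Γ (s ++ t))).symm.trans
          (SuperRep.Iso.tensor_left _ (SuperRep.Iso.pullback_tensor P q.2 (evalHom Γ q.1)))

open Classical in
/-- Trivial factors can be left out. -/
theorem evalRep_iso_filter (l : List (RatPoint k A × SuperRep k g)) : (evalRep Γ l).Iso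
    (evalRep Γ (l.filter fun p => RepClass.mk p.2 ≠ RepClass.mk (SuperRep.trivial k g))) := by
  induction l with
  | nil => exact SuperRep.Iso.refl _
  | cons p l ih =>
    by_cases h : RepClass.mk p.2 = RepClass.mk (SuperRep.trivial k g)
    · rw [List.filter_cons_of_neg (by simpa using h)]
      refine SuperRep.Iso.trans (SuperRep.Iso.tensor_left (evalRep Γ l)
        (((RepClass.mk_eq_mk_iff.1 h).pullback _).trans
          (SuperRep.Iso.trivial_pullback (evalHom Γ p.1)))) ?_
      exact (SuperRep.Iso.trivial_tensor _).trans ih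
    · rw [List.filter_cons_of_pos (by simpa using h)]
      exact SuperRep.Iso.tensor_right _ ih

namespace EquivariantFun

open Classical in
/-- The equivariant function with given values at points of different orbits, and trivial values at
the points of all other orbits. -/
theorem exists_toFun_eq [Finite Γ] (hfree : ∀ (γ : Γ) (m : RatPoint k A), γ • m = m → γ = 1)
    {l : List (RatPoint k A × SuperRep k g)}
    (hl : l.Pairwise (fun p q => ∀ γ : Γ, γ • p.1 ≠ q.1)) (hirr : ∀ p ∈ l, p.2.IsIrreducible) :
    ∃ Ψ : EquivariantFun Γ k g A, (∀ p ∈ l, Ψ.toFun p.1 = RepClass.mk p.2) ∧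
      ∀ m ∈ Ψ.support, ∃ p ∈ l, ∃ γ : Γ, γ • p.1 = m := by
  have : Std.Symm fun p q : RatPoint k A × SuperRep k g => ∀ γ : Γ, γ • p.1 ≠ q.1 :=
    ⟨fun a b h ε hε => h ε⁻¹ (by rw [← hε, inv_smul_smul])⟩
  let F : RatPoint k A → RepClass k g := fun m =>
    if h : ∃ q : (RatPoint k A × SuperRep k g) × Γ, q.1 ∈ l ∧ q.2 • q.1.1 = m then
      (RepClass.mk h.choose.1.2).twist h.choose.2 else RepClass.mk (SuperRep.trivial k g)
  have hF : ∀ p ∈ l, ∀ γ : Γ, F (γ • p.1) = (RepClass.mk p.2).twist γ := by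
    intro p hp γ
    have h : ∃ q : (RatPoint k A × SuperRep k g) × Γ, q.1 ∈ l ∧ q.2 • q.1.1 = γ • p.1 :=
      ⟨(p, γ), hp, rfl⟩
    simp only [F, dif_pos h]
    obtain ⟨h1, h2⟩ := h.choose_spec
    generalize h.choose = q at h1 h2
    obtain ⟨q, δ⟩ := q
    have hqp : q = p := by
      by_contra hne
      exact hl.forall h1 hp hne (γ⁻¹ * δ) (by rw [mul_smul, h2, inv_smul_smul])
    subst hqp
    -- Freeness makes the group element unique, so the value does not depend on the choice made in
    -- `F`.
    have h3 : γ⁻¹ * δ = 1 := hfree _ q.1 (by rw [mul_smul, h2, inv_smul_smul])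
    rw [inv_mul_eq_one.1 h3]
  have hF0 : ∀ m, (¬ ∃ p ∈ l, ∃ γ : Γ, γ • p.1 = m) →
      F m = RepClass.mk (SuperRep.trivial k g) := fun m hm =>
    dif_neg fun ⟨q, hq, h⟩ => hm ⟨q.1, hq, q.2, h⟩
  have hsupp : ∀ m, F m ≠ RepClass.mk (SuperRep.trivial k g) →
      ∃ p ∈ l, ∃ γ : Γ, γ • p.1 = m := fun m hm => by
    by_contra h
    exact hm (hF0 m h)
  refine ⟨⟨F, fun m => ?_, ?_, fun γ m => ?_⟩, fun p hp => ?_, hsupp⟩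
  · by_cases hm : ∃ p ∈ l, ∃ γ : Γ, γ • p.1 = m
    · obtain ⟨p, hp, γ, rfl⟩ := hm
      rw [hF p hp]
      exact RepClass.twist_isIrreducible γ (hirr p hp)
    · rw [hF0 m hm]
      have : Nontrivial (SuperRep.trivial k g).V := inferInstanceAs (Nontrivial k)
      exact SuperRep.isDense_trivial.isIrreducible
  · refine Set.Finite.subset (Set.Finite.image2 (fun (γ : Γ) p => γ • p.1) Set.finite_univ
      (List.finite_toSet l)) fun m hm => ?_
    obtain ⟨p, hp, γ, h⟩ := hsupp m hm
    exact ⟨γ, trivial, p, hp, h⟩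
  · by_cases hm : ∃ p ∈ l, ∃ γ : Γ, γ • p.1 = m
    · obtain ⟨p, hp, δ, rfl⟩ := hm
      rw [← mul_smul, hF p hp, hF p hp, RepClass.twist_mul]
    · rw [hF0 m hm, hF0, RepClass.twist_trivial]
      rintro ⟨p, hp, δ, h⟩
      exact hm ⟨p, hp, γ⁻¹ * δ, by rw [mul_smul, h, inv_smul_smul]⟩
  · have := hF p hp 1
    rwa [one_smul, RepClass.twist_one] at this

/-- After merging, the points lie on distinct orbits and all factors are irreducible, so they define
an equivariant function. Factors that are trivial, or became so, are filtered out since its support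
omits them. -/
theorem exists_evalClass_eq [Finite Γ]
    (hfree : ∀ (γ : Γ) (m : RatPoint k A), γ • m = m → γ = 1)
    (l : List (RatPoint k A × SuperRep k g)) (h : (evalRep Γ l).IsIrreducible) :
    ∃ Ψ : EquivariantFun Γ k g A, Ψ.evalClass = RepClass.mk (evalRep Γ l) := by
  classical
  obtain ⟨l₁, hl₁, hiso⟩ := exists_pairwise_evalRep_iso (Γ := Γ) l
  have hirr := isIrreducible_of_evalRep (hiso.isIrreducible h)
  obtain ⟨Ψ, hΨ, hsupp⟩ := exists_toFun_eq hfree hl₁ hirr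
  refine ⟨Ψ, ?_⟩
  rw [RepClass.mk_eq_mk_iff.2 (hiso.trans (evalRep_iso_filter l₁)), eq_comm]
  refine Ψ.evalClass_eq ⟨hl₁.filter _, fun p hp => ?_, fun m hm => ?_, fun p hp => ?_⟩
  · rw [List.mem_filter, decide_eq_true_iff] at hp
    change Ψ.toFun p.1 ≠ _
    rw [hΨ p hp.1]
    exact hp.2
  · obtain ⟨p, hp, γ, rfl⟩ := hsupp m hm
    refine ⟨p, List.mem_filter.2 ⟨hp, decide_eq_true_iff.2 ?_⟩, γ, rfl⟩
    rw [← hΨ p hp]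
    exact smul_mem_support.1 hm
  · rw [List.mem_filter] at hp
    exact (hΨ p hp.1).symm

theorem evalClass_isIrreducible [IsAlgClosed k] [CharZero k] [FiniteDimensional k g] [Finite Γ]
    (hfree : ∀ (γ : Γ) (m : RatPoint k A), γ • m = m → γ = 1)
    (hg : IsReductiveLie k g ∨ IsBasicClassical k g ∨ ∃ n : ℕ, 1 ≤ n ∧ IsSpecialLinear k g n)
    (Ψ : EquivariantFun Γ k g A) : Ψ.evalClass.IsIrreducible := by
  obtain ⟨l, hl⟩ := Ψ.exists_presents
  rw [← Ψ.evalClass_eq hl]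
  have hirr : ∀ p ∈ l, p.2.IsIrreducible := fun p hp => by
    have := Ψ.isIrreducible p.1
    rwa [← hl.2.2.2 p hp] at this
  have : Nontrivial (evalRep Γ l).V := evalRep_nontrivial fun p hp => (hirr p hp).1
  exact (evalRep_isDense hfree hl.1 fun p hp =>
    (hirr p hp).isDense ((hirr p hp).hasNoOddSymmetry hg)).isIrreducible

theorem evalClass_isEvaluation (Ψ : EquivariantFun Γ k g A) : Ψ.evalClass.IsEvaluation := by
  obtain ⟨l, hl⟩ := Ψ.exists_presents
  refine ⟨l, ?_, Ψ.evalClass_eq hl⟩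
  rw [List.Nodup, List.pairwise_map]
  exact hl.1.imp fun h h' => h 1 (by rw [one_smul, h'])

end EquivariantFun

end Evaluation

theorem mainTheorem11 {k : Type*} [Field k] [IsAlgClosed k] [CharZero k]
    {Γ : Type*} [Group Γ] [Finite Γ]
    {g : Type*} [AddCommGroup g] [Module k g] [FiniteDimensional k g]
    [LieSuperalgebra k g] [LieSuperalgebra.Action Γ k g]
    {A : Type*} [CommRing A] [Algebra k A] [Algebra.FiniteType k A]
    [MulSemiringAction Γ A] [SMulCommClass Γ k A]
    (hfree : ∀ (γ : Γ) (m : RatPoint k A), γ • m = m → γ = 1)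
    (hg : LieSuperalgebra.IsReductiveLie k g ∨ LieSuperalgebra.IsBasicClassical k g ∨
      ∃ n : ℕ, 1 ≤ n ∧ LieSuperalgebra.IsSpecialLinear k g n) :
    (∀ (Ψ : EquivariantFun Γ k g A) (l : List (RatPoint k A × SuperRep k g)),
      Ψ.Presents l → RepClass.mk (evalRep Γ l) = Ψ.evalClass) ∧
    (∀ Ψ : EquivariantFun Γ k g A, Ψ.evalClass.IsIrreducible) ∧
    Set.BijOn (fun Ψ : EquivariantFun Γ k g A => Ψ.evalClass) Set.univ
      {c | c.IsIrreducible ∧ c.IsEvaluation} := by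
  refine ⟨fun Ψ l h => Ψ.evalClass_eq h, fun Ψ => Ψ.evalClass_isIrreducible hfree hg,
    fun Ψ _ => ⟨Ψ.evalClass_isIrreducible hfree hg, Ψ.evalClass_isEvaluation⟩,
    (EquivariantFun.evalClass_injective hfree).injOn, ?_⟩
  rintro _ ⟨hirr, l, -, rfl⟩
  obtain ⟨Ψ, hΨ⟩ := EquivariantFun.exists_evalClass_eq hfree l hirr
  exact ⟨Ψ, trivial, hΨ⟩
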